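/- Let $X\sim N(\theta,\sigma^2)$ with $\theta\in\mathbb R$, $\sigma>0$, let $t<T$ be real numbers and $c>0$, and let $Y$ be the left-truncated, right-censored payment-per-payment variable $$Y=c\,(\min\{X,T\}-t)\,\mid\,X>t ,$$ that is, $Y$ has the law of $c(\min\{X,T\}-t)$ under the conditional probability given $X>t$. Let $Y_1,Y_2,\dots$ be i.i.d. copies of $Y$. Write $F_X$ for the distribution function of $X$, $F_Y^{-1}$ for the quantile function of $Y$, $\Phi$, $\phi$ for the standard normal distribution function and density, $\bar s=1-s$, $h_Y(y)=y/c+t$, and $s^*=\dfrac{F_X(T)-F_X(t)}{1-F_X(t)}$. Let the winsorizing proportions $a,b$ satisfy $$0\le a<1-b<s^* .$$ **Moments.** Let $m_n,m_n^*$ be nonnegative (possibly data-dependent) integers with $\sqrt n\,(m_n/n-a)\to0$ and $\sqrt n\,(m_n^*/n-b)\to0$ in probability (for example $m_n=[na]$ and $m_n^*=[nb]$, or $m_n^*=\max\{[nb],\#\{i\le n:Y_i=c(T-t)\}\}$). With the order statistics $y_{1:n}\le\dots\le y_{n:n}$ of $Y_1,\dots,Y_n$ put $$\widehat W_k=\frac1n\Big[m_n\,h_Y(y_{m_n+1:n})^k+\sum_{i=m_n+1}^{n-m_n^*}h_Y(y_{i:n})^k+m_n^*\,h_Y(y_{n-m_n^*:n})^k\Big],\qquad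 k=1,2$$ (an order statistic whose index is not in $\{1,\dots,n\}$ is read as $0$), and $$W_{y,k}=a\,h_Y(F_Y^{-1}(a))^k+\int_a^{\bar b}h_Y(F_Y^{-1}(v))^k\,dv+b\,h_Y(F_Y^{-1}(\bar b))^k .$$ **Estimator.** For $\gamma=(t-\theta)/\sigma$ put $\Delta_s=\Phi^{-1}(s+\bar s\,\Phi(\gamma))$ and $$c_{y,k}=a\Delta_a^k+\int_a^{\bar b}\Delta_s^k\,ds+b\Delta_{\bar b}^k ,$$ a function of $a,b,\theta,\sigma$ through $a,b,\gamma$. The MWM estimator $(\hat\theta_n,\hat\sigma_n)$ is a measurable solution $(\theta,\sigma)$, $\sigma>0$, of the implicit equations $$\theta=w_1-c_{y,1}\,\sigma,\qquad \sigma=\sqrt{\frac{w_2-w_1^2}{c_{y,2}-c_{y,1}^2}}\qquad\text{at }(w_1,w_2)=(\widehat W_1,\widehat W_2),$$ whenever they have one (and is arbitrary otherwise). **The matrix $\Sigma_y$.** Put $\partial_a c_{y,k}=a(1-\Phi(\gamma))\,\dfrac{k\Delta_a^{k-1}}{\phi(\Delta_a)}$ and $\partial_b c_{y,k}=-b(1-\Phi(\gamma))\,\dfrac{k\Delta_{\bar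 b}^{k-1}}{\phi(\Delta_{\bar b})}$, let $\partial_a,\partial_b$ act on polynomials in the $c_{y,k}$ by the sum and product rules, and for $i,j\in\{1,2\}$ let $$\begin{aligned}v_{ij}={}&c_{y,i+j}-c_{y,i}c_{y,j}-a\,\partial_a(c_{y,i+j}-c_{y,i}c_{y,j})-b\,\partial_b(c_{y,i+j}-c_{y,i}c_{y,j})\\&+a\bar a\,\partial_ac_{y,i}\,\partial_ac_{y,j}+b\bar b\,\partial_bc_{y,i}\,\partial_bc_{y,j}-ab\big(\partial_ac_{y,i}\,\partial_bc_{y,j}+\partial_bc_{y,i}\,\partial_ac_{y,j}\big).\end{aligned}$$ Put $c^*_{y,1}=v_{11}$, $c^*_{y,2}=\tfrac12v_{12}$, $c^*_{y,3}=\tfrac14v_{22}$, and let $\Sigma_y=[\sigma_{ij}^2]$ have the entries $$\sigma_{11}^2=\sigma^2c_{y,1}^*,\quad \sigma_{12}^2=\sigma_{21}^2=2\theta\sigma^2c_{y,1}^*+2\sigma^3c_{y,2}^*,\quad \sigma_{22}^2=4\theta^2\sigma^2c_{y,1}^*+8\theta\sigma^3c_{y,2}^*+4\sigma^4c_{y,3}^*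 .$$ **The matrix $D_y$.** Put $$B_k=\frac{a\bar a\Delta_a^{k-1}}{\phi(\Delta_a)}+\int_a^{\bar b}\frac{\bar s\,\Delta_s^{k-1}}{\phi(\Delta_s)}ds+\frac{b^2\Delta_{\bar b}^{k-1}}{\phi(\Delta_{\bar b})},\quad \partial_\theta c_{y,k}=-\frac{k\phi(\gamma)}{\sigma}B_k,\quad \partial_\sigma c_{y,k}=-\frac{k(t-\theta)\phi(\gamma)}{\sigma^2}B_k,$$ $$f_{11}=1+\sigma\,\partial_\theta c_{y,1},\quad f_{12}=c_{y,1}+\sigma\,\partial_\sigma c_{y,1},\quad f_{21}=\partial_\theta c_{y,2}-2c_{y,1}\partial_\theta c_{y,1},\quad f_{22}=\partial_\sigma c_{y,2}-2c_{y,1}\partial_\sigma c_{y,1},$$ $C=c_{y,2}-c_{y,1}^2$, $V=W_{y,2}-W_{y,1}^2$, $K=\tfrac12\sqrt{C/V}$, $Q=f_{11}C^2+KV(f_{11}f_{22}-f_{12}f_{21})$, and let $D_y=[d_{ij}]$ have the entries $$d_{21}=-\frac{K\,[2f_{11}W_{y,1}C+f_{21}V]}{Q},\quad d_{22}=\frac{Kf_{11}C}{Q},\quad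 d_{11}=\frac{1-f_{12}d_{21}}{f_{11}},\quad d_{12}=-\frac{f_{12}d_{22}}{f_{11}} .$$ **Claim.** All the constants above are taken at the true $(\theta,\sigma)$. 1. For every integer $k\ge0$, the expressions $\partial_ac_{y,k}$, $\partial_bc_{y,k}$, $\partial_\theta c_{y,k}$, $\partial_\sigma c_{y,k}$ are the partial derivatives of $c_{y,k}$ with respect to $a,b,\theta,\sigma$ (for $k=0$ they are $0$). 2. $D_y$ is the Jacobian matrix at $(W_{y,1},W_{y,2})$ of a map $g=(g_1,g_2)$ such that $g(W_{y,1},W_{y,2})=(\theta,\sigma)$ and $g(w_1,w_2)$ solves the implicit equations for all $(w_1,w_2)$ near $(W_{y,1},W_{y,2})$. 3. With probability tending to $1$ the implicit equations have a solution at $(\widehat W_1,\widehat W_2)$. 4. $(\hat\theta_n,\hat\sigma_n)$ is asymptotically normal with mean $(\theta,\sigma)$ and covariance $n^{-1}S$, $S=D_y\Sigma_yD_y'$: the matrix $S$ is positive semidefinite and $$\sqrt n\,\big((\hat\theta_n,\hat\sigma_n)-(\theta,\sigma)\big)\longrightarrow N(0,S)\quad\text{in distribution.}$$ -/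

import Mathlib

open MeasureTheory ProbabilityTheory Filter Topology
open scoped Matrix

namespace MWM

noncomputable section

/-- The quantile function `v ↦ inf {x | v ≤ F x}` of the law `P` with distribution function `F`. -/
def quantile (P : Measure ℝ) (v : ℝ) : ℝ := sInf {x : ℝ | v ≤ cdf P x}

/-- Standard normal distribution function. -/
def Phi (x : ℝ) : ℝ := cdf (gaussianReal 0 1) x

/-- Standard normal density. -/
def phi (x : ℝ) : ℝ := gaussianPDFReal 0 1 x

/-- Standard normal quantile function. -/
def PhiInv (v : ℝ) : ℝ := quantile (gaussianReal 0 1) v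

/-- The law `N(θ, σ²)` of the (transformed) ground-up loss `X`. -/
def lossLaw (θ σ : ℝ) : Measure ℝ := gaussianReal θ (σ ^ 2).toNNReal

/-- The law of the payment-per-payment variable `Y = c (min (X, T) - t) | X > t`,
for `X ∼ N(θ, σ²)`. -/
def paymentLaw (c t T θ σ : ℝ) : Measure ℝ :=
  (ProbabilityTheory.cond (lossLaw θ σ) (Set.Ioi t)).map fun x => c * (min x T - t)

/-- `s* = (F_X(T) - F_X(t)) / (1 - F_X(t))`. -/
def sStar (t T θ σ : ℝ) : ℝ :=
  (cdf (lossLaw θ σ) T - cdf (lossLaw θ σ) t) / (1 - cdf (lossLaw θ σ) t)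

/-- `h_Y(y) = y / c + t`. -/
def hY (c t y : ℝ) : ℝ := y / c + t

/-! ### Sample winsorized moments -/

/-- The `i`-th smallest (`1 ≤ i ≤ n`) of the numbers `y 0, …, y (n - 1)`. -/
def orderStat {n : ℕ} (y : Fin n → ℝ) (i : ℕ) : ℝ :=
  if h : 1 ≤ i ∧ i ≤ n then y (Tuple.sort y ⟨i - 1, by omega⟩) else 0

/-- The `k`-th sample winsorized moment, with `m` observations winsorized from below and `m'`
from above. -/
def sampleMoment (c t : ℝ) {n : ℕ} (y : Fin n → ℝ) (m m' k : ℕ) : ℝ :=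
  (1 / (n : ℝ)) *
    ((m : ℝ) * hY c t (orderStat y (m + 1)) ^ k
      + ∑ i ∈ Finset.Icc (m + 1) (n - m'), hY c t (orderStat y i) ^ k
      + (m' : ℝ) * hY c t (orderStat y (n - m')) ^ k)

/-- The `k`-th population winsorized moment `W_{y,k}`. -/
def popMoment (c t T a b θ σ : ℝ) (k : ℕ) : ℝ :=
  a * hY c t (quantile (paymentLaw c t T θ σ) a) ^ k
    + (∫ v in a..(1 - b), hY c t (quantile (paymentLaw c t T θ σ) v) ^ k)
    + b * hY c t (quantile (paymentLaw c t T θ σ) (1 - b)) ^ k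

/-! ### The constants `c_{y,k}` and the estimating equations -/

/-- `γ = (t - θ) / σ`. -/
def gam (t θ σ : ℝ) : ℝ := (t - θ) / σ

/-- `Δ_s = Φ⁻¹(s + (1 - s) Φ(γ))`. -/
def Delta (γ s : ℝ) : ℝ := PhiInv (s + (1 - s) * Phi γ)

/-- `c_{y,k} = a Δ_a^k + ∫_a^{1-b} Δ_s^k ds + b Δ_{1-b}^k`. -/
def cy (a b γ : ℝ) (k : ℕ) : ℝ :=
  a * Delta γ a ^ k + (∫ s in a..(1 - b), Delta γ s ^ k) + b * Delta γ (1 - b) ^ k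

/-- `(θ, σ)`, with `σ > 0`, solves the implicit equations
`θ = w₁ - c_{y,1} σ`, `σ = √((w₂ - w₁²) / (c_{y,2} - c_{y,1}²))`,
in which `c_{y,k}` is evaluated at `γ = (t - θ) / σ`. -/
def Solves (t a b w₁ w₂ θ σ : ℝ) : Prop :=
  0 < σ ∧
  θ = w₁ - cy a b (gam t θ σ) 1 * σ ∧
  σ = √((w₂ - w₁ ^ 2) / (cy a b (gam t θ σ) 2 - cy a b (gam t θ σ) 1 ^ 2))

/-! ### The matrix `Σ_y` -/

/-- Expression for `∂c_{y,k}/∂a`. -/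
def cyDa (a γ : ℝ) (k : ℕ) : ℝ :=
  a * (1 - Phi γ) * (k * Delta γ a ^ (k - 1) / phi (Delta γ a))

/-- Expression for `∂c_{y,k}/∂b`. -/
def cyDb (b γ : ℝ) (k : ℕ) : ℝ :=
  -(b * (1 - Phi γ) * (k * Delta γ (1 - b) ^ (k - 1) / phi (Delta γ (1 - b))))

/-- `c*_{y,1}`. -/
def cStar1 (a b γ : ℝ) : ℝ :=
  cy a b γ 2 - cy a b γ 1 ^ 2
    - a * (cyDa a γ 2 - 2 * cy a b γ 1 * cyDa a γ 1)
    - b * (cyDb b γ 2 - 2 * cy a b γ 1 * cyDb b γ 1)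
    + a * (1 - a) * cyDa a γ 1 ^ 2 + b * (1 - b) * cyDb b γ 1 ^ 2
    - 2 * a * b * cyDa a γ 1 * cyDb b γ 1

/-- `c*_{y,2}`. -/
def cStar2 (a b γ : ℝ) : ℝ :=
  (cy a b γ 3 - cy a b γ 1 * cy a b γ 2
    - a * (cyDa a γ 3 - (cy a b γ 2 * cyDa a γ 1 + cy a b γ 1 * cyDa a γ 2))
    - b * (cyDb b γ 3 - (cy a b γ 2 * cyDb b γ 1 + cy a b γ 1 * cyDb b γ 2))
    + a * (1 - a) * cyDa a γ 1 * cyDa a γ 2 + b * (1 - b) * cyDb b γ 1 * cyDb b γ 2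
    - a * b * (cyDa a γ 1 * cyDb b γ 2 + cyDb b γ 1 * cyDa a γ 2)) / 2

/-- `c*_{y,3}`. -/
def cStar3 (a b γ : ℝ) : ℝ :=
  (cy a b γ 4 - cy a b γ 2 ^ 2
    - a * (cyDa a γ 4 - 2 * cy a b γ 2 * cyDa a γ 2)
    - b * (cyDb b γ 4 - 2 * cy a b γ 2 * cyDb b γ 2)
    + a * (1 - a) * cyDa a γ 2 ^ 2 + b * (1 - b) * cyDb b γ 2 ^ 2
    - 2 * a * b * cyDa a γ 2 * cyDb b γ 2) / 4

/-- The matrix `Σ_y`. -/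
def SigmaMat (t a b θ σ : ℝ) : Matrix (Fin 2) (Fin 2) ℝ :=
  let c₁ := cStar1 a b (gam t θ σ)
  let c₂ := cStar2 a b (gam t θ σ)
  let c₃ := cStar3 a b (gam t θ σ)
  !![σ ^ 2 * c₁, 2 * θ * σ ^ 2 * c₁ + 2 * σ ^ 3 * c₂;
     2 * θ * σ ^ 2 * c₁ + 2 * σ ^ 3 * c₂,
       4 * θ ^ 2 * σ ^ 2 * c₁ + 8 * θ * σ ^ 3 * c₂ + 4 * σ ^ 4 * c₃]

/-! ### The matrix `D_y` -/

/-- The expression in braces in the formulas for `∂c_{y,k}/∂θ` and `∂c_{y,k}/∂σ`. -/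
def brace (a b γ : ℝ) (k : ℕ) : ℝ :=
  a * (1 - a) * Delta γ a ^ (k - 1) / phi (Delta γ a)
    + (∫ s in a..(1 - b), (1 - s) * Delta γ s ^ (k - 1) / phi (Delta γ s))
    + b ^ 2 * Delta γ (1 - b) ^ (k - 1) / phi (Delta γ (1 - b))

/-- Expression for `∂c_{y,k}/∂θ`. -/
def cyDtheta (t a b θ σ : ℝ) (k : ℕ) : ℝ :=
  -(k * phi (gam t θ σ) / σ) * brace a b (gam t θ σ) k

/-- Expression for `∂c_{y,k}/∂σ`. -/
def cyDsigma (t a b θ σ : ℝ) (k : ℕ) : ℝ :=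
  -(k * (t - θ) * phi (gam t θ σ) / σ ^ 2) * brace a b (gam t θ σ) k

def f11 (t a b θ σ : ℝ) : ℝ := 1 + σ * cyDtheta t a b θ σ 1

def f12 (t a b θ σ : ℝ) : ℝ := cy a b (gam t θ σ) 1 + σ * cyDsigma t a b θ σ 1

def f21 (t a b θ σ : ℝ) : ℝ :=
  cyDtheta t a b θ σ 2 - 2 * cy a b (gam t θ σ) 1 * cyDtheta t a b θ σ 1

def f22 (t a b θ σ : ℝ) : ℝ :=
  cyDsigma t a b θ σ 2 - 2 * cy a b (gam t θ σ) 1 * cyDsigma t a b θ σ 1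

/-- `c_{y,2} - c_{y,1}²`. -/
def cVar (t a b θ σ : ℝ) : ℝ := cy a b (gam t θ σ) 2 - cy a b (gam t θ σ) 1 ^ 2

/-- `W_{y,2} - W_{y,1}²`. -/
def wVar (c t T a b θ σ : ℝ) : ℝ :=
  popMoment c t T a b θ σ 2 - popMoment c t T a b θ σ 1 ^ 2

/-- `K = ½ √((c_{y,2} - c_{y,1}²) / (W_{y,2} - W_{y,1}²))`. -/
def Kconst (c t T a b θ σ : ℝ) : ℝ :=
  1 / 2 * √(cVar t a b θ σ / wVar c t T a b θ σ)

/-- The common denominator of `d₂₁` and `d₂₂`. -/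
def denom (c t T a b θ σ : ℝ) : ℝ :=
  f11 t a b θ σ * cVar t a b θ σ ^ 2
    + Kconst c t T a b θ σ * wVar c t T a b θ σ
      * (f11 t a b θ σ * f22 t a b θ σ - f12 t a b θ σ * f21 t a b θ σ)

def d21 (c t T a b θ σ : ℝ) : ℝ :=
  -(Kconst c t T a b θ σ
      * (2 * f11 t a b θ σ * popMoment c t T a b θ σ 1 * cVar t a b θ σ
          + f21 t a b θ σ * wVar c t T a b θ σ)) / denom c t T a b θ σ

def d22 (c t T a b θ σ : ℝ) : ℝ :=
  Kconst c t T a b θ σ * f11 t a b θ σ * cVar t a b θ σ / denom c t T a b θ σ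

def d11 (c t T a b θ σ : ℝ) : ℝ :=
  (1 - f12 t a b θ σ * d21 c t T a b θ σ) / f11 t a b θ σ

def d12 (c t T a b θ σ : ℝ) : ℝ :=
  -(f12 t a b θ σ * d22 c t T a b θ σ) / f11 t a b θ σ

/-- The matrix `D_y`. -/
def DMat (c t T a b θ σ : ℝ) : Matrix (Fin 2) (Fin 2) ℝ :=
  !![d11 c t T a b θ σ, d12 c t T a b θ σ; d21 c t T a b θ σ, d22 c t T a b θ σ]

/-- `S = D_y Σ_y D_y'`. -/
def SMat (c t T a b θ σ : ℝ) : Matrix (Fin 2) (Fin 2) ℝ :=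
  DMat c t T a b θ σ * SigmaMat t a b θ σ * (DMat c t T a b θ σ)ᵀ

end

end MWM

/-!
# Asymptotic normality of the method of winsorized moments for truncated and censored normal data

**Solving the equations.** In terms of `γ = (t - θ) / σ` the implicit equations say
`w₁ - t = σ * excess γ` and `w₂ - w₁² = σ² * spread γ`, where `excess = c_{y,1} - γ` and
`spread = c_{y,2} - c_{y,1}²` (`solves_iff`). Eliminating `σ` leaves the single equation
`(w₂ - w₁²) / (w₁ - t)² = ratio γ` with `ratio = spread / excess²`. The point is that `ratio` is
strictly increasing in `γ` (`ratio_numerator_pos`). Up to positive factors its derivative is the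
difference of the two sides of `integral_mills_lt`, an inequality between moments that follows from
the strict convexity of Mills' ratio `(1 - Φ) / φ`.
Hence a solution is unique whenever it exists (`solution_of_solves`), solutions persist under
small changes of `(w₁, w₂)` (`eventually_solves_solution`), and the solution map is
differentiable with Jacobian matrix `D_y` (`hasFDerivAt_solution`). Uniqueness is what identifies
an arbitrary estimator with the value of this map, on the event that a solution exists.

**Linearizing the sample moments.** A sample winsorized moment is the empirical mean of a power of
the observations clamped to the interval between two order statistics
(`sum_clamp_orderStat`). By Bahadur's representation of the order statistics
(`tendsto_bahadur`) it differs from its population value by the empirical mean of an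
`influence` function, up to an error `o(n^{-1/2})` in probability (`tendsto_winsorized`). The
quantile at level `a` needs a density only if `a > 0`; for `a = 0` its term carries the weight `0`.
Convergence in probability is handled as convergence along the filter `inProb μ` on `ℕ × Ω`, so
that the usual calculus of limits and of `=o` applies.

**The limit law.** The payment, clamped to the interval between two of its quantiles, has the law
of the quantile function at a clamped uniform variable (`map_wins_paymentLaw`). This
identifies the moments of the influence functions with the constants `c_{y,k}`, and their
covariance matrix with the one that is turned into `Σ_y` by the passage from the standardized
losses to the losses themselves (`integral_inflComb_sq`, `SigmaMat_eq`). The central limit theorem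
for the influence functions (`tendstoInDistribution_inflSum`) and the delta method
(`tendsto_delta_method`) give the limit `N(0, D_y Σ_y D_y')`.
-/

namespace MWM

/-! ### Convergence in probability as convergence along a filter -/

section InProb

variable {Ω : Type*} [MeasurableSpace Ω] {μ : Measure Ω}

/-- The filter on `ℕ × Ω` of the events (sequences of subsets of `Ω`) whose probability tends to
one. Outer measure is used, so the events need not be measurable. A sequence of random elements,
read as a function on `ℕ × Ω`, converges in probability exactly when it converges along this
filter, so the calculus of limits and of `=o` applies to it. -/
def inProb (μ : Measure Ω) : Filter (ℕ × Ω) where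
  sets := {E | Tendsto (fun n => μ {ω | (n, ω) ∉ E}) atTop (𝓝 0)}
  univ_sets := by simp
  sets_of_superset := by
    intro E F hE hEF
    refine tendsto_of_tendsto_of_tendsto_of_le_of_le tendsto_const_nhds hE (fun _ => zero_le)
      fun n => measure_mono fun ω hω h => hω (hEF h)
  inter_sets := by
    intro E F hE hF
    have h := Tendsto.add hE hF
    rw [add_zero] at h
    refine tendsto_of_tendsto_of_tendsto_of_le_of_le tendsto_const_nhds h (fun _ => zero_le)
      fun n => le_trans (measure_mono ?_) (measure_union_le _ _)
    intro ω hω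
    by_contra hcon
    simp only [Set.mem_union, Set.mem_ofPred_eq, not_or, not_not] at hcon
    exact hω ⟨hcon.1, hcon.2⟩

lemma eventually_inProb {p : ℕ × Ω → Prop} :
    (∀ᶠ x in inProb μ, p x) ↔ Tendsto (fun n => μ {ω | ¬ p (n, ω)}) atTop (𝓝 0) := Iff.rfl

lemma eventually_inProb_of_le {p : ℕ × Ω → Prop}
    (h : ∀ η : ENNReal, 0 < η → ∀ᶠ n in atTop, μ {ω | ¬ p (n, ω)} ≤ η) :
    ∀ᶠ x in inProb μ, p x :=
  eventually_inProb.2 (ENNReal.tendsto_nhds_zero.2 h)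

lemma eventually_inProb_of_eventually {p : ℕ → Prop} (h : ∀ᶠ n in atTop, p n) :
    ∀ᶠ x in inProb μ, p x.1 := by
  rw [eventually_inProb]
  refine tendsto_const_nhds.congr' ?_
  filter_upwards [h] with n hn
  simp [hn]

lemma eventually_inProb_of_ae {p : ℕ × Ω → Prop} (h : ∀ n, ∀ᵐ ω ∂μ, p (n, ω)) :
    ∀ᶠ x in inProb μ, p x := by
  rw [eventually_inProb]
  refine tendsto_const_nhds.congr fun n => ?_
  exact (ae_iff.1 (h n)).symm

lemma tendsto_fst_inProb : Tendsto Prod.fst (inProb μ) atTop :=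
  fun _ hs => eventually_inProb_of_eventually (μ := μ) hs

lemma tendsto_inProb_iff {E : Type*} [PseudoMetricSpace E] {X : ℕ × Ω → E} {c : E} :
    Tendsto X (inProb μ) (𝓝 c) ↔
      ∀ ε > 0, Tendsto (fun n => μ {ω | ε ≤ dist (X (n, ω)) c}) atTop (𝓝 0) := by
  rw [Metric.tendsto_nhds]
  refine forall₂_congr fun ε _ => ?_
  rw [eventually_inProb]
  simp only [not_lt]

lemma tendsto_inProb_iff_tendstoInMeasure {E : Type*} [PseudoMetricSpace E] {X : ℕ → Ω → E}
    {c : E} : Tendsto (fun x : ℕ × Ω => X x.1 x.2) (inProb μ) (𝓝 c) ↔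
      TendstoInMeasure μ X atTop (fun _ => c) := by
  rw [tendsto_inProb_iff, tendstoInMeasure_iff_dist]

/-- Tightness (boundedness in probability) of a sequence of random vectors. -/
def Tight (μ : Measure Ω) {E : Type*} [Norm E] (X : ℕ × Ω → E) : Prop :=
  ∀ η : ENNReal, 0 < η → ∃ K : ℝ, ∀ᶠ n in atTop, μ {ω | K < ‖X (n, ω)‖} ≤ η

/-- To show that an event has probability tending to one, one may assume that a given tight
sequence is bounded by a constant. -/
lemma Tight.eventually {E : Type*} [Norm E] {X : ℕ × Ω → E} (hX : Tight μ X)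
    {p : ℕ × Ω → Prop} (h : ∀ K : ℝ, ∀ᶠ x in inProb μ, ‖X x‖ ≤ K → p x) :
    ∀ᶠ x in inProb μ, p x := by
  refine eventually_inProb_of_le fun η hη => ?_
  have hη2 : 0 < η / 2 := ENNReal.half_pos hη.ne'
  obtain ⟨K, hK⟩ := hX (η / 2) hη2
  have h2 := ENNReal.tendsto_nhds_zero.1 (eventually_inProb.1 (h K)) (η / 2) hη2
  filter_upwards [hK, h2] with n h1 h2
  calc μ {ω | ¬ p (n, ω)}
      ≤ μ ({ω | K < ‖X (n, ω)‖} ∪ {ω | ¬ (‖X (n, ω)‖ ≤ K → p (n, ω))}) := by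
        refine measure_mono fun ω hω => ?_
        by_cases hc : K < ‖X (n, ω)‖
        · exact Or.inl hc
        · exact Or.inr fun hcon => hω (hcon (not_lt.1 hc))
    _ ≤ η / 2 + η / 2 := (measure_union_le _ _).trans (add_le_add h1 h2)
    _ = η := ENNReal.add_halves η

variable {E : Type*} [NormedAddCommGroup E]

lemma Tight.of_eventually_le {F : Type*} [NormedAddCommGroup F] {X : ℕ × Ω → E} {Y : ℕ × Ω → F}
    (hX : Tight μ X) (C D : ℝ) (h : ∀ᶠ x in inProb μ, ‖Y x‖ ≤ C * ‖X x‖ + D) :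
    Tight μ Y := by
  intro η hη
  have hη2 : 0 < η / 2 := ENNReal.half_pos hη.ne'
  obtain ⟨K, hK⟩ := hX (η / 2) hη2
  have h2 := ENNReal.tendsto_nhds_zero.1 (eventually_inProb.1 h) (η / 2) hη2
  refine ⟨|C| * K + D, ?_⟩
  filter_upwards [hK, h2] with n h1 h2
  refine le_trans (measure_mono ?_) ((measure_union_le _ _).trans
    ((add_le_add h1 h2).trans (ENNReal.add_halves η).le))
  intro ω hω
  by_contra hcon
  simp only [Set.mem_union, Set.mem_ofPred_eq, not_or, not_not, not_lt] at hcon hω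
  have h3 : C * ‖X (n, ω)‖ ≤ |C| * K :=
    (mul_le_mul_of_nonneg_right (le_abs_self C) (norm_nonneg _)).trans
      (mul_le_mul_of_nonneg_left hcon.1 (abs_nonneg C))
  linarith [hcon.2]

lemma Tight.add {X Y : ℕ × Ω → E} (hX : Tight μ X) (hY : Tight μ Y) :
    Tight μ (fun x => X x + Y x) := by
  intro η hη
  have hη2 : 0 < η / 2 := ENNReal.half_pos hη.ne'
  obtain ⟨K, hK⟩ := hX (η / 2) hη2
  obtain ⟨L, hL⟩ := hY (η / 2) hη2
  refine ⟨K + L, ?_⟩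
  filter_upwards [hK, hL] with n h1 h2
  refine le_trans (measure_mono ?_) ((measure_union_le _ _).trans
    ((add_le_add h1 h2).trans (ENNReal.add_halves η).le))
  intro ω hω
  by_contra hcon
  simp only [Set.mem_union, Set.mem_ofPred_eq, not_or, not_lt] at hcon hω
  have := norm_add_le (X (n, ω)) (Y (n, ω))
  linarith [hcon.1, hcon.2]

lemma Tight.of_tendsto {X : ℕ × Ω → E} {c : E} (hX : Tendsto X (inProb μ) (𝓝 c)) :
    Tight μ X := by
  intro η hη
  have h : ∀ᶠ x in inProb μ, ‖X x‖ ≤ ‖c‖ + 1 := by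
    filter_upwards [hX.norm.eventually (gt_mem_nhds (lt_add_one ‖c‖))] with x hx using hx.le
  refine ⟨‖c‖ + 1, ?_⟩
  filter_upwards [ENNReal.tendsto_nhds_zero.1 (eventually_inProb.1 h) η hη] with n hn
  simpa using hn

lemma Tight.const_mul {X : ℕ × Ω → ℝ} (hX : Tight μ X) (c : ℝ) :
    Tight μ (fun x => c * X x) :=
  hX.of_eventually_le |c| 0 (Eventually.of_forall fun x => by simp)

lemma Tight.of_tendsto_sub {X Y : ℕ × Ω → E} (hX : Tight μ X)
    (h : Tendsto (fun x => Y x - X x) (inProb μ) (𝓝 0)) : Tight μ Y := by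
  simpa using (Tight.of_tendsto h).add hX

/-- The product of a tight sequence and a sequence tending to zero in probability tends to zero
in probability. -/
lemma Tight.tendsto_of_isLittleO {F : Type*} [NormedAddCommGroup F] {X : ℕ × Ω → E}
    {Y : ℕ × Ω → F} (hX : Tight μ X) (h : Y =o[inProb μ] X) : Tendsto Y (inProb μ) (𝓝 0) := by
  rw [Metric.tendsto_nhds]
  intro ε hε
  refine hX.eventually fun K => ?_
  have hK : 0 < ε / (|K| + 1) := by positivity
  filter_upwards [h.def hK] with x hx hxK
  rw [dist_zero_right]
  calc ‖Y x‖ ≤ ε / (|K| + 1) * ‖X x‖ := hx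
    _ ≤ ε / (|K| + 1) * |K| := by gcongr; exact hxK.trans (le_abs_self K)
    _ < ε / (|K| + 1) * (|K| + 1) := by gcongr; linarith
    _ = ε := by field_simp

lemma Tight.mul_tendsto_zero {X Y : ℕ × Ω → ℝ} (hX : Tight μ X)
    (hY : Tendsto Y (inProb μ) (𝓝 0)) : Tendsto (fun x => Y x * X x) (inProb μ) (𝓝 0) :=
  hX.tendsto_of_isLittleO (by
    simpa using ((Asymptotics.isLittleO_one_iff ℝ).2 hY).mul_isBigO
      (Asymptotics.isBigO_refl X (inProb μ)))

lemma tendsto_sqrt_inProb : Tendsto (fun x : ℕ × Ω => √(x.1 : ℝ)) (inProb μ) atTop :=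
  (Real.tendsto_sqrt_atTop.comp tendsto_natCast_atTop_atTop).comp tendsto_fst_inProb

lemma eventually_pos_inProb : ∀ᶠ x in inProb μ, 0 < x.1 :=
  eventually_inProb_of_eventually (p := fun n => 0 < n) (eventually_gt_atTop 0)

/-- If `√n (X_n - c)` is tight then `X_n → c` in probability. -/
lemma tendsto_of_tight_sqrt [NormedSpace ℝ E] {X : ℕ × Ω → E} {c : E}
    (h : Tight μ fun x => √(x.1 : ℝ) • (X x - c)) : Tendsto X (inProb μ) (𝓝 c) := by
  rw [← tendsto_sub_nhds_zero_iff]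
  refine h.tendsto_of_isLittleO ?_
  have h1 : Tendsto (fun x : ℕ × Ω => (√(x.1 : ℝ))⁻¹) (inProb μ) (𝓝 0) :=
    tendsto_inv_atTop_zero.comp tendsto_sqrt_inProb
  have h2 := ((Asymptotics.isLittleO_one_iff ℝ).2 h1).smul_isBigO
    (Asymptotics.isBigO_refl (fun x => √(x.1 : ℝ) • (X x - c)) (inProb μ))
  refine h2.congr' ?_ ?_
  · filter_upwards [eventually_pos_inProb] with x hx
    rw [inv_smul_smul₀]
    positivity
  · exact Eventually.of_forall fun x => by simp

/-- The grid argument: two real sequences, one of them tight, that are with probability tending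
to one on the same side of every level up to an arbitrarily small margin have a difference that
tends to zero in probability. -/
lemma tendsto_sub_zero_of_levels {V Z : ℕ × Ω → ℝ} (hZ : Tight μ Z)
    (h1 : ∀ u v, u < v → ∀ᶠ x in inProb μ, ¬ (V x ≤ u ∧ v ≤ Z x))
    (h2 : ∀ u v, u < v → ∀ᶠ x in inProb μ, ¬ (v ≤ V x ∧ Z x ≤ u)) :
    Tendsto (fun x => V x - Z x) (inProb μ) (𝓝 0) := by
  rw [Metric.tendsto_nhds]
  intro ε hε
  refine hZ.eventually fun K => ?_
  set δ := ε / 3 with hδ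
  have hδ0 : 0 < δ := by positivity
  -- only the finitely many levels `j δ` within distance `K` of zero matter
  set N : ℤ := ⌈|K| / δ⌉ + 1
  have g1 : ∀ᶠ x in inProb μ, ∀ j ∈ Finset.Icc (-N) N,
      ¬ (V x ≤ ((j - 1 : ℤ) : ℝ) * δ ∧ (j : ℝ) * δ ≤ Z x) :=
    (Finset.eventually_all _).2 fun j _ => h1 _ _ (by push_cast; nlinarith)
  have g2 : ∀ᶠ x in inProb μ, ∀ j ∈ Finset.Icc (-N) N,
      ¬ (((j + 2 : ℤ) : ℝ) * δ ≤ V x ∧ Z x ≤ ((j + 1 : ℤ) : ℝ) * δ) :=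
    (Finset.eventually_all _).2 fun j _ => h2 _ _ (by push_cast; nlinarith)
  filter_upwards [g1, g2] with x g1 g2 hx
  set j := ⌊Z x / δ⌋
  have hj1 : (j : ℝ) * δ ≤ Z x := (le_div_iff₀ hδ0).1 (Int.floor_le _)
  have hj2 : Z x < ((j + 1 : ℤ) : ℝ) * δ := by
    push_cast
    exact (div_lt_iff₀ hδ0).1 (Int.lt_floor_add_one _)
  have hZK : |Z x / δ| ≤ |K| / δ := by
    rw [abs_div, abs_of_pos hδ0]
    exact div_le_div_of_nonneg_right (hx.trans (le_abs_self K)) hδ0.le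
  have hjN : j ∈ Finset.Icc (-N) N := by
    rw [Finset.mem_Icc]
    have h3 := abs_le.1 (hZK.trans (Int.le_ceil _))
    constructor
    · rw [Int.le_floor]
      push_cast [N]
      linarith [h3.1]
    · have : (j : ℝ) ≤ (N : ℝ) := by
        push_cast [N]
        linarith [Int.floor_le (Z x / δ), h3.2]
      exact_mod_cast this
  have k1 := g1 j hjN
  have k2 := g2 j hjN
  push_cast at k1 k2 hj2
  rw [not_and_or, not_le, not_le] at k1 k2
  rw [dist_zero_right, Real.norm_eq_abs, abs_lt]
  constructor
  · rcases k1 with k1 | k1 <;> nlinarith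
  · rcases k2 with k2 | k2 <;> nlinarith

end InProb

/-! ### The empirical process -/

section Empirical

variable {Ω : Type*} {P : Measure ℝ} {Y : ℕ → Ω → ℝ}

/-- The empirical mean `n⁻¹ ∑ f (Y_i)` of the first `n` observations. -/
noncomputable def emp (Y : ℕ → Ω → ℝ) (f : ℝ → ℝ) (x : ℕ × Ω) : ℝ :=
  (∑ i ∈ Finset.range x.1, f (Y i x.2)) / x.1

/-- The empirical process `√n (n⁻¹ ∑ f (Y_i) - ∫ f dP)`. -/
noncomputable def empProc (P : Measure ℝ) (Y : ℕ → Ω → ℝ) (f : ℝ → ℝ) (x : ℕ × Ω) : ℝ :=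
  √(x.1 : ℝ) * (emp Y f x - ∫ y, f y ∂P)

lemma emp_add (f g : ℝ → ℝ) (x : ℕ × Ω) :
    emp Y (fun y => f y + g y) x = emp Y f x + emp Y g x := by
  simp [emp, Finset.sum_add_distrib, add_div]

lemma emp_sub (f g : ℝ → ℝ) (x : ℕ × Ω) :
    emp Y (fun y => f y - g y) x = emp Y f x - emp Y g x := by
  simp [emp, Finset.sum_sub_distrib, sub_div]

lemma emp_const_mul (c : ℝ) (f : ℝ → ℝ) (x : ℕ × Ω) :
    emp Y (fun y => c * f y) x = c * emp Y f x := by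
  simp [emp, ← Finset.mul_sum, mul_div_assoc]

lemma emp_const (c : ℝ) {x : ℕ × Ω} (hx : 0 < x.1) : emp Y (fun _ => c) x = c := by
  have : (x.1 : ℝ) ≠ 0 := by positivity
  simp [emp]
  field_simp

lemma emp_mono {f g : ℝ → ℝ} (h : ∀ y, f y ≤ g y) (x : ℕ × Ω) : emp Y f x ≤ emp Y g x :=
  div_le_div_of_nonneg_right (Finset.sum_le_sum fun _ _ => h _) (Nat.cast_nonneg _)

lemma abs_emp_le (f : ℝ → ℝ) (x : ℕ × Ω) : |emp Y f x| ≤ emp Y (fun y => |f y|) x := by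
  rw [emp, abs_div, Nat.abs_cast]
  exact div_le_div_of_nonneg_right (Finset.abs_sum_le_sum_abs _ _) (Nat.cast_nonneg _)

lemma integrable_of_bounded [IsProbabilityMeasure P] {f : ℝ → ℝ} (hf : Measurable f) {C : ℝ}
    (hC : ∀ y, |f y| ≤ C) : Integrable f P :=
  Integrable.of_bound hf.aestronglyMeasurable C (Eventually.of_forall hC)

lemma empProc_sub [IsProbabilityMeasure P] {f g : ℝ → ℝ} (hf : Integrable f P)
    (hg : Integrable g P) (x : ℕ × Ω) :
    empProc P Y (fun y => f y - g y) x = empProc P Y f x - empProc P Y g x := by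
  rw [empProc, empProc, empProc, emp_sub, integral_sub hf hg]
  ring

lemma empProc_const_mul (c : ℝ) (f : ℝ → ℝ) (x : ℕ × Ω) :
    empProc P Y (fun y => c * f y) x = c * empProc P Y f x := by
  rw [empProc, empProc, emp_const_mul, integral_const_mul]
  ring

variable [MeasurableSpace Ω] {μ : Measure Ω} [IsProbabilityMeasure μ]

/-- Chebyshev's inequality for the empirical process. -/
lemma measure_empProc_ge_le (hindep : iIndepFun Y μ) (hlaw : ∀ i, HasLaw (Y i) P μ)
    {f : ℝ → ℝ} (hf : Measurable f) {C : ℝ} (hC : ∀ y, |f y| ≤ C) {ε : ℝ} (hε : 0 < ε) {n : ℕ}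
    (hn : 0 < n) :
    μ {ω | ε ≤ |empProc P Y f (n, ω)|} ≤ ENNReal.ofReal ((∫ y, f y ^ 2 ∂P) / ε ^ 2) := by
  have hP : IsProbabilityMeasure P := (hlaw 0).isProbabilityMeasure_iff.1 inferInstance
  have hn' : (0 : ℝ) < n := by exact_mod_cast hn
  have hmeas : ∀ i, AEMeasurable (fun ω => f (Y i ω)) μ := fun i =>
    hf.comp_aemeasurable (hlaw i).aemeasurable
  have hL : ∀ i, MemLp (fun ω => f (Y i ω)) 2 μ := fun i =>
    MemLp.of_bound (hmeas i).aestronglyMeasurable C (Eventually.of_forall fun ω => hC _)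
  set S : Ω → ℝ := ∑ i ∈ Finset.range n, fun ω => f (Y i ω) with hS
  have hSL : MemLp S 2 μ := memLp_finsetSum' _ fun i _ => hL i
  have hint : ∀ i, ∫ ω, f (Y i ω) ∂μ = ∫ y, f y ∂P := fun i =>
    (hlaw i).integral_comp hf.aestronglyMeasurable
  have hmean : ∫ ω, S ω ∂μ = n * ∫ y, f y ∂P := by
    simp only [hS, Finset.sum_apply]
    rw [integral_finsetSum _ fun i _ => (hL i).integrable (by norm_num)]
    simp [hint]
  have hvar : Var[S; μ] ≤ n * ∫ y, f y ^ 2 ∂P := by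
    rw [hS, IndepFun.variance_sum (fun i _ => hL i)]
    · calc ∑ i ∈ Finset.range n, Var[fun ω => f (Y i ω); μ]
          ≤ ∑ i ∈ Finset.range n, ∫ y, f y ^ 2 ∂P := by
            refine Finset.sum_le_sum fun i _ => ?_
            refine (variance_le_expectation_sq (hmeas i).aestronglyMeasurable).trans_eq ?_
            exact (hlaw i).integral_comp (f := fun y => f y ^ 2)
              (hf.pow_const 2).aestronglyMeasurable
        _ = n * ∫ y, f y ^ 2 ∂P := by simp
    · intro i _ j _ hij
      exact (hindep.indepFun hij).comp hf hf
  have hc : 0 < ε * √(n : ℝ) := by positivity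
  calc μ {ω | ε ≤ |empProc P Y f (n, ω)|}
      ≤ μ {ω | ε * √(n : ℝ) ≤ |S ω - ∫ ω, S ω ∂μ|} := by
        refine measure_mono fun ω hω => ?_
        simp only [Set.mem_ofPred_eq] at hω ⊢
        have hsq : √(n : ℝ) * √(n : ℝ) = n := Real.mul_self_sqrt hn'.le
        have : S ω - ∫ ω, S ω ∂μ = √(n : ℝ) * empProc P Y f (n, ω) := by
          rw [hmean, empProc, emp, ← mul_assoc]
          simp only [hS, Finset.sum_apply]
          rw [hsq]
          field_simp
        rw [this, abs_mul, abs_of_nonneg (Real.sqrt_nonneg _), mul_comm]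
        exact mul_le_mul_of_nonneg_left hω (Real.sqrt_nonneg _)
    _ ≤ ENNReal.ofReal (Var[S; μ] / (ε * √(n : ℝ)) ^ 2) := meas_ge_le_variance_div_sq hSL hc
    _ ≤ ENNReal.ofReal ((∫ y, f y ^ 2 ∂P) / ε ^ 2) := by
        refine ENNReal.ofReal_le_ofReal ?_
        rw [mul_pow, Real.sq_sqrt hn'.le, div_le_div_iff₀ (by positivity) (by positivity)]
        calc Var[S; μ] * ε ^ 2 ≤ (n * ∫ y, f y ^ 2 ∂P) * ε ^ 2 := by gcongr
          _ = _ := by ring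

lemma tight_empProc (hindep : iIndepFun Y μ) (hlaw : ∀ i, HasLaw (Y i) P μ)
    {f : ℝ → ℝ} (hf : Measurable f) {C : ℝ} (hC : ∀ y, |f y| ≤ C) :
    Tight μ (empProc P Y f) := by
  intro η hη
  set I := ∫ y, f y ^ 2 ∂P
  have hlim : Tendsto (fun K : ℝ => ENNReal.ofReal (I / K ^ 2)) atTop (𝓝 0) := by
    rw [← ENNReal.ofReal_zero]
    exact ENNReal.tendsto_ofReal (tendsto_const_nhds.div_atTop (tendsto_pow_atTop two_ne_zero))
  obtain ⟨K, hK, hK0⟩ :=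
    ((ENNReal.tendsto_nhds_zero.1 hlim η hη).and (eventually_gt_atTop 0)).exists
  refine ⟨K, ?_⟩
  filter_upwards [eventually_gt_atTop 0] with n hn
  refine (measure_mono fun ω hω => ?_).trans
    ((measure_empProc_ge_le hindep hlaw hf hC hK0 hn).trans hK)
  simpa using hω.le

/-- The empirical process at functions whose second moments tend to zero. -/
lemma tendsto_empProc_zero (hindep : iIndepFun Y μ) (hlaw : ∀ i, HasLaw (Y i) P μ)
    {f : ℕ → ℝ → ℝ} (hf : ∀ n, Measurable (f n)) {C : ℝ} (hC : ∀ n y, |f n y| ≤ C)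
    (h : Tendsto (fun n => ∫ y, f n y ^ 2 ∂P) atTop (𝓝 0)) :
    Tendsto (fun x : ℕ × Ω => empProc P Y (f x.1) x) (inProb μ) (𝓝 0) := by
  rw [tendsto_inProb_iff]
  intro ε hε
  have hlim : Tendsto (fun n => ENNReal.ofReal ((∫ y, f n y ^ 2 ∂P) / ε ^ 2)) atTop (𝓝 0) := by
    rw [← ENNReal.ofReal_zero]
    exact ENNReal.tendsto_ofReal (by simpa using h.div_const (ε ^ 2))
  refine tendsto_of_tendsto_of_tendsto_of_le_of_le' tendsto_const_nhds hlim
    (Eventually.of_forall fun _ => zero_le) ?_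
  filter_upwards [eventually_gt_atTop 0] with n hn
  simpa using measure_empProc_ge_le hindep hlaw (hf n) (hC n) hε hn

/-- The weak law of large numbers. -/
lemma tendsto_emp (hindep : iIndepFun Y μ) (hlaw : ∀ i, HasLaw (Y i) P μ)
    {f : ℝ → ℝ} (hf : Measurable f) {C : ℝ} (hC : ∀ y, |f y| ≤ C) :
    Tendsto (emp Y f) (inProb μ) (𝓝 (∫ y, f y ∂P)) :=
  tendsto_of_tight_sqrt (tight_empProc hindep hlaw hf hC)

/-- The indicator function of `(-∞, q]`. -/
noncomputable def below (q y : ℝ) : ℝ := if y ≤ q then 1 else 0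

lemma measurable_below (q : ℝ) : Measurable (below q) :=
  Measurable.ite measurableSet_Iic measurable_const measurable_const

lemma abs_below_le (q y : ℝ) : |below q y| ≤ 1 := by
  unfold below; split_ifs <;> simp

lemma integral_below [IsProbabilityMeasure P] (q : ℝ) : ∫ y, below q y ∂P = cdf P q := by
  have : below q = (Set.Iic q).indicator 1 := by
    ext y; simp [below, Set.indicator]
  rw [this, integral_indicator_one measurableSet_Iic, cdf_eq_real]

lemma integrable_below [IsProbabilityMeasure P] (q : ℝ) : Integrable (below q) P :=
  integrable_of_bounded (measurable_below q) (abs_below_le q)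

lemma integral_below_sub_sq [IsProbabilityMeasure P] (q r : ℝ) :
    ∫ y, (below r y - below q y) ^ 2 ∂P = |cdf P r - cdf P q| := by
  wlog h : q ≤ r generalizing q r
  · rw [abs_sub_comm, ← this r q (le_of_not_ge h)]
    refine integral_congr_ae (Eventually.of_forall fun y => ?_)
    simp only
    ring
  · rw [abs_of_nonneg (sub_nonneg.2 (monotone_cdf P h)), ← integral_below, ← integral_below,
      ← integral_sub (integrable_below r) (integrable_below q)]
    refine integral_congr_ae (Eventually.of_forall fun y => ?_)
    simp only [below]
    split_ifs <;> first | (exfalso; linarith) | norm_num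

end Empirical

/-! ### Order statistics -/

section OrderStat

variable {n : ℕ}

lemma card_perm_eq (y : Fin n → ℝ) (σ : Equiv.Perm (Fin n)) (p : ℝ → Prop) [DecidablePred p] :
    (Finset.univ.filter fun i => p ((y ∘ σ) i)).card = (Finset.univ.filter fun i => p (y i)).card := by
  refine Finset.card_bij (fun i _ => σ i) (by simp) (by simp) fun i hi => ⟨σ.symm i, ?_, by simp⟩
  simpa using hi

lemma orderStat_le_iff (y : Fin n → ℝ) {r : ℕ} (hr : 1 ≤ r ∧ r ≤ n) (x : ℝ) :
    orderStat y r ≤ x ↔ r ≤ (Finset.univ.filter fun i => y i ≤ x).card := by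
  have h := Tuple.lt_card_le_iff_apply_le_of_monotone (j := (⟨r - 1, by omega⟩ : Fin n))
    (a := x) (Tuple.monotone_sort y)
  rw [card_perm_eq y _ (· ≤ x)] at h
  rw [orderStat, dif_pos hr]
  refine Iff.trans h.symm ?_
  simp only
  omega

lemma le_orderStat_iff (y : Fin n → ℝ) {r : ℕ} (hr : 1 ≤ r ∧ r ≤ n) (x : ℝ) :
    x ≤ orderStat y r ↔ (Finset.univ.filter fun i => y i < x).card < r := by
  have h := Tuple.lt_card_lt_iff_apply_lt_of_monotone (j := (⟨r - 1, by omega⟩ : Fin n))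
    (a := x) (Tuple.monotone_sort y)
  rw [card_perm_eq y _ (· < x)] at h
  rw [orderStat, dif_pos hr, ← not_lt]
  refine (not_congr h.symm).trans ?_
  simp only
  omega

lemma orderStat_mono (y : Fin n → ℝ) {r s : ℕ} (hr : 1 ≤ r) (hrs : r ≤ s) (hs : s ≤ n) :
    orderStat y r ≤ orderStat y s := by
  rw [orderStat, orderStat, dif_pos ⟨hr, hrs.trans hs⟩, dif_pos ⟨hr.trans hrs, hs⟩]
  exact Tuple.monotone_sort y (by simp only [Fin.mk_le_mk]; omega)

lemma sum_orderStat (y : Fin n → ℝ) (f : ℝ → ℝ) :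
    ∑ i ∈ Finset.Icc 1 n, f (orderStat y i) = ∑ i, f (y i) := by
  rw [← Equiv.sum_comp (Tuple.sort y) (fun i => f (y i))]
  refine (Finset.sum_bij (fun (i : Fin n) _ => (i : ℕ) + 1) ?_ ?_ ?_ ?_).symm
  · intro i _; simp
  · intro i _ j _ h; ext; omega
  · intro i hi
    rw [Finset.mem_Icc] at hi
    exact ⟨⟨i - 1, by omega⟩, by simp, by simp only; omega⟩
  · intro i _
    rw [orderStat, dif_pos ⟨by omega, by omega⟩]
    congr

/-- Winsorizing the `m` smallest and the `m'` largest observations is the same as clamping all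
observations to the interval between the two extreme retained order statistics. -/
lemma sum_clamp_orderStat (y : Fin n → ℝ) (f : ℝ → ℝ) {m m' : ℕ} (h : m + m' < n) :
    ∑ i, f (max (orderStat y (m + 1)) (min (orderStat y (n - m')) (y i))) =
      m * f (orderStat y (m + 1)) + ∑ i ∈ Finset.Icc (m + 1) (n - m'), f (orderStat y i)
        + m' * f (orderStat y (n - m')) := by
  set A := orderStat y (m + 1)
  set B := orderStat y (n - m')
  have hAB : A ≤ B := orderStat_mono y (by omega) (by omega) (by omega)
  rw [← sum_orderStat y fun z => f (max A (min B z))]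
  have hsplit : Finset.Icc 1 n =
      (Finset.Icc 1 m ∪ Finset.Icc (m + 1) (n - m')) ∪ Finset.Icc (n - m' + 1) n := by
    ext i; simp only [Finset.mem_union, Finset.mem_Icc]; omega
  rw [hsplit, Finset.sum_union, Finset.sum_union]
  · congr 1
    · congr 1
      · rw [Finset.sum_congr rfl (g := fun _ => f A)]
        · simp
        · intro i hi
          rw [Finset.mem_Icc] at hi
          have : orderStat y i ≤ A := orderStat_mono y hi.1 (by omega) (by omega)
          rw [max_eq_left ((min_le_right _ _).trans this)]
      · refine Finset.sum_congr rfl fun i hi => ?_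
        rw [Finset.mem_Icc] at hi
        rw [min_eq_right (orderStat_mono y (by omega) hi.2 (by omega)),
          max_eq_right (orderStat_mono y (by omega) hi.1 (by omega))]
    · rw [Finset.sum_congr rfl (g := fun _ => f B)]
      · simp only [Finset.sum_const, Nat.card_Icc, nsmul_eq_mul]
        congr 2
        omega
      · intro i hi
        rw [Finset.mem_Icc] at hi
        rw [min_eq_left (orderStat_mono y (by omega) (by omega) hi.2), max_eq_right hAB]
  · rw [Finset.disjoint_left]; intro i; simp only [Finset.mem_Icc]; omega
  · rw [Finset.disjoint_left]; intro i; simp only [Finset.mem_union, Finset.mem_Icc]; omega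

end OrderStat

/-! ### Asymptotics of order statistics -/

section Bahadur

variable {Ω : Type*} {P : Measure ℝ} {Y : ℕ → Ω → ℝ}

/-- The `r`-th order statistic of the first `n` observations, as a function on `ℕ × Ω`. -/
noncomputable def ostat (Y : ℕ → Ω → ℝ) (r : ℕ) (x : ℕ × Ω) : ℝ :=
  orderStat (fun i : Fin x.1 => Y i x.2) r

lemma sum_range_ite_eq_card (x : ℕ × Ω) (p : ℝ → Prop) [DecidablePred p] :
    ∑ i ∈ Finset.range x.1, (if p (Y i x.2) then (1 : ℝ) else 0) =
      ((Finset.univ.filter fun i : Fin x.1 => p (Y i x.2)).card : ℝ) := by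
  rw [Finset.sum_range (fun i => if p (Y i x.2) then (1 : ℝ) else 0), Finset.sum_boole]

lemma ostat_le_iff {x : ℕ × Ω} {r : ℕ} (hr : 1 ≤ r ∧ r ≤ x.1) (u : ℝ) :
    ostat Y r x ≤ u ↔ (r : ℝ) / x.1 ≤ emp Y (below u) x := by
  have hx : (0 : ℝ) < x.1 := by exact_mod_cast (by omega : 0 < x.1)
  rw [ostat, orderStat_le_iff _ hr, emp, div_le_div_iff_of_pos_right hx]
  simp only [below]
  rw [sum_range_ite_eq_card x (· ≤ u)]
  exact_mod_cast Iff.rfl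

lemma emp_lt_ostat_le {x : ℕ × Ω} {r : ℕ} (hr : 1 ≤ r ∧ r ≤ x.1) :
    emp Y (fun y => if y < ostat Y r x then 1 else 0) x ≤ (r : ℝ) / x.1 := by
  have hx : (0 : ℝ) < x.1 := by exact_mod_cast (by omega : 0 < x.1)
  rw [emp, div_le_div_iff_of_pos_right hx, sum_range_ite_eq_card x (· < ostat Y r x)]
  exact_mod_cast ((le_orderStat_iff (fun i : Fin x.1 => Y i x.2) hr _).1 le_rfl).le

/-- Replacing the threshold `q` by an order statistic `A` in the empirical mean of `ψ (max q y)`: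
the change is `ψ A - ψ q` times the proportion of observations below `q`, up to the contribution
of the observations that lie between `A` and `q`. -/
lemma abs_emp_max_ostat_sub_le {x : ℕ × Ω} {r : ℕ} (hr : 1 ≤ r ∧ r ≤ x.1) {ψ : ℝ → ℝ}
    {q δ L : ℝ} (hL : 0 ≤ L)
    (hψ : ∀ u ∈ Set.Icc (q - δ) (q + δ), ∀ v ∈ Set.Icc (q - δ) (q + δ),
      |ψ u - ψ v| ≤ L * |u - v|)
    (hA : |ostat Y r x - q| ≤ δ) :
    |emp Y (fun y => ψ (max (ostat Y r x) y)) x - emp Y (fun y => ψ (max q y)) x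
        - (ψ (ostat Y r x) - ψ q) * emp Y (below q) x|
      ≤ L * |ostat Y r x - q| * |emp Y (below q) x - (r : ℝ) / x.1| := by
  set A := ostat Y r x with hAdef
  have hδ : 0 ≤ δ := (abs_nonneg _).trans hA
  have hA' := abs_le.1 hA
  rw [← emp_const_mul, ← emp_sub, ← emp_sub]
  refine (abs_emp_le _ _).trans ?_
  have hLA : 0 ≤ L * |A - q| := by positivity
  rcases lt_trichotomy q A with h | h | h
  · have hb : ∀ y, |ψ (max A y) - ψ (max q y) - (ψ A - ψ q) * below q y| ≤
        L * |A - q| * ((if y < A then 1 else 0) - below q y) := by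
      intro y
      unfold below
      rcases le_or_gt y q with h1 | h1
      · rw [if_pos h1, if_pos (h1.trans_lt h), max_eq_left h1, max_eq_left (h1.trans h.le)]
        simp
      · rw [if_neg (not_le.2 h1), max_eq_right h1.le]
        rcases lt_or_ge y A with h2 | h2
        · rw [if_pos h2, max_eq_left h2.le]
          simp only [mul_zero, sub_zero, mul_one]
          refine (hψ A ⟨by linarith, by linarith⟩ y ⟨by linarith, by linarith⟩).trans ?_
          refine mul_le_mul_of_nonneg_left ?_ hL
          rw [abs_of_nonneg (by linarith), abs_of_nonneg (by linarith)]
          linarith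
        · rw [if_neg (not_lt.2 h2), max_eq_right h2]
          simp
    refine (emp_mono hb x).trans ?_
    rw [emp_const_mul, emp_sub]
    refine mul_le_mul_of_nonneg_left ?_ hLA
    rw [abs_sub_comm]
    exact (sub_le_sub_right (emp_lt_ostat_le hr) _).trans (le_abs_self _)
  · simp [← h, emp]
  · have hb : ∀ y, |ψ (max A y) - ψ (max q y) - (ψ A - ψ q) * below q y| ≤
        L * |A - q| * (below q y - below A y) := by
      intro y
      unfold below
      rcases le_or_gt y A with h1 | h1
      · rw [if_pos h1, if_pos (h1.trans h.le), max_eq_left h1, max_eq_left (h1.trans h.le)]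
        simp
      · rw [if_neg (not_le.2 h1), max_eq_right h1.le]
        rcases le_or_gt y q with h2 | h2
        · rw [if_pos h2, max_eq_left h2]
          have : ψ y - ψ q - (ψ A - ψ q) * 1 = ψ y - ψ A := by ring
          rw [this, sub_zero, mul_one]
          refine (hψ y ⟨by linarith, by linarith⟩ A ⟨by linarith, by linarith⟩).trans ?_
          refine mul_le_mul_of_nonneg_left ?_ hL
          rw [abs_of_nonneg (by linarith), abs_of_nonpos (by linarith)]
          linarith
        · rw [if_neg (not_le.2 h2), max_eq_right h2.le]
          simp
    refine (emp_mono hb x).trans ?_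
    rw [emp_const_mul, emp_sub]
    refine mul_le_mul_of_nonneg_left ?_ hLA
    exact (sub_le_sub_left ((ostat_le_iff hr A).1 le_rfl) _).trans (le_abs_self _)

variable [MeasurableSpace Ω] {μ : Measure Ω}

lemma tendsto_of_sqrt_mul_sub {R : ℕ × Ω → ℝ} {p : ℝ}
    (hR : Tendsto (fun x => √(x.1 : ℝ) * (R x - p)) (inProb μ) (𝓝 0)) :
    Tendsto R (inProb μ) (𝓝 p) :=
  tendsto_of_tight_sqrt (Tight.of_tendsto hR)

variable [IsProbabilityMeasure μ]

lemma emp_below_eq_zero (hlaw : ∀ i, HasLaw (Y i) P μ) {u : ℝ} (hu : cdf P u = 0) :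
    ∀ᶠ x in inProb μ, emp Y (below u) x = 0 := by
  have hP : IsProbabilityMeasure P := (hlaw 0).isProbabilityMeasure_iff.1 inferInstance
  refine eventually_inProb_of_ae fun n => ?_
  have h0 : P (Set.Iic u) = 0 := by rw [← ofReal_cdf, hu, ENNReal.ofReal_zero]
  have h : ∀ i, ∀ᵐ ω ∂μ, u < Y i ω := by
    intro i
    have := (hlaw i).map_eq ▸ h0
    rw [Measure.map_apply_of_aemeasurable (hlaw i).aemeasurable measurableSet_Iic] at this
    rw [ae_iff]
    simpa [Set.preimage, Set.mem_Iic] using this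
  filter_upwards [ae_all_iff.2 h] with ω hω
  rw [emp, Finset.sum_eq_zero, zero_div]
  intro i _
  rw [below, if_neg (not_le.2 (hω i))]

/-- Consistency of sample quantiles. The second alternative in `hlt` covers the left endpoint of
the support, where `p` may be `0`. -/
lemma tendsto_ostat (hindep : iIndepFun Y μ) (hlaw : ∀ i, HasLaw (Y i) P μ) {r : ℕ × Ω → ℕ}
    {p q : ℝ} (hr : Tendsto (fun x => (r x : ℝ) / x.1) (inProb μ) (𝓝 p))
    (hrange : ∀ᶠ x in inProb μ, 1 ≤ r x ∧ r x ≤ x.1)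
    (hgt : ∀ u, q < u → p < cdf P u) (hlt : ∀ u, u < q → cdf P u < p ∨ cdf P u = 0) :
    Tendsto (fun x => ostat Y (r x) x) (inProb μ) (𝓝 q) := by
  have hP : IsProbabilityMeasure P := (hlaw 0).isProbabilityMeasure_iff.1 inferInstance
  have hF : ∀ u, Tendsto (emp Y (below u)) (inProb μ) (𝓝 (cdf P u)) := fun u => by
    rw [← integral_below]
    exact tendsto_emp hindep hlaw (measurable_below u) (abs_below_le u)
  rw [tendsto_order]
  constructor
  · intro u hu
    rcases hlt u hu with h | h
    · filter_upwards [hrange, (hF u).eventually_lt hr h] with x hx hlt'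
      rw [← not_le, ostat_le_iff hx, not_le]
      exact hlt'
    · filter_upwards [hrange, emp_below_eq_zero hlaw h] with x hx h0
      rw [← not_le, ostat_le_iff hx, not_le, h0]
      have h1 : (0 : ℝ) < r x := by exact_mod_cast hx.1
      have h2 : (0 : ℝ) < x.1 := by exact_mod_cast hx.1.trans hx.2
      positivity
  · intro u hu
    obtain ⟨v, hqv, hvu⟩ := exists_between hu
    filter_upwards [hrange, hr.eventually_lt (hF v) (hgt v hqv)] with x hx hlt'
    exact ((ostat_le_iff hx v).2 hlt'.le).trans_lt hvu

/-- The increments of the empirical distribution function over intervals of length of order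
`n ^ (-1/2)` are asymptotically those of the distribution function. -/
lemma tendsto_emp_below_increment (hindep : iIndepFun Y μ) (hlaw : ∀ i, HasLaw (Y i) P μ)
    {q f : ℝ} (hf : HasDerivAt (cdf P) f q) (u : ℝ) :
    Tendsto (fun x => √(x.1 : ℝ) *
      (emp Y (below (q + (√(x.1 : ℝ))⁻¹ * u)) x - emp Y (below q) x)) (inProb μ) (𝓝 (f * u)) := by
  have hP : IsProbabilityMeasure P := (hlaw 0).isProbabilityMeasure_iff.1 inferInstance
  have hs : Tendsto (fun n : ℕ => √(n : ℝ)) atTop atTop :=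
    Real.tendsto_sqrt_atTop.comp tendsto_natCast_atTop_atTop
  have hqn : Tendsto (fun n : ℕ => q + (√(n : ℝ))⁻¹ * u) atTop (𝓝 q) := by
    simpa using tendsto_const_nhds.add ((tendsto_inv_atTop_zero.comp hs).mul_const u)
  have h1 : Tendsto (fun x : ℕ × Ω => empProc P Y
      (fun y => below (q + (√(x.1 : ℝ))⁻¹ * u) y - below q y) x) (inProb μ) (𝓝 0) := by
    refine tendsto_empProc_zero (C := 2) hindep hlaw
      (f := fun n y => below (q + (√(n : ℝ))⁻¹ * u) y - below q y)
      (fun n => (measurable_below _).sub (measurable_below _)) (fun n y => ?_) ?_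
    · have := abs_sub (below (q + (√(n : ℝ))⁻¹ * u) y) (below q y)
      linarith [abs_below_le (q + (√(n : ℝ))⁻¹ * u) y, abs_below_le q y]
    · simp only [integral_below_sub_sq]
      have := (hf.continuousAt.tendsto.comp hqn).sub_const (cdf P q)
      simpa using this.abs
  have h2 : Tendsto (fun n : ℕ => √(n : ℝ) * (cdf P (q + (√(n : ℝ))⁻¹ * u) - cdf P q)) atTop
      (𝓝 (f * u)) := by
    have := hf.hasFDerivAt.lim u (tendsto_norm_atTop_atTop.comp hs)
    simpa [mul_comm] using this
  have h3 := h1.add (h2.comp (tendsto_fst_inProb (μ := μ)))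
  rw [zero_add] at h3
  refine h3.congr fun x => ?_
  simp only [Function.comp]
  rw [empProc, emp_sub, integral_sub (integrable_below _) (integrable_below _), integral_below,
    integral_below]
  ring

/-- Bahadur's representation of a sample quantile, with remainder `o(n ^ (-1/2))` in
probability and a possibly random index. -/
lemma tendsto_bahadur (hindep : iIndepFun Y μ) (hlaw : ∀ i, HasLaw (Y i) P μ) {r : ℕ × Ω → ℕ}
    {q f : ℝ}
    (hr : Tendsto (fun x => √(x.1 : ℝ) * ((r x : ℝ) / x.1 - cdf P q)) (inProb μ) (𝓝 0))
    (hrange : ∀ᶠ x in inProb μ, 1 ≤ r x ∧ r x ≤ x.1)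
    (hf : HasDerivAt (cdf P) f q) (hf0 : 0 < f) :
    Tendsto (fun x => √(x.1 : ℝ) * (ostat Y (r x) x - q) + f⁻¹ * empProc P Y (below q) x)
      (inProb μ) (𝓝 0) := by
  have hP : IsProbabilityMeasure P := (hlaw 0).isProbabilityMeasure_iff.1 inferInstance
  have hZ : Tight μ fun x => -f⁻¹ * empProc P Y (below q) x :=
    (tight_empProc hindep hlaw (measurable_below q) (abs_below_le q)).const_mul _
  -- a bound on the order statistic is a bound on an increment of the empirical distribution
  have key : ∀ (u : ℝ) (x : ℕ × Ω), 1 ≤ r x ∧ r x ≤ x.1 →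
      (√(x.1 : ℝ) * (ostat Y (r x) x - q) ≤ u ↔
        √(x.1 : ℝ) * ((r x : ℝ) / x.1 - cdf P q) - empProc P Y (below q) x ≤
          √(x.1 : ℝ) * (emp Y (below (q + (√(x.1 : ℝ))⁻¹ * u)) x - emp Y (below q) x)) := by
    intro u x hx
    have h0 : (0 : ℝ) < x.1 := by exact_mod_cast hx.1.trans hx.2
    have hs : 0 < √(x.1 : ℝ) := Real.sqrt_pos.2 h0
    have e1 : √(x.1 : ℝ) * (ostat Y (r x) x - q) ≤ u ↔
        ostat Y (r x) x ≤ q + (√(x.1 : ℝ))⁻¹ * u := by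
      rw [← sub_le_iff_le_add', inv_mul_eq_div, le_div_iff₀ hs, mul_comm]
    rw [e1, ostat_le_iff hx, empProc, integral_below, ← mul_sub, mul_le_mul_iff_right₀ hs]
    constructor <;> intro h <;> linarith
  have := tendsto_sub_zero_of_levels (V := fun x => √(x.1 : ℝ) * (ostat Y (r x) x - q)) hZ ?_ ?_
  · refine this.congr fun x => by ring
  · intro u v huv
    have hD := (hr.sub (tendsto_emp_below_increment hindep hlaw hf u))
    have hlim : -(f * v) < 0 - f * u := by nlinarith
    filter_upwards [hrange, hD.eventually (lt_mem_nhds hlim)] with x hx hlt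
    rintro ⟨h1, h2⟩
    rw [key u x hx] at h1
    have h3 : f * v ≤ -empProc P Y (below q) x := by
      calc f * v ≤ f * (-f⁻¹ * empProc P Y (below q) x) := by gcongr
        _ = _ := by field_simp
    linarith
  · intro u v huv
    obtain ⟨w, huw, hwv⟩ := exists_between huv
    have hD := (hr.sub (tendsto_emp_below_increment hindep hlaw hf w))
    have hlim : 0 - f * w < -(f * u) := by nlinarith
    filter_upwards [hrange, hD.eventually (gt_mem_nhds hlim)] with x hx hlt
    rintro ⟨h1, h2⟩
    have h4 := (not_congr (key w x hx)).1 (by linarith)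
    have h3 : -empProc P Y (below q) x ≤ f * u := by
      calc -empProc P Y (below q) x = f * (-f⁻¹ * empProc P Y (below q) x) := by field_simp
        _ ≤ f * u := by gcongr
    linarith

/-- A smooth function of a sample quantile. -/
lemma tendsto_bahadur_comp (hindep : iIndepFun Y μ) (hlaw : ∀ i, HasLaw (Y i) P μ)
    {r : ℕ × Ω → ℕ} {q f ψ' : ℝ} {ψ : ℝ → ℝ}
    (hr : Tendsto (fun x => √(x.1 : ℝ) * ((r x : ℝ) / x.1 - cdf P q)) (inProb μ) (𝓝 0))
    (hrange : ∀ᶠ x in inProb μ, 1 ≤ r x ∧ r x ≤ x.1)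
    (hf : HasDerivAt (cdf P) f q) (hf0 : 0 < f) (hψ : HasDerivAt ψ ψ' q) :
    Tendsto (fun x => √(x.1 : ℝ) * (ψ (ostat Y (r x) x) - ψ q)
      + ψ' / f * empProc P Y (below q) x) (inProb μ) (𝓝 0) := by
  have hB := tendsto_bahadur hindep hlaw hr hrange hf hf0
  have hG : Tight μ (empProc P Y (below q)) :=
    tight_empProc hindep hlaw (measurable_below q) (abs_below_le q)
  have hV : Tight μ fun x => √(x.1 : ℝ) * (ostat Y (r x) x - q) :=
    (hG.const_mul (-f⁻¹)).of_tendsto_sub (hB.congr fun x => by ring)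
  have hA : Tendsto (fun x => ostat Y (r x) x) (inProb μ) (𝓝 q) := tendsto_of_tight_sqrt hV
  have hlin : Tendsto (fun x => √(x.1 : ℝ) * (ψ (ostat Y (r x) x) - ψ q
      - (ostat Y (r x) x - q) * ψ')) (inProb μ) (𝓝 0) := by
    refine hV.tendsto_of_isLittleO ?_
    have := (hψ.isLittleO).comp_tendsto hA
    simpa using (Asymptotics.isBigO_refl (fun x : ℕ × Ω => √(x.1 : ℝ)) (inProb μ)).mul_isLittleO
      this
  have h := hlin.add (hB.const_mul ψ')
  rw [mul_zero, add_zero] at h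
  refine h.congr fun x => ?_
  field_simp
  ring

/-- Linearization of the empirical mean of `ψ (max A y)` when `A` is a sample quantile. -/
lemma tendsto_emp_max_ostat (hindep : iIndepFun Y μ) (hlaw : ∀ i, HasLaw (Y i) P μ)
    {r : ℕ × Ω → ℕ} {q : ℝ} {ψ : ℝ → ℝ} (hψ : ContDiff ℝ 1 ψ)
    (hr : Tendsto (fun x => √(x.1 : ℝ) * ((r x : ℝ) / x.1 - cdf P q)) (inProb μ) (𝓝 0))
    (hrange : ∀ᶠ x in inProb μ, 1 ≤ r x ∧ r x ≤ x.1)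
    (hA : Tendsto (fun x => ostat Y (r x) x) (inProb μ) (𝓝 q)) :
    Tendsto (fun x => √(x.1 : ℝ) * (emp Y (fun y => ψ (max (ostat Y (r x) x) y)) x
      - emp Y (fun y => ψ (max q y)) x - cdf P q * (ψ (ostat Y (r x) x) - ψ q)))
      (inProb μ) (𝓝 0) := by
  have hP : IsProbabilityMeasure P := (hlaw 0).isProbabilityMeasure_iff.1 inferInstance
  have hG : Tight μ (empProc P Y (below q)) :=
    tight_empProc hindep hlaw (measurable_below q) (abs_below_le q)
  obtain ⟨L, s, hs, hLip⟩ := hψ.contDiffAt.exists_lipschitzOnWith (x := q)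
  obtain ⟨δ, hδ, hδs⟩ := Metric.nhds_basis_closedBall.mem_iff.1 hs
  rw [Real.closedBall_eq_Icc] at hδs
  have hLip' : ∀ u ∈ Set.Icc (q - δ) (q + δ), ∀ v ∈ Set.Icc (q - δ) (q + δ),
      |ψ u - ψ v| ≤ L * |u - v| := fun u hu v hv => by
    simpa [Real.dist_eq] using hLip.dist_le_mul u (hδs hu) v (hδs hv)
  have hAq : Tendsto (fun x => (L : ℝ) * |ostat Y (r x) x - q|) (inProb μ) (𝓝 0) := by
    simpa using ((hA.sub_const q).abs).const_mul (L : ℝ)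
  have hcount : Tight μ fun x => |√(x.1 : ℝ) * (emp Y (below q) x - (r x : ℝ) / x.1)| := by
    have h1 : Tight μ fun x => √(x.1 : ℝ) * (emp Y (below q) x - (r x : ℝ) / x.1) := by
      refine hG.of_tendsto_sub ?_
      have := hr.neg
      rw [neg_zero] at this
      refine this.congr fun x => ?_
      rw [empProc, integral_below]
      ring
    exact h1.of_eventually_le 1 0 (Eventually.of_forall fun x => by simp)
  have hrem := hcount.mul_tendsto_zero hAq
  have hmain : Tendsto (fun x => √(x.1 : ℝ) * (emp Y (fun y => ψ (max (ostat Y (r x) x) y)) x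
      - emp Y (fun y => ψ (max q y)) x - (ψ (ostat Y (r x) x) - ψ q) * emp Y (below q) x))
      (inProb μ) (𝓝 0) := by
    refine squeeze_zero_norm' ?_ hrem
    filter_upwards [hrange, hA.eventually (Metric.closedBall_mem_nhds q hδ)] with x hx hxδ
    rw [Real.norm_eq_abs, abs_mul, abs_mul, mul_left_comm]
    refine mul_le_mul_of_nonneg_left ?_ (abs_nonneg _)
    exact abs_emp_max_ostat_sub_le hx L.2 hLip' (by simpa [Real.dist_eq] using hxδ)
  have hψA : Tendsto (fun x => ψ (ostat Y (r x) x) - ψ q) (inProb μ) (𝓝 0) := by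
    simpa using ((hψ.continuous.tendsto q).comp hA).sub_const (ψ q)
  have h := hmain.add (hG.mul_tendsto_zero hψA)
  rw [add_zero] at h
  refine h.congr fun x => ?_
  rw [empProc, integral_below]
  ring

end Bahadur

/-! ### Asymptotic linearity of winsorized means -/

section Winsorized

variable {Ω : Type*} {P : Measure ℝ} {Y : ℕ → Ω → ℝ}

/-- Clamping a number to the interval `[A, B]`. -/
noncomputable def wins (A B y : ℝ) : ℝ := max A (min B y)

lemma continuous_wins (A B : ℝ) : Continuous (wins A B) := by unfold wins; fun_prop

lemma wins_mem {A B : ℝ} (h : A ≤ B) (y : ℝ) : wins A B y ∈ Set.Icc A B :=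
  ⟨le_max_left _ _, max_le h (min_le_left _ _)⟩

/-- Clamping on both sides in terms of clamping on one side. -/
lemma apply_wins {A B : ℝ} (h : A ≤ B) (ψ : ℝ → ℝ) (y : ℝ) :
    ψ (wins A B y) = ψ (max A y) - ψ (max B y) + ψ B := by
  unfold wins
  rcases le_total y B with h1 | h1
  · rw [min_eq_right h1, max_eq_left h1]; ring
  · rw [min_eq_left h1, max_eq_right h1, max_eq_right h, max_eq_right (h.trans h1)]; ring

lemma emp_wins {A B : ℝ} (h : A ≤ B) (ψ : ℝ → ℝ) {x : ℕ × Ω} (hx : 0 < x.1) :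
    emp Y (fun y => ψ (wins A B y)) x =
      emp Y (fun y => ψ (max A y)) x - emp Y (fun y => ψ (max B y)) x + ψ B := by
  simp only [apply_wins h]
  rw [emp_add, emp_sub, emp_const _ hx]

lemma exists_bound_wins {A B : ℝ} (h : A ≤ B) {ψ : ℝ → ℝ} (hψ : Continuous ψ) :
    ∃ C, ∀ y, |ψ (wins A B y)| ≤ C := by
  obtain ⟨C, hC⟩ := (isCompact_Icc (a := A) (b := B)).exists_bound_of_continuousOn hψ.continuousOn
  exact ⟨C, fun y => hC _ (wins_mem h y)⟩

/-- The influence function of a winsorized mean: the clamped function together with the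
contributions of the two estimated quantiles, with weights `α` and `β`. -/
noncomputable def influence (ψ : ℝ → ℝ) (qa qb α β y : ℝ) : ℝ :=
  ψ (wins qa qb y) - α * below qa y - β * below qb y

lemma measurable_influence {ψ : ℝ → ℝ} (hψ : Continuous ψ) (qa qb α β : ℝ) :
    Measurable (influence ψ qa qb α β) :=
  (((hψ.comp (continuous_wins qa qb)).measurable.sub ((measurable_below qa).const_mul α))).sub
    ((measurable_below qb).const_mul β)

lemma exists_bound_influence {ψ : ℝ → ℝ} (hψ : Continuous ψ) {qa qb : ℝ} (h : qa ≤ qb)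
    (α β : ℝ) : ∃ C, ∀ y, |influence ψ qa qb α β y| ≤ C := by
  obtain ⟨C, hC⟩ := exists_bound_wins h hψ
  refine ⟨C + |α| + |β|, fun y => ?_⟩
  have h1 : |α * below qa y| ≤ |α| := by
    rw [abs_mul]; exact mul_le_of_le_one_right (abs_nonneg _) (abs_below_le _ _)
  have h2 : |β * below qb y| ≤ |β| := by
    rw [abs_mul]; exact mul_le_of_le_one_right (abs_nonneg _) (abs_below_le _ _)
  unfold influence
  have h3 := abs_sub (ψ (wins qa qb y) - α * below qa y) (β * below qb y)
  have h4 := abs_sub (ψ (wins qa qb y)) (α * below qa y)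
  linarith [hC y]

variable [MeasurableSpace Ω] {μ : Measure Ω}

/-- With probability tending to one the retained part of the sample is nonempty. -/
lemma eventually_add_lt {m m' : ℕ → Ω → ℕ} {a b : ℝ} (hab : a < 1 - b)
    (hm : Tendsto (fun x : ℕ × Ω => √(x.1 : ℝ) * ((m x.1 x.2 : ℝ) / x.1 - a)) (inProb μ) (𝓝 0))
    (hm' : Tendsto (fun x : ℕ × Ω => √(x.1 : ℝ) * ((m' x.1 x.2 : ℝ) / x.1 - b))
      (inProb μ) (𝓝 0)) :
    ∀ᶠ x in inProb μ, m x.1 x.2 + m' x.1 x.2 < x.1 := by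
  have h := (tendsto_of_sqrt_mul_sub hm).add (tendsto_of_sqrt_mul_sub hm')
  filter_upwards [h.eventually (gt_mem_nhds (by linarith : a + b < 1)), eventually_pos_inProb]
    with x hx h0
  have h0' : (0 : ℝ) < x.1 := by exact_mod_cast h0
  rw [← add_div, div_lt_one h0'] at hx
  exact_mod_cast hx

variable [IsProbabilityMeasure μ]

/-- Asymptotic linearity of winsorized means: up to `o(n ^ (-1/2))` in probability, a winsorized
mean is the empirical mean of its influence function. No derivative of the distribution function
at the lower quantile is needed when `a = 0`. -/
lemma tendsto_winsorized (hindep : iIndepFun Y μ) (hlaw : ∀ i, HasLaw (Y i) P μ)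
    {m m' : ℕ → Ω → ℕ} {a b qa qb fa fb ψa ψb : ℝ} {ψ : ℝ → ℝ} (hψ : ContDiff ℝ 1 ψ)
    (hab : a < 1 - b) (hq : qa ≤ qb) (hFa : cdf P qa = a) (hFb : cdf P qb = 1 - b)
    (hm : Tendsto (fun x : ℕ × Ω => √(x.1 : ℝ) * ((m x.1 x.2 : ℝ) / x.1 - a)) (inProb μ) (𝓝 0))
    (hm' : Tendsto (fun x : ℕ × Ω => √(x.1 : ℝ) * ((m' x.1 x.2 : ℝ) / x.1 - b))
      (inProb μ) (𝓝 0))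
    (hgt : ∀ u, qa < u → a < cdf P u) (hlt : ∀ u, u < qa → cdf P u < a ∨ cdf P u = 0)
    (hfa : 0 < a → HasDerivAt (cdf P) fa qa ∧ 0 < fa) (hfb : HasDerivAt (cdf P) fb qb)
    (hfb0 : 0 < fb) (hψa : HasDerivAt ψ ψa qa) (hψb : HasDerivAt ψ ψb qb) :
    Tendsto (fun x => √(x.1 : ℝ) * (emp Y (fun y => ψ (wins (ostat Y (m x.1 x.2 + 1) x)
        (ostat Y (x.1 - m' x.1 x.2) x) y)) x - ∫ y, ψ (wins qa qb y) ∂P)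
      - empProc P Y (influence ψ qa qb (a * (ψa / fa)) (b * (ψb / fb))) x) (inProb μ) (𝓝 0) := by
  have hP : IsProbabilityMeasure P := (hlaw 0).isProbabilityMeasure_iff.1 inferInstance
  have ha : 0 ≤ a := hFa ▸ cdf_nonneg P qa
  have hlt' := eventually_add_lt hab hm hm'
  have hra : Tendsto (fun x : ℕ × Ω => √(x.1 : ℝ) * (((m x.1 x.2 + 1 : ℕ) : ℝ) / x.1 - cdf P qa))
      (inProb μ) (𝓝 0) := by
    have h1 : Tendsto (fun x : ℕ × Ω => (√(x.1 : ℝ))⁻¹) (inProb μ) (𝓝 0) :=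
      tendsto_inv_atTop_zero.comp tendsto_sqrt_inProb
    have h2 := hm.add h1
    rw [add_zero] at h2
    refine h2.congr' ?_
    filter_upwards [eventually_pos_inProb] with x hx
    have h0 : (0 : ℝ) < x.1 := by exact_mod_cast hx
    have h3 : (√(x.1 : ℝ))⁻¹ = √(x.1 : ℝ) * (1 / x.1) := by
      rw [← Real.sqrt_div_self]; ring
    rw [hFa, h3]
    push_cast
    ring
  have hrb : Tendsto (fun x : ℕ × Ω => √(x.1 : ℝ) * (((x.1 - m' x.1 x.2 : ℕ) : ℝ) / x.1
      - cdf P qb)) (inProb μ) (𝓝 0) := by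
    have h2 := hm'.neg
    rw [neg_zero] at h2
    refine h2.congr' ?_
    filter_upwards [hlt'] with x hx
    have h0 : (x.1 : ℝ) ≠ 0 := by
      have : x.1 ≠ 0 := by omega
      exact_mod_cast this
    rw [hFb, Nat.cast_sub (by omega)]
    field_simp
    ring
  have hrange_a : ∀ᶠ x in inProb μ, 1 ≤ m x.1 x.2 + 1 ∧ m x.1 x.2 + 1 ≤ x.1 := by
    filter_upwards [hlt'] with x hx
    omega
  have hrange_b : ∀ᶠ x in inProb μ, 1 ≤ x.1 - m' x.1 x.2 ∧ x.1 - m' x.1 x.2 ≤ x.1 := by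
    filter_upwards [hlt'] with x hx
    omega
  have hA : Tendsto (fun x => ostat Y (m x.1 x.2 + 1) x) (inProb μ) (𝓝 qa) :=
    tendsto_ostat hindep hlaw (tendsto_of_sqrt_mul_sub hra) hrange_a
      (by rwa [hFa]) (by rwa [hFa])
  have hVb := tendsto_bahadur hindep hlaw hrb hrange_b hfb hfb0
  have hB : Tendsto (fun x => ostat Y (x.1 - m' x.1 x.2) x) (inProb μ) (𝓝 qb) := by
    have hG : Tight μ (empProc P Y (below qb)) :=
      tight_empProc hindep hlaw (measurable_below qb) (abs_below_le qb)
    exact tendsto_of_tight_sqrt ((hG.const_mul (-fb⁻¹)).of_tendsto_sub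
      (hVb.congr fun x => by rw [smul_eq_mul]; ring))
  have t1 := tendsto_emp_max_ostat hindep hlaw hψ hra hrange_a hA
  have t2 := tendsto_emp_max_ostat hindep hlaw hψ hrb hrange_b hB
  have t3 := (tendsto_bahadur_comp hindep hlaw hrb hrange_b hfb hfb0 hψb).const_mul b
  have t4 : Tendsto (fun x => a * (√(x.1 : ℝ) * (ψ (ostat Y (m x.1 x.2 + 1) x) - ψ qa)
      + ψa / fa * empProc P Y (below qa) x)) (inProb μ) (𝓝 0) := by
    rcases ha.eq_or_lt with h0 | h0
    · simpa [← h0] using tendsto_const_nhds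
    · simpa using (tendsto_bahadur_comp hindep hlaw hra hrange_a (hfa h0).1 (hfa h0).2
        hψa).const_mul a
  have h := (t1.sub t2).add (t3.add t4)
  simp only [mul_zero, add_zero, sub_zero] at h
  refine h.congr' ?_
  filter_upwards [hlt'] with x hx
  have hAB : ostat Y (m x.1 x.2 + 1) x ≤ ostat Y (x.1 - m' x.1 x.2) x :=
    orderStat_mono _ (by omega) (by omega) (by omega)
  have hx0 : 0 < x.1 := by omega
  obtain ⟨C, hC⟩ := exists_bound_wins hq hψ.continuous
  have hmeas : Measurable fun y => ψ (wins qa qb y) :=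
    (hψ.continuous.comp (continuous_wins qa qb)).measurable
  have hI := integrable_of_bounded (P := P) hmeas hC
  have hIF : empProc P Y (influence ψ qa qb (a * (ψa / fa)) (b * (ψb / fb))) x =
      empProc P Y (fun y => ψ (wins qa qb y)) x - a * (ψa / fa) * empProc P Y (below qa) x
        - b * (ψb / fb) * empProc P Y (below qb) x := by
    unfold influence
    have hI2 : Integrable (fun y => ψ (wins qa qb y) - a * (ψa / fa) * below qa y) P :=
      hI.sub ((integrable_below qa).const_mul _)
    rw [empProc_sub hI2 ((integrable_below qb).const_mul _),
      empProc_sub hI ((integrable_below qa).const_mul _), empProc_const_mul, empProc_const_mul]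
  have hdef : empProc P Y (fun y => ψ (wins qa qb y)) x =
      √(x.1 : ℝ) * (emp Y (fun y => ψ (wins qa qb y)) x - ∫ y, ψ (wins qa qb y) ∂P) := rfl
  rw [hIF, hdef, emp_wins hAB ψ hx0, emp_wins hq ψ hx0, hFa, hFb]
  ring

end Winsorized

/-! ### A central limit theorem in Euclidean space -/

section CLT

variable {Ω : Type*} [MeasurableSpace Ω] {μ : Measure Ω} [IsProbabilityMeasure μ]
  {ι : Type*} [Fintype ι] [DecidableEq ι]

open scoped RealInnerProductSpace in
/-- The central limit theorem for centred random vectors, by the Cramér–Wold device. -/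
lemma tendstoInDistribution_sum_multivariateGaussian {X : ℕ → Ω → EuclideanSpace ℝ ι}
    (hindep : iIndepFun X μ) (hident : ∀ i, IdentDistrib (X i) (X 0) μ μ)
    {S : Matrix ι ι ℝ} (hS : S.PosSemidef)
    (hL : ∀ t : EuclideanSpace ℝ ι, MemLp (fun ω => ⟪X 0 ω, t⟫) 2 μ)
    (hmean : ∀ t : EuclideanSpace ℝ ι, ∫ ω, ⟪X 0 ω, t⟫ ∂μ = 0)
    (hcov : ∀ t : EuclideanSpace ℝ ι, ∫ ω, ⟪X 0 ω, t⟫ ^ 2 ∂μ = t ⬝ᵥ S *ᵥ t) :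
    TendstoInDistribution (fun (n : ℕ) ω => (√(n : ℝ))⁻¹ • ∑ i ∈ Finset.range n, X i ω) atTop
      (id : EuclideanSpace ℝ ι → EuclideanSpace ℝ ι) (fun _ => μ)
      (multivariateGaussian 0 S) where
  forall_aemeasurable n :=
    (measurable_const_smul _).comp_aemeasurable
      (Finset.aemeasurable_fun_sum _ fun i _ => (hident i).aemeasurable_fst)
  tendsto := by
    have hm : ∀ n : ℕ, AEMeasurable (fun ω => (√(n : ℝ))⁻¹ • ∑ i ∈ Finset.range n, X i ω) μ :=
      fun n => (measurable_const_smul _).comp_aemeasurable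
        (Finset.aemeasurable_fun_sum _ fun i _ => (hident i).aemeasurable_fst)
    refine ProbabilityMeasure.tendsto_iff_tendsto_charFun.2 fun t => ?_
    simp only [ProbabilityMeasure.coe_mk, Measure.map_id]
    rw [charFun_multivariateGaussian hS]
    have hcont : Measurable fun x : EuclideanSpace ℝ ι => ⟪x, t⟫ := by fun_prop
    -- the one-dimensional theorem for the projection on `t`, at the point `1`
    have h1 := tendstoInDistribution_inv_sqrt_mul_sum_sub (P := μ)
      (X := fun i ω => ⟪X i ω, t⟫) (Y := id)
      (P' := gaussianReal 0 Var[fun ω => ⟪X 0 ω, t⟫; μ].toNNReal) HasLaw.id (hL t)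
      (hindep.comp (fun _ x => ⟪x, t⟫) fun _ => hcont)
      (fun i => (hident i).comp hcont)
    have h2 := ProbabilityMeasure.tendsto_iff_tendsto_charFun.1 h1.tendsto 1
    simp only [ProbabilityMeasure.coe_mk, Measure.map_id, charFun_gaussianReal] at h2
    have hv : Var[fun ω => ⟪X 0 ω, t⟫; μ] = t ⬝ᵥ S *ᵥ t := by
      rw [variance_eq_sub (hL t), hmean t, ← hcov t]
      simp
    convert! h2 using 2 with n
    · rw [charFun_apply, charFun_apply, integral_map (hm n) (by fun_prop),
        integral_map (h1.forall_aemeasurable n) (by fun_prop)]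
      refine integral_congr_ae (Eventually.of_forall fun ω => ?_)
      simp only [inner_smul_left, sum_inner, hmean t]
      simp
    · rw [hv]
      have h0 : 0 ≤ t ⬝ᵥ S *ᵥ t := by rw [← hcov t]; positivity
      simp [Real.coe_toNNReal _ h0]

end CLT

/-! ### The standard normal distribution and its quantile function -/

section Normal

lemma phi_eq (x : ℝ) : phi x = (√(2 * Real.pi))⁻¹ * Real.exp (-x ^ 2 / 2) := by
  simp [phi, gaussianPDFReal]

lemma phi_pos (x : ℝ) : 0 < phi x := gaussianPDFReal_pos 0 1 x one_ne_zero

lemma hasDerivAt_phi (x : ℝ) : HasDerivAt phi (-(x * phi x)) x := by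
  have h1 : HasDerivAt (fun y : ℝ => -y ^ 2 / 2) (-x) x := by
    have := ((hasDerivAt_pow 2 x).neg.div_const 2)
    convert! this using 1
    simp; ring
  have h2 := (h1.exp.const_mul (√(2 * Real.pi))⁻¹)
  have h3 : phi = fun y => (√(2 * Real.pi))⁻¹ * Real.exp (-y ^ 2 / 2) := funext phi_eq
  rw [h3]
  convert! h2 using 1
  ring

@[fun_prop]
lemma continuous_phi : Continuous phi :=
  continuous_iff_continuousAt.2 fun x => (hasDerivAt_phi x).continuousAt

lemma Phi_eq_integral (x : ℝ) : Phi x = ∫ y in Set.Iic x, phi y := by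
  rw [Phi, cdf_eq_real, measureReal_def, gaussianReal_apply_eq_integral 0 one_ne_zero,
    ENNReal.toReal_ofReal]
  · rfl
  · exact setIntegral_nonneg measurableSet_Iic fun y _ => (phi_pos y).le

lemma hasStrictDerivAt_Phi (x : ℝ) : HasStrictDerivAt Phi (phi x) x := by
  have h : Phi = fun x => Phi 0 + ∫ y in (0 : ℝ)..x, phi y := by
    ext x
    have hi : Integrable phi := integrable_gaussianPDFReal 0 1
    rw [← intervalIntegral.integral_Iic_sub_Iic hi.integrableOn hi.integrableOn,
      ← Phi_eq_integral, ← Phi_eq_integral]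
    ring
  rw [h]
  exact (continuous_phi.integral_hasStrictDerivAt 0 x).const_add _

lemma hasDerivAt_Phi (x : ℝ) : HasDerivAt Phi (phi x) x := (hasStrictDerivAt_Phi x).hasDerivAt

@[fun_prop]
lemma continuous_Phi : Continuous Phi :=
  continuous_iff_continuousAt.2 fun x => (hasDerivAt_Phi x).continuousAt

lemma strictMono_Phi : StrictMono Phi :=
  strictMono_of_hasDerivAt_pos hasDerivAt_Phi phi_pos

lemma Phi_pos (x : ℝ) : 0 < Phi x :=
  (cdf_nonneg (gaussianReal 0 1) (x - 1)).trans_lt (strictMono_Phi (sub_one_lt x))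

lemma Phi_lt_one (x : ℝ) : Phi x < 1 :=
  (strictMono_Phi (lt_add_one x)).trans_le (cdf_le_one (gaussianReal 0 1) (x + 1))

lemma one_sub_Phi_pos (x : ℝ) : 0 < 1 - Phi x := sub_pos.2 (Phi_lt_one x)

lemma tendsto_Phi_atTop : Tendsto Phi atTop (𝓝 1) := tendsto_cdf_atTop _

lemma PhiInv_Phi (x : ℝ) : PhiInv (Phi x) = x := by
  have : {y | Phi x ≤ cdf (gaussianReal 0 1) y} = Set.Ici x := by
    ext y
    exact strictMono_Phi.le_iff_le
  rw [PhiInv, quantile, this, csInf_Ici]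

lemma exists_Phi_eq {v : ℝ} (h0 : 0 < v) (h1 : v < 1) : ∃ x, Phi x = v := by
  obtain ⟨x, hx⟩ := ((tendsto_order.1 (tendsto_cdf_atBot (gaussianReal 0 1))).2 v h0).exists
  obtain ⟨y, hy⟩ := ((tendsto_order.1 tendsto_Phi_atTop).1 v h1).exists
  have hxy : x ≤ y := by
    by_contra hcon
    exact absurd (strictMono_Phi (not_le.1 hcon)) (not_lt.2 (hx.le.trans hy.le))
  obtain ⟨z, -, hz⟩ := intermediate_value_Icc hxy continuous_Phi.continuousOn ⟨hx.le, hy.le⟩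
  exact ⟨z, hz⟩

lemma Phi_PhiInv {v : ℝ} (h0 : 0 < v) (h1 : v < 1) : Phi (PhiInv v) = v := by
  obtain ⟨x, rfl⟩ := exists_Phi_eq h0 h1
  rw [PhiInv_Phi]

lemma hasDerivAt_PhiInv {v : ℝ} (h0 : 0 < v) (h1 : v < 1) :
    HasDerivAt PhiInv (phi (PhiInv v))⁻¹ v := by
  obtain ⟨x, rfl⟩ := exists_Phi_eq h0 h1
  rw [PhiInv_Phi]
  exact ((hasStrictDerivAt_Phi x).to_local_left_inverse (phi_pos x).ne'
    (Eventually.of_forall PhiInv_Phi)).hasDerivAt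

end Normal

/-! ### Quantiles of the left-truncated standard normal distribution -/

section Delta

lemma level_mem {s : ℝ} (h0 : 0 ≤ s) (h1 : s < 1) (γ : ℝ) :
    0 < s + (1 - s) * Phi γ ∧ s + (1 - s) * Phi γ < 1 := by
  have := Phi_pos γ
  have := one_sub_Phi_pos γ
  constructor
  · have : 0 < (1 - s) * Phi γ := mul_pos (by linarith) (Phi_pos γ)
    linarith
  · nlinarith

lemma Phi_Delta {γ s : ℝ} (h : 0 < s + (1 - s) * Phi γ ∧ s + (1 - s) * Phi γ < 1) :
    Phi (Delta γ s) = s + (1 - s) * Phi γ := Phi_PhiInv h.1 h.2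

lemma Delta_zero (γ : ℝ) : Delta γ 0 = γ := by simp [Delta, PhiInv_Phi]

lemma Delta_lt_Delta {γ s r : ℝ} (h0 : 0 ≤ s) (hsr : s < r) (h1 : r < 1) :
    Delta γ s < Delta γ r := by
  rw [← strictMono_Phi.lt_iff_lt, Phi_Delta (level_mem h0 (hsr.trans h1) γ),
    Phi_Delta (level_mem (h0.trans hsr.le) h1 γ)]
  nlinarith [one_sub_Phi_pos γ]

lemma Delta_mono {γ s r : ℝ} (h0 : 0 ≤ s) (hsr : s ≤ r) (h1 : r < 1) :
    Delta γ s ≤ Delta γ r := by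
  rcases hsr.eq_or_lt with h | h
  · rw [h]
  · exact (Delta_lt_Delta h0 h h1).le

lemma le_Delta {γ s : ℝ} (h0 : 0 ≤ s) (h1 : s < 1) : γ ≤ Delta γ s := by
  simpa [Delta_zero] using Delta_mono (γ := γ) le_rfl h0 h1

lemma hasDerivAt_Delta_right {γ s : ℝ} (h0 : 0 ≤ s) (h1 : s < 1) :
    HasDerivAt (fun s => Delta γ s) ((1 - Phi γ) / phi (Delta γ s)) s := by
  have hs : HasDerivAt (fun s : ℝ => s + (1 - s) * Phi γ) (1 - Phi γ) s := by
    have := (hasDerivAt_id s).add (((hasDerivAt_id s).const_sub 1).mul_const (Phi γ))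
    convert! this using 1
    ring
  have h := level_mem h0 h1 γ
  have := (hasDerivAt_PhiInv h.1 h.2).comp s hs
  convert! this using 1
  rw [Delta, div_eq_inv_mul]

lemma hasDerivAt_Delta_left {γ s : ℝ} (h0 : 0 ≤ s) (h1 : s < 1) :
    HasDerivAt (fun γ => Delta γ s) ((1 - s) * phi γ / phi (Delta γ s)) γ := by
  have hs : HasDerivAt (fun γ : ℝ => s + (1 - s) * Phi γ) ((1 - s) * phi γ) γ :=
    ((hasDerivAt_Phi γ).const_mul (1 - s)).const_add s
  have h := level_mem h0 h1 γ
  have := (hasDerivAt_PhiInv h.1 h.2).comp γ hs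
  convert! this using 1
  rw [Delta, div_eq_inv_mul]

lemma continuousAt_Delta {γ s : ℝ} (h0 : 0 ≤ s) (h1 : s < 1) :
    ContinuousAt (fun p : ℝ × ℝ => Delta p.1 p.2) (γ, s) := by
  have h := level_mem h0 h1 γ
  have hc : ContinuousAt (fun p : ℝ × ℝ => p.2 + (1 - p.2) * Phi p.1) (γ, s) := by fun_prop
  exact ContinuousAt.comp (g := PhiInv) (hasDerivAt_PhiInv h.1 h.2).continuousAt hc

end Delta

/-! ### The constants as integrals over the unit interval -/

section Constants

/-- Winsorizing a function on the unit interval moves the mass outside `[α, β]` to the endpoints. -/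
lemma integral_comp_wins {f : ℝ → ℝ} {α β : ℝ} (h0 : 0 ≤ α) (hαβ : α ≤ β) (h1 : β ≤ 1)
    (hf : Continuous fun s => f (wins α β s)) :
    ∫ s in (0 : ℝ)..1, f (wins α β s) =
      α * f α + (∫ s in α..β, f s) + (1 - β) * f β := by
  rw [← intervalIntegral.integral_add_adjacent_intervals (hf.intervalIntegrable 0 α)
      (hf.intervalIntegrable α 1),
    ← intervalIntegral.integral_add_adjacent_intervals (hf.intervalIntegrable α β)
      (hf.intervalIntegrable β 1), ← add_assoc]
  congr 1
  · congr 1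
    · rw [intervalIntegral.integral_congr (g := fun _ => f α)]
      · simp
      · intro s hs
        rw [Set.uIcc_of_le h0] at hs
        simp only [wins]
        rw [min_eq_right (hs.2.trans hαβ), max_eq_left hs.2]
    · refine intervalIntegral.integral_congr fun s hs => ?_
      rw [Set.uIcc_of_le hαβ] at hs
      simp only [wins]
      rw [min_eq_right hs.2, max_eq_right hs.1]
  · rw [intervalIntegral.integral_congr (g := fun _ => f β)]
    · simp
    · intro s hs
      rw [Set.uIcc_of_le h1] at hs
      simp only [wins]
      rw [min_eq_left hs.1, max_eq_right hαβ]

/-- Differentiation under the integral sign for a jointly continuous derivative. -/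
lemma hasDerivAt_integral_of_continuous {F F' : ℝ → ℝ → ℝ}
    (hF : Continuous fun p : ℝ × ℝ => F p.1 p.2) (hF' : Continuous fun p : ℝ × ℝ => F' p.1 p.2)
    (h : ∀ x s, HasDerivAt (fun x => F x s) (F' x s) x) (x : ℝ) :
    HasDerivAt (fun x => ∫ s in (0 : ℝ)..1, F x s) (∫ s in (0 : ℝ)..1, F' x s) x := by
  obtain ⟨C, hC⟩ := ((isCompact_closedBall x 1).prod
    (isCompact_Icc (a := (0 : ℝ)) (b := 1))).exists_bound_of_continuousOn hF'.continuousOn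
  have hFx : ∀ y, Continuous (F y) := fun y => hF.comp (by fun_prop : Continuous fun s => (y, s))
  have hF'x : ∀ y, Continuous (F' y) := fun y =>
    hF'.comp (by fun_prop : Continuous fun s => (y, s))
  refine (intervalIntegral.hasDerivAt_integral_of_dominated_loc_of_deriv_le
    (bound := fun _ => C) (Metric.closedBall_mem_nhds x one_pos)
    (Eventually.of_forall fun y => (hFx y).aestronglyMeasurable)
    ((hFx x).intervalIntegrable _ _) (hF'x x).aestronglyMeasurable
    (Eventually.of_forall fun s hs y hy => ?_) intervalIntegrable_const
    (Eventually.of_forall fun s _ y _ => h y s)).2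
  rw [Set.uIoc_of_le zero_le_one] at hs
  exact hC (y, s) ⟨hy, hs.1.le, hs.2⟩

variable {a b : ℝ}

lemma wins_mem_unit (ha : 0 ≤ a) (hab : a < 1 - b) (hb : 0 < b) (s : ℝ) :
    0 ≤ wins a (1 - b) s ∧ wins a (1 - b) s < 1 := by
  have := wins_mem hab.le s
  exact ⟨ha.trans this.1, this.2.trans_lt (by linarith)⟩

lemma continuous_Delta_wins (ha : 0 ≤ a) (hab : a < 1 - b) (hb : 0 < b) :
    Continuous fun p : ℝ × ℝ => Delta p.1 (wins a (1 - b) p.2) := by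
  rw [continuous_iff_continuousAt]
  rintro ⟨γ, s⟩
  have h := wins_mem_unit ha hab hb s
  have hc : ContinuousAt (fun p : ℝ × ℝ => (p.1, wins a (1 - b) p.2)) (γ, s) :=
    (continuous_fst.prodMk ((continuous_wins a (1 - b)).comp continuous_snd)).continuousAt
  exact ContinuousAt.comp (x := (γ, s)) (f := fun p : ℝ × ℝ => (p.1, wins a (1 - b) p.2))
    (g := fun p : ℝ × ℝ => Delta p.1 p.2) (continuousAt_Delta h.1 h.2) hc

lemma continuous_Delta_wins_right (ha : 0 ≤ a) (hab : a < 1 - b) (hb : 0 < b) (γ : ℝ) :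
    Continuous fun s => Delta γ (wins a (1 - b) s) :=
  (continuous_Delta_wins ha hab hb).comp (by fun_prop : Continuous fun s : ℝ => (γ, s))

lemma cy_eq_integral (ha : 0 ≤ a) (hab : a < 1 - b) (hb : 0 < b) (γ : ℝ) (k : ℕ) :
    cy a b γ k = ∫ s in (0 : ℝ)..1, Delta γ (wins a (1 - b) s) ^ k := by
  rw [integral_comp_wins (f := fun s => Delta γ s ^ k) ha hab.le (by linarith)
    ((continuous_Delta_wins_right ha hab hb γ).pow k), cy, sub_sub_cancel]

/-- `∂Δ_s/∂γ` at the winsorized argument. -/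
noncomputable def dDelta (a b γ s : ℝ) : ℝ :=
  (1 - wins a (1 - b) s) * phi γ / phi (Delta γ (wins a (1 - b) s))

lemma continuous_dDelta (ha : 0 ≤ a) (hab : a < 1 - b) (hb : 0 < b) :
    Continuous fun p : ℝ × ℝ => dDelta a b p.1 p.2 := by
  have h1 := continuous_Delta_wins ha hab hb
  have h2 := (continuous_wins a (1 - b)).comp (continuous_snd (X := ℝ) (Y := ℝ))
  exact ((continuous_const.sub h2).mul (continuous_phi.comp continuous_fst)).div
    (continuous_phi.comp h1) fun p => (phi_pos _).ne'

lemma continuous_dDelta_right (ha : 0 ≤ a) (hab : a < 1 - b) (hb : 0 < b) (γ : ℝ) :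
    Continuous (dDelta a b γ) :=
  (continuous_dDelta ha hab hb).comp (by fun_prop : Continuous fun s : ℝ => (γ, s))

/-- The derivative of `c_{y,k}` with respect to `γ`, as an integral over the unit interval. -/
noncomputable def cyDgam (a b γ : ℝ) (k : ℕ) : ℝ :=
  ∫ s in (0 : ℝ)..1, k * Delta γ (wins a (1 - b) s) ^ (k - 1) * dDelta a b γ s

lemma continuous_cyDgam_integrand (ha : 0 ≤ a) (hab : a < 1 - b) (hb : 0 < b) (k : ℕ) :
    Continuous fun p : ℝ × ℝ =>
      (k : ℝ) * Delta p.1 (wins a (1 - b) p.2) ^ (k - 1) * dDelta a b p.1 p.2 :=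
  (continuous_const.mul ((continuous_Delta_wins ha hab hb).pow _)).mul (continuous_dDelta ha hab hb)

lemma continuous_cyDgam (ha : 0 ≤ a) (hab : a < 1 - b) (hb : 0 < b) (k : ℕ) :
    Continuous fun γ => cyDgam a b γ k :=
  intervalIntegral.continuous_parametric_intervalIntegral_of_continuous'
    (f := fun γ s => (k : ℝ) * Delta γ (wins a (1 - b) s) ^ (k - 1) * dDelta a b γ s)
    (continuous_cyDgam_integrand ha hab hb k) 0 1

lemma hasDerivAt_cy_gam (ha : 0 ≤ a) (hab : a < 1 - b) (hb : 0 < b) (γ : ℝ) (k : ℕ) :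
    HasDerivAt (fun γ => cy a b γ k) (cyDgam a b γ k) γ := by
  simp only [cy_eq_integral ha hab hb]
  refine hasDerivAt_integral_of_continuous
    (F := fun γ s => Delta γ (wins a (1 - b) s) ^ k)
    (F' := fun γ s => (k : ℝ) * Delta γ (wins a (1 - b) s) ^ (k - 1) * dDelta a b γ s)
    ((continuous_Delta_wins ha hab hb).pow k) (continuous_cyDgam_integrand ha hab hb k)
    (fun γ s => ?_) γ
  have h := wins_mem_unit ha hab hb s
  exact (hasDerivAt_Delta_left h.1 h.2).fun_pow k

lemma cyDgam_eq_brace (ha : 0 ≤ a) (hab : a < 1 - b) (hb : 0 < b) (γ : ℝ) (k : ℕ) :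
    cyDgam a b γ k = k * phi γ * brace a b γ k := by
  have hc : Continuous fun s => (1 - wins a (1 - b) s) * Delta γ (wins a (1 - b) s) ^ (k - 1)
      / phi (Delta γ (wins a (1 - b) s)) := by
    have h1 := continuous_Delta_wins_right ha hab hb γ
    exact ((continuous_const.sub (continuous_wins a (1 - b))).mul (h1.pow _)).div
      (continuous_phi.comp h1) fun p => (phi_pos _).ne'
  have hB : brace a b γ k = ∫ s in (0 : ℝ)..1, (1 - wins a (1 - b) s) *
      Delta γ (wins a (1 - b) s) ^ (k - 1) / phi (Delta γ (wins a (1 - b) s)) := by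
    rw [integral_comp_wins (f := fun s => (1 - s) * Delta γ s ^ (k - 1) / phi (Delta γ s)) ha
      hab.le (by linarith) hc, brace]
    ring
  rw [hB, ← intervalIntegral.integral_const_mul, cyDgam]
  refine intervalIntegral.integral_congr fun s _ => ?_
  simp only [dDelta]
  ring

lemma hasDerivAt_cy_theta (ha : 0 ≤ a) (hab : a < 1 - b) (hb : 0 < b) (t θ σ : ℝ) (k : ℕ) :
    HasDerivAt (fun x => cy a b (gam t x σ) k) (cyDtheta t a b θ σ k) θ := by
  have hg : HasDerivAt (fun x => gam t x σ) (-1 / σ) θ :=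
    ((hasDerivAt_id θ).const_sub t).div_const σ
  have := (hasDerivAt_cy_gam ha hab hb (gam t θ σ) k).comp θ hg
  convert! this using 1
  rw [cyDgam_eq_brace ha hab hb, cyDtheta]
  ring

lemma hasDerivAt_cy_sigma (ha : 0 ≤ a) (hab : a < 1 - b) (hb : 0 < b) (t θ : ℝ) {σ : ℝ}
    (hσ : σ ≠ 0) (k : ℕ) :
    HasDerivAt (fun x => cy a b (gam t θ x) k) (cyDsigma t a b θ σ k) σ := by
  have hg : HasDerivAt (fun x => gam t θ x) (-((t - θ) / σ ^ 2)) σ := by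
    have := ((hasDerivAt_inv hσ).const_mul (t - θ))
    convert! this using 1
    ring
  have := (hasDerivAt_cy_gam ha hab hb (gam t θ σ) k).comp σ hg
  convert! this using 1
  rw [cyDgam_eq_brace ha hab hb, cyDsigma]
  ring

lemma intervalIntegrable_Delta_pow {x y : ℝ} (γ : ℝ) (k : ℕ) (hx0 : 0 ≤ x) (hxy : x ≤ y)
    (hy1 : y < 1) : IntervalIntegrable (fun s => Delta γ s ^ k) volume x y := by
  refine ContinuousOn.intervalIntegrable fun s hs => ?_
  rw [Set.uIcc_of_le hxy] at hs
  exact ((hasDerivAt_Delta_right (hx0.trans hs.1) (hs.2.trans_lt hy1)).continuousAt.pow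
    k).continuousWithinAt

lemma stronglyMeasurableAtFilter_Delta_pow {x : ℝ} (γ : ℝ) (k : ℕ) (hx0 : 0 ≤ x) (hx1 : x < 1) :
    StronglyMeasurableAtFilter (fun s => Delta γ s ^ k) (𝓝 x) := by
  set U : Set ℝ := {s | 0 < s + (1 - s) * Phi γ ∧ s + (1 - s) * Phi γ < 1}
  have hlev : Continuous fun s : ℝ => s + (1 - s) * Phi γ := by fun_prop
  have hU : IsOpen U := (isOpen_lt continuous_const hlev).inter (isOpen_lt hlev continuous_const)
  have hc : ContinuousOn (fun s => Delta γ s ^ k) U := by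
    intro s hs
    have h1 : ContinuousAt (fun s : ℝ => s + (1 - s) * Phi γ) s := by fun_prop
    have h2 : ContinuousAt (fun s => Delta γ s) s :=
      ContinuousAt.comp (g := PhiInv) (hasDerivAt_PhiInv hs.1 hs.2).continuousAt h1
    exact (h2.pow k).continuousWithinAt
  exact hc.stronglyMeasurableAtFilter hU x (level_mem hx0 hx1 γ)

lemma hasDerivAt_cy_a (ha : 0 ≤ a) (hab : a < 1 - b) (hb : 0 < b) (γ : ℝ) (k : ℕ) :
    HasDerivAt (fun x => cy x b γ k) (cyDa a γ k) a := by
  have h1 : a < 1 := by linarith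
  have hD := (hasDerivAt_Delta_right (γ := γ) ha h1).fun_pow k
  have hI := intervalIntegral.integral_hasDerivAt_left
    (intervalIntegrable_Delta_pow γ k ha hab.le (by linarith))
    (stronglyMeasurableAtFilter_Delta_pow γ k ha h1) hD.continuousAt
  have := ((((hasDerivAt_id a).mul hD).add hI).add_const (b * Delta γ (1 - b) ^ k))
  convert! this using 1
  simp only [cyDa, id]
  ring

lemma hasDerivAt_cy_b (ha : 0 ≤ a) (hab : a < 1 - b) (hb : 0 < b) (γ : ℝ) (k : ℕ) :
    HasDerivAt (fun x => cy a x γ k) (cyDb b γ k) b := by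
  have h0 : 0 ≤ 1 - b := by linarith
  have h1 : 1 - b < 1 := by linarith
  have hs : HasDerivAt (fun x : ℝ => 1 - x) (-1) b := (hasDerivAt_id b).const_sub 1
  have hD := (hasDerivAt_Delta_right (γ := γ) h0 h1).fun_pow k
  have hI := intervalIntegral.integral_hasDerivAt_right
    (intervalIntegrable_Delta_pow γ k ha hab.le h1)
    (stronglyMeasurableAtFilter_Delta_pow γ k h0 h1) hD.continuousAt
  have := ((hI.comp b hs).const_add (a * Delta γ a ^ k)).add ((hasDerivAt_id b).mul (hD.comp b hs))
  convert! this using 1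
  simp only [cyDb, id, Function.comp]
  ring

end Constants

/-! ### Mills' ratio -/

section Mills

/-- Mills' ratio `(1 - Φ) / φ`, the reciprocal of the hazard rate of the standard normal law. -/
noncomputable def mills (x : ℝ) : ℝ := (1 - Phi x) / phi x

lemma mills_pos (x : ℝ) : 0 < mills x := div_pos (one_sub_Phi_pos x) (phi_pos x)

lemma hasDerivAt_mills (x : ℝ) : HasDerivAt mills (x * mills x - 1) x := by
  have h := ((hasDerivAt_Phi x).const_sub 1).div (hasDerivAt_phi x) (phi_pos x).ne'
  convert! h using 1
  have := (phi_pos x).ne'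
  unfold mills
  field_simp
  ring

lemma continuous_mills : Continuous mills :=
  continuous_iff_continuousAt.2 fun x => (hasDerivAt_mills x).continuousAt

lemma pos_of_strictAntiOn_of_tendsto {f : ℝ → ℝ} {c x : ℝ} (hf : StrictAntiOn f (Set.Ioi c))
    (hlim : Tendsto f atTop (𝓝 0)) (hx : c < x) : 0 < f x := by
  have hx1 : x + 1 ∈ Set.Ioi c := by simp only [Set.mem_Ioi]; linarith
  have h1 : f (x + 1) < f x := hf hx hx1 (by linarith)
  have h2 : 0 ≤ f (x + 1) := by
    refine le_of_tendsto hlim ?_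
    filter_upwards [eventually_ge_atTop (x + 1)] with y hy
    exact hf.antitoneOn hx1 (hx1.trans_le hy) hy
  linarith

lemma tendsto_one_sub_Phi : Tendsto (fun x => 1 - Phi x) atTop (𝓝 0) := by
  simpa using tendsto_Phi_atTop.const_sub 1

lemma phi_le (x : ℝ) : phi x ≤ phi 0 := by
  rw [phi_eq, phi_eq]
  refine mul_le_mul_of_nonneg_left (Real.exp_le_exp.2 ?_) (by positivity)
  nlinarith [sq_nonneg x]

lemma tendsto_phi_zero_div : Tendsto (fun x : ℝ => phi 0 / x) atTop (𝓝 0) :=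
  tendsto_const_nhds.div_atTop tendsto_id

/-- The upper bound `1 / x` for Mills' ratio. -/
lemma mul_mills_lt_one (x : ℝ) : x * mills x < 1 := by
  rcases le_or_gt x 0 with hx | hx
  · have := mul_nonpos_of_nonpos_of_nonneg hx (mills_pos x).le
    linarith
  have hd : ∀ y : ℝ, 0 < y → HasDerivAt (fun y => phi y / y - (1 - Phi y)) (-(phi y / y ^ 2)) y := by
    intro y hy
    have h := ((hasDerivAt_phi y).div (hasDerivAt_id y) hy.ne').sub
      ((hasDerivAt_Phi y).const_sub 1)
    convert! h using 1
    simp only [id]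
    field_simp
    ring
  have hanti : StrictAntiOn (fun y => phi y / y - (1 - Phi y)) (Set.Ioi 0) := by
    refine strictAntiOn_of_deriv_neg (convex_Ioi 0)
      (fun y hy => (hd y hy).continuousAt.continuousWithinAt) fun y hy => ?_
    rw [interior_Ioi] at hy
    rw [(hd y hy).deriv]
    have := phi_pos y
    have : (0 : ℝ) < y := hy
    have : 0 < phi y / y ^ 2 := by positivity
    linarith
  have hlim : Tendsto (fun y => phi y / y - (1 - Phi y)) atTop (𝓝 0) := by
    have h1 : Tendsto (fun y => phi y / y) atTop (𝓝 0) := by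
      refine tendsto_of_tendsto_of_tendsto_of_le_of_le' tendsto_const_nhds tendsto_phi_zero_div
        ?_ ?_
      · filter_upwards [eventually_gt_atTop 0] with y hy
        exact div_nonneg (phi_pos y).le hy.le
      · filter_upwards [eventually_gt_atTop 0] with y hy
        exact div_le_div_of_nonneg_right (phi_le y) hy.le
    simpa using h1.sub tendsto_one_sub_Phi
  have h := pos_of_strictAntiOn_of_tendsto hanti hlim hx
  rw [sub_pos, lt_div_iff₀ hx] at h
  rw [mills, mul_div_assoc', div_lt_one (phi_pos x)]
  linarith

/-- The lower bound `x / (1 + x²)` for Mills' ratio; it says that the second derivative of the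
ratio is positive. -/
lemma lt_mul_mills (x : ℝ) : x < (1 + x ^ 2) * mills x := by
  have hd : ∀ y : ℝ, HasDerivAt (fun y => (1 - Phi y) - y * phi y / (1 + y ^ 2))
      (-(2 * phi y / (1 + y ^ 2) ^ 2)) y := by
    intro y
    have hy : 1 + y ^ 2 ≠ 0 := by positivity
    have h := ((hasDerivAt_Phi y).const_sub 1).sub
      (((hasDerivAt_id y).mul (hasDerivAt_phi y)).div ((hasDerivAt_pow 2 y).const_add 1) hy)
    convert! h using 1
    simp only [id, Pi.mul_apply]
    field_simp
    simp
    ring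
  have hanti : StrictAnti fun y => (1 - Phi y) - y * phi y / (1 + y ^ 2) := by
    refine strictAnti_of_deriv_neg fun y => ?_
    rw [(hd y).deriv]
    have := phi_pos y
    have : 0 < 2 * phi y / (1 + y ^ 2) ^ 2 := by positivity
    linarith
  have hlim : Tendsto (fun y => (1 - Phi y) - y * phi y / (1 + y ^ 2)) atTop (𝓝 0) := by
    have h1 : Tendsto (fun y => y * phi y / (1 + y ^ 2)) atTop (𝓝 0) := by
      refine tendsto_of_tendsto_of_tendsto_of_le_of_le' tendsto_const_nhds tendsto_phi_zero_div
        ?_ ?_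
      · filter_upwards [eventually_gt_atTop 0] with y hy
        have := phi_pos y
        positivity
      · filter_upwards [eventually_gt_atTop 0] with y hy
        rw [div_le_div_iff₀ (by positivity) hy]
        have := phi_le y
        nlinarith [phi_pos y, phi_pos 0, mul_le_mul_of_nonneg_left this (sq_nonneg y)]
    simpa using tendsto_one_sub_Phi.sub h1
  have h := pos_of_strictAntiOn_of_tendsto (c := x - 1) (hanti.strictAntiOn _) hlim
    (by linarith : x - 1 < x)
  have hx : 0 < 1 + x ^ 2 := by positivity
  rw [sub_pos, div_lt_iff₀ hx] at h
  rw [mills, mul_div_assoc', lt_div_iff₀ (phi_pos x)]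
  linarith

lemma strictAnti_mills : StrictAnti mills :=
  strictAnti_of_deriv_neg fun x => by
    rw [(hasDerivAt_mills x).deriv]
    linarith [mul_mills_lt_one x]

lemma strictConvexOn_mills : StrictConvexOn ℝ Set.univ mills := by
  have hderiv : deriv mills = fun x => x * mills x - 1 :=
    funext fun x => (hasDerivAt_mills x).deriv
  refine StrictMono.strictConvexOn_univ_of_deriv continuous_mills ?_
  rw [hderiv]
  have hd : ∀ x, HasDerivAt (fun x => x * mills x - 1) ((1 + x ^ 2) * mills x - x) x := by
    intro x
    have h := ((hasDerivAt_id x).mul (hasDerivAt_mills x)).sub_const 1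
    convert! h using 1
    simp only [id]
    ring
  exact strictMono_of_hasDerivAt_pos hd fun x => sub_pos.2 (lt_mul_mills x)

/-- The chords of Mills' ratio from `γ` have increasing slopes. -/
lemma mills_chord {γ x y : ℝ} (hx : γ < x) (hxy : x < y) :
    (mills γ - mills y) * (x - γ) < (mills γ - mills x) * (y - γ) := by
  have h := strictConvexOn_mills.secant_strict_mono (a := γ) (Set.mem_univ _) (Set.mem_univ x)
    (Set.mem_univ y) hx.ne' (hx.trans hxy).ne' hxy
  rw [div_lt_div_iff₀ (by linarith) (by linarith)] at h
  linarith

end Mills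

/-! ### Monotonicity of the coefficient of variation -/

section Monotone

variable {a b : ℝ}

lemma dDelta_eq_mills (ha : 0 ≤ a) (hab : a < 1 - b) (hb : 0 < b) (γ s : ℝ) :
    dDelta a b γ s = mills (Delta γ (wins a (1 - b) s)) / mills γ := by
  have h := wins_mem_unit ha hab hb s
  have h1 := (one_sub_Phi_pos γ).ne'
  have h2 := (phi_pos γ).ne'
  have h3 := (phi_pos (Delta γ (wins a (1 - b) s))).ne'
  rw [dDelta, mills, mills, Phi_Delta (level_mem h.1 h.2 γ)]
  field_simp
  ring

/-- The inequality `E [u] E [u h] < E [u²] E [h]` for `u = Δ - γ` and the decrease `h` of Mills'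
ratio from `γ` to `Δ`. It holds because `h / u` is a strictly decreasing function of `u`
(`mills_chord`): with `u₀ = E [u²] / E [u]` and `κ` the value of `h / u` at `u = u₀`, it says that
the product `(h - κ u) (u₀ - u)`, which is nonnegative and not identically zero, has a positive
mean. -/
lemma integral_mills_lt (ha : 0 ≤ a) (hab : a < 1 - b) (hb : 0 < b) (γ : ℝ) :
    (∫ s in (0 : ℝ)..1, (Delta γ (wins a (1 - b) s) - γ)) *
      (∫ s in (0 : ℝ)..1, (Delta γ (wins a (1 - b) s) - γ) *
        (mills γ - mills (Delta γ (wins a (1 - b) s)))) <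
    (∫ s in (0 : ℝ)..1, (Delta γ (wins a (1 - b) s) - γ) ^ 2) *
      (∫ s in (0 : ℝ)..1, (mills γ - mills (Delta γ (wins a (1 - b) s)))) := by
  set D : ℝ → ℝ := fun s => Delta γ (wins a (1 - b) s) with hD
  have hDc : Continuous D := continuous_Delta_wins_right ha hab hb γ
  have hge : ∀ s, γ ≤ D s := fun s =>
    le_Delta (wins_mem_unit ha hab hb s).1 (wins_mem_unit ha hab hb s).2
  -- two points of the unit interval at which `u` takes different positive values
  set s₁ := (a + (1 - b)) / 2 with hs₁
  have w1 : wins a (1 - b) s₁ = s₁ := by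
    rw [wins, min_eq_right (by linarith), max_eq_right (by linarith)]
  have w2 : wins a (1 - b) 1 = 1 - b := by
    rw [wins, min_eq_left (by linarith), max_eq_right (by linarith)]
  have h1 : γ < D s₁ := by
    have := Delta_lt_Delta (γ := γ) le_rfl (by linarith : 0 < s₁) (by linarith)
    rw [Delta_zero] at this
    simp only [hD]
    rwa [w1]
  have h2 : D s₁ < D 1 := by
    simp only [hD]
    rw [w1, w2]
    exact Delta_lt_Delta (by linarith) (by linarith) (by linarith)
  have hu1 : 0 < ∫ s in (0 : ℝ)..1, (D s - γ) :=
    intervalIntegral.integral_pos one_pos (by fun_prop) (fun s _ => sub_nonneg.2 (hge s))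
      ⟨1, by simp, by linarith⟩
  have hu2 : 0 < ∫ s in (0 : ℝ)..1, (D s - γ) ^ 2 :=
    intervalIntegral.integral_pos one_pos (by fun_prop) (fun s _ => sq_nonneg _)
      ⟨1, by simp, pow_pos (by linarith) 2⟩
  set m₁ := ∫ s in (0 : ℝ)..1, (D s - γ)
  set m₂ := ∫ s in (0 : ℝ)..1, (D s - γ) ^ 2
  set u₀ := m₂ / m₁ with hu₀
  have hu₀0 : 0 < u₀ := div_pos hu2 hu1
  set κ := (mills γ - mills (γ + u₀)) / u₀ with hκ
  have hκu : κ * u₀ = mills γ - mills (γ + u₀) := by rw [hκ]; field_simp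
  have hmc : Continuous fun s => mills (D s) := continuous_mills.comp hDc
  -- the integrand compares `h / u` at `u` and at `u₀`
  have hpos : ∀ s, γ < D s → D s ≠ γ + u₀ →
      0 < (mills γ - mills (D s) - κ * (D s - γ)) * (u₀ - (D s - γ)) := by
    intro s hs hne
    rcases lt_or_gt_of_ne hne with hlt | hgt
    · have h := mills_chord hs hlt
      refine mul_pos ?_ (by linarith)
      rw [add_sub_cancel_left, ← hκu] at h
      have : κ * (D s - γ) * u₀ < (mills γ - mills (D s)) * u₀ := by linarith
      linarith [lt_of_mul_lt_mul_right this hu₀0.le]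
    · have h := mills_chord (by linarith : γ < γ + u₀) hgt
      refine mul_pos_of_neg_of_neg ?_ (by linarith)
      rw [add_sub_cancel_left, ← hκu] at h
      have : (mills γ - mills (D s)) * u₀ < κ * (D s - γ) * u₀ := by linarith
      linarith [lt_of_mul_lt_mul_right this hu₀0.le]
  have hint : 0 < ∫ s in (0 : ℝ)..1,
      (mills γ - mills (D s) - κ * (D s - γ)) * (u₀ - (D s - γ)) := by
    refine intervalIntegral.integral_pos one_pos (by fun_prop) (fun s _ => ?_) ?_
    · rcases (hge s).eq_or_lt with h | h
      · rw [← h]; simp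
      · by_cases hne : D s = γ + u₀
        · rw [hne]; simp
        · exact (hpos s h hne).le
    · by_cases hne : D s₁ = γ + u₀
      · exact ⟨1, by simp, hpos 1 (h1.trans h2) (by linarith)⟩
      · exact ⟨s₁, ⟨by linarith, by linarith⟩, hpos s₁ h1 hne⟩
  have hexp : ∫ s in (0 : ℝ)..1, (mills γ - mills (D s) - κ * (D s - γ)) * (u₀ - (D s - γ)) =
      u₀ * (∫ s in (0 : ℝ)..1, (mills γ - mills (D s)))
        - (∫ s in (0 : ℝ)..1, (D s - γ) * (mills γ - mills (D s)))
        - κ * u₀ * m₁ + κ * m₂ := by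
    have e : ∀ s, (mills γ - mills (D s) - κ * (D s - γ)) * (u₀ - (D s - γ)) =
        u₀ * (mills γ - mills (D s)) - (D s - γ) * (mills γ - mills (D s))
          - κ * u₀ * (D s - γ) + κ * (D s - γ) ^ 2 := fun s => by ring
    simp only [e]
    have i1 : Continuous fun s => u₀ * (mills γ - mills (D s)) := by fun_prop
    have i2 : Continuous fun s => (D s - γ) * (mills γ - mills (D s)) := by fun_prop
    have i3 : Continuous fun s => κ * u₀ * (D s - γ) := by fun_prop
    have i4 : Continuous fun s => κ * (D s - γ) ^ 2 := by fun_prop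
    have i12 : Continuous fun s =>
        u₀ * (mills γ - mills (D s)) - (D s - γ) * (mills γ - mills (D s)) := i1.sub i2
    have i123 : Continuous fun s => u₀ * (mills γ - mills (D s))
        - (D s - γ) * (mills γ - mills (D s)) - κ * u₀ * (D s - γ) := i12.sub i3
    rw [intervalIntegral.integral_add (i123.intervalIntegrable _ _) (i4.intervalIntegrable _ _),
      intervalIntegral.integral_sub (i12.intervalIntegrable _ _) (i3.intervalIntegrable _ _),
      intervalIntegral.integral_sub (i1.intervalIntegrable _ _) (i2.intervalIntegrable _ _),
      intervalIntegral.integral_const_mul, intervalIntegral.integral_const_mul,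
      intervalIntegral.integral_const_mul]
  rw [hexp] at hint
  have hm : κ * u₀ * m₁ = κ * m₂ := by rw [hu₀]; field_simp
  have h3 : (∫ s in (0 : ℝ)..1, (D s - γ) * (mills γ - mills (D s))) <
      u₀ * (∫ s in (0 : ℝ)..1, (mills γ - mills (D s))) := by linarith
  calc m₁ * (∫ s in (0 : ℝ)..1, (D s - γ) * (mills γ - mills (D s)))
      < m₁ * (u₀ * (∫ s in (0 : ℝ)..1, (mills γ - mills (D s)))) :=
        mul_lt_mul_of_pos_left h3 hu1
    _ = m₂ * (∫ s in (0 : ℝ)..1, (mills γ - mills (D s))) := by rw [hu₀]; field_simp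

/-- The mean excess `c_{y,1} - γ` of the winsorized truncated normal law over the truncation
point. -/
noncomputable def excess (a b γ : ℝ) : ℝ := cy a b γ 1 - γ

/-- The variance `c_{y,2} - c_{y,1}²` of the winsorized truncated normal law. -/
noncomputable def spread (a b γ : ℝ) : ℝ := cy a b γ 2 - cy a b γ 1 ^ 2

/-- The derivative of `spread` with respect to `γ`. -/
noncomputable def spreadD (a b γ : ℝ) : ℝ :=
  cyDgam a b γ 2 - 2 * cy a b γ 1 * cyDgam a b γ 1

lemma excess_eq_integral (ha : 0 ≤ a) (hab : a < 1 - b) (hb : 0 < b) (γ : ℝ) :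
    excess a b γ = ∫ s in (0 : ℝ)..1, (Delta γ (wins a (1 - b) s) - γ) := by
  rw [excess, cy_eq_integral ha hab hb, intervalIntegral.integral_sub
    ((continuous_Delta_wins_right ha hab hb γ).intervalIntegrable _ _)
    intervalIntegrable_const]
  simp

lemma integral_Delta_sub_sq (ha : 0 ≤ a) (hab : a < 1 - b) (hb : 0 < b) (γ x : ℝ) :
    ∫ s in (0 : ℝ)..1, (Delta γ (wins a (1 - b) s) - x) ^ 2 =
      cy a b γ 2 - 2 * x * cy a b γ 1 + x ^ 2 := by
  have hDc := continuous_Delta_wins_right ha hab hb γ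
  have e : ∀ s, (Delta γ (wins a (1 - b) s) - x) ^ 2 = Delta γ (wins a (1 - b) s) ^ 2
      - 2 * x * Delta γ (wins a (1 - b) s) ^ 1 + x ^ 2 := fun s => by ring
  simp only [e]
  have i1 : Continuous fun s => Delta γ (wins a (1 - b) s) ^ 2 := hDc.pow 2
  have i2 : Continuous fun s => 2 * x * Delta γ (wins a (1 - b) s) ^ 1 :=
    continuous_const.mul (hDc.pow 1)
  have i12 : Continuous fun s => Delta γ (wins a (1 - b) s) ^ 2
      - 2 * x * Delta γ (wins a (1 - b) s) ^ 1 := i1.sub i2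
  rw [intervalIntegral.integral_add (i12.intervalIntegrable _ _) intervalIntegrable_const,
    intervalIntegral.integral_sub (i1.intervalIntegrable _ _) (i2.intervalIntegrable _ _),
    intervalIntegral.integral_const_mul, ← cy_eq_integral ha hab hb, ← cy_eq_integral ha hab hb]
  simp

lemma excess_pos (ha : 0 ≤ a) (hab : a < 1 - b) (hb : 0 < b) (γ : ℝ) : 0 < excess a b γ := by
  have hDc := continuous_Delta_wins_right ha hab hb γ
  rw [excess_eq_integral ha hab hb]
  refine intervalIntegral.integral_pos one_pos (hDc.sub continuous_const).continuousOn
    (fun s _ => sub_nonneg.2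
      (le_Delta (wins_mem_unit ha hab hb s).1 (wins_mem_unit ha hab hb s).2)) ⟨1, by simp, ?_⟩
  rw [wins, min_eq_left (by linarith), max_eq_right (by linarith), sub_pos]
  simpa [Delta_zero] using
    Delta_lt_Delta (γ := γ) le_rfl (by linarith : 0 < 1 - b) (by linarith)

lemma spread_pos (ha : 0 ≤ a) (hab : a < 1 - b) (hb : 0 < b) (γ : ℝ) : 0 < spread a b γ := by
  have hDc := continuous_Delta_wins_right ha hab hb γ
  set c₁ := cy a b γ 1 with hc₁
  have h : spread a b γ = ∫ s in (0 : ℝ)..1, (Delta γ (wins a (1 - b) s) - c₁) ^ 2 := by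
    rw [integral_Delta_sub_sq ha hab hb, spread, ← hc₁]
    ring
  rw [h]
  have w1 : wins a (1 - b) 0 = a := by
    rw [wins, min_eq_right (by linarith), max_eq_left ha]
  have w2 : wins a (1 - b) 1 = 1 - b := by
    rw [wins, min_eq_left (by linarith), max_eq_right (by linarith)]
  have hlt : Delta γ a < Delta γ (1 - b) := Delta_lt_Delta ha hab (by linarith)
  refine intervalIntegral.integral_pos one_pos ((hDc.sub continuous_const).pow 2).continuousOn
    (fun s _ => sq_nonneg _) ?_
  by_cases hne : Delta γ a = c₁
  · refine ⟨1, by simp, ?_⟩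
    rw [w2]
    exact pow_pos (by linarith) 2
  · refine ⟨0, by simp, ?_⟩
    rw [w1]
    exact sq_pos_of_ne_zero (sub_ne_zero.2 hne)

end Monotone

section Ratio

variable {a b : ℝ}

/-- The factor `1 - ∂c_{y,1}/∂γ`, up to a positive constant the mean decrease of Mills' ratio. -/
lemma integral_mills_sub (ha : 0 ≤ a) (hab : a < 1 - b) (hb : 0 < b) (γ : ℝ) :
    ∫ s in (0 : ℝ)..1, (mills γ - mills (Delta γ (wins a (1 - b) s))) =
      mills γ * (1 - cyDgam a b γ 1) := by
  have hm := (mills_pos γ).ne'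
  have e : ∀ s, mills γ - mills (Delta γ (wins a (1 - b) s)) = mills γ * (1 - dDelta a b γ s) := by
    intro s
    rw [dDelta_eq_mills ha hab hb]
    field_simp
  simp only [e]
  rw [intervalIntegral.integral_const_mul, intervalIntegral.integral_sub intervalIntegrable_const
    ((continuous_dDelta_right ha hab hb γ).intervalIntegrable _ _)]
  simp [cyDgam]

lemma integral_mul_mills_sub (ha : 0 ≤ a) (hab : a < 1 - b) (hb : 0 < b) (γ : ℝ) :
    ∫ s in (0 : ℝ)..1, (Delta γ (wins a (1 - b) s) - γ) *
        (mills γ - mills (Delta γ (wins a (1 - b) s))) =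
      mills γ * (excess a b γ - cyDgam a b γ 2 / 2 + γ * cyDgam a b γ 1) := by
  have hm := (mills_pos γ).ne'
  have hDc := continuous_Delta_wins_right ha hab hb γ
  have hdc := continuous_dDelta_right ha hab hb γ
  have e : ∀ s, (Delta γ (wins a (1 - b) s) - γ) *
      (mills γ - mills (Delta γ (wins a (1 - b) s))) =
      mills γ * ((Delta γ (wins a (1 - b) s) - γ)
        - (1 / 2) * (((2 : ℕ) : ℝ) * Delta γ (wins a (1 - b) s) ^ (2 - 1) * dDelta a b γ s)
        + γ * (((1 : ℕ) : ℝ) * Delta γ (wins a (1 - b) s) ^ (1 - 1) * dDelta a b γ s)) := by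
    intro s
    rw [dDelta_eq_mills ha hab hb]
    field_simp
    push_cast
    simp
    ring
  simp only [e]
  have i1 : Continuous fun s => Delta γ (wins a (1 - b) s) - γ := hDc.sub continuous_const
  have i2 : Continuous fun s =>
      (1 / 2) * (((2 : ℕ) : ℝ) * Delta γ (wins a (1 - b) s) ^ (2 - 1) * dDelta a b γ s) :=
    continuous_const.mul ((continuous_const.mul (hDc.pow _)).mul hdc)
  have i3 : Continuous fun s =>
      γ * (((1 : ℕ) : ℝ) * Delta γ (wins a (1 - b) s) ^ (1 - 1) * dDelta a b γ s) :=
    continuous_const.mul ((continuous_const.mul (hDc.pow _)).mul hdc)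
  have i12 : Continuous fun s => Delta γ (wins a (1 - b) s) - γ
      - (1 / 2) * (((2 : ℕ) : ℝ) * Delta γ (wins a (1 - b) s) ^ (2 - 1) * dDelta a b γ s) :=
    i1.sub i2
  rw [intervalIntegral.integral_const_mul,
    intervalIntegral.integral_add (i12.intervalIntegrable _ _) (i3.intervalIntegrable _ _),
    intervalIntegral.integral_sub (i1.intervalIntegrable _ _) (i2.intervalIntegrable _ _),
    intervalIntegral.integral_const_mul, intervalIntegral.integral_const_mul,
    excess_eq_integral ha hab hb, cyDgam, cyDgam]
  ring

/-- The mean excess decreases in the truncation point. -/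
lemma cyDgam_one_lt_one (ha : 0 ≤ a) (hab : a < 1 - b) (hb : 0 < b) (γ : ℝ) :
    cyDgam a b γ 1 < 1 := by
  have hmc : Continuous fun s => mills γ - mills (Delta γ (wins a (1 - b) s)) :=
    continuous_const.sub (continuous_mills.comp (continuous_Delta_wins_right ha hab hb γ))
  have h : 0 < ∫ s in (0 : ℝ)..1, (mills γ - mills (Delta γ (wins a (1 - b) s))) := by
    refine intervalIntegral.integral_pos one_pos hmc.continuousOn (fun s _ => sub_nonneg.2
      (strictAnti_mills.antitone
        (le_Delta (wins_mem_unit ha hab hb s).1 (wins_mem_unit ha hab hb s).2)))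
      ⟨1, by simp, sub_pos.2 (strictAnti_mills ?_)⟩
    rw [wins, min_eq_left (by linarith), max_eq_right (by linarith)]
    simpa [Delta_zero] using
      Delta_lt_Delta (γ := γ) le_rfl (by linarith : 0 < 1 - b) (by linarith)
  rw [integral_mills_sub ha hab hb] at h
  linarith [pos_of_mul_pos_right h (mills_pos γ).le]

/-- The numerator of the derivative of `spread / excess²`; up to a positive factor, also the
determinant of the estimating equations. -/
lemma ratio_numerator_pos (ha : 0 ≤ a) (hab : a < 1 - b) (hb : 0 < b) (γ : ℝ) :
    0 < 2 * (1 - cyDgam a b γ 1) * spread a b γ + spreadD a b γ * excess a b γ := by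
  have h := integral_mills_lt ha hab hb γ
  have h2 : ∫ s in (0 : ℝ)..1, (Delta γ (wins a (1 - b) s) - γ) ^ 2 =
      spread a b γ + excess a b γ ^ 2 := by
    rw [integral_Delta_sub_sq ha hab hb, spread, excess]
    ring
  rw [h2, integral_mills_sub ha hab hb, integral_mul_mills_sub ha hab hb,
    ← excess_eq_integral ha hab hb] at h
  have h3 : mills γ * (excess a b γ * (excess a b γ - cyDgam a b γ 2 / 2 + γ * cyDgam a b γ 1)) <
      mills γ * ((spread a b γ + excess a b γ ^ 2) * (1 - cyDgam a b γ 1)) := by linarith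
  have h4 := lt_of_mul_lt_mul_left h3 (mills_pos γ).le
  have h5 : cy a b γ 1 = excess a b γ + γ := by rw [excess]; ring
  rw [spreadD, h5]
  nlinarith

/-- The squared coefficient of variation of the excess over the truncation point. -/
noncomputable def ratio (a b γ : ℝ) : ℝ := spread a b γ / excess a b γ ^ 2

/-- The derivative of `ratio`. -/
noncomputable def ratioD (a b γ : ℝ) : ℝ :=
  (2 * (1 - cyDgam a b γ 1) * spread a b γ + spreadD a b γ * excess a b γ) / excess a b γ ^ 3

lemma hasDerivAt_excess (ha : 0 ≤ a) (hab : a < 1 - b) (hb : 0 < b) (γ : ℝ) :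
    HasDerivAt (excess a b) (cyDgam a b γ 1 - 1) γ :=
  (hasDerivAt_cy_gam ha hab hb γ 1).sub (hasDerivAt_id γ)

lemma hasDerivAt_spread (ha : 0 ≤ a) (hab : a < 1 - b) (hb : 0 < b) (γ : ℝ) :
    HasDerivAt (spread a b) (spreadD a b γ) γ := by
  have h := (hasDerivAt_cy_gam ha hab hb γ 2).sub ((hasDerivAt_cy_gam ha hab hb γ 1).fun_pow 2)
  convert! h using 1
  rw [spreadD]
  simp

lemma hasDerivAt_ratio (ha : 0 ≤ a) (hab : a < 1 - b) (hb : 0 < b) (γ : ℝ) :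
    HasDerivAt (ratio a b) (ratioD a b γ) γ := by
  have hM := (excess_pos ha hab hb γ).ne'
  have h := (hasDerivAt_spread ha hab hb γ).div ((hasDerivAt_excess ha hab hb γ).fun_pow 2)
    (pow_ne_zero 2 hM)
  convert! h using 1
  rw [ratioD]
  field_simp
  simp
  ring

lemma ratioD_pos (ha : 0 ≤ a) (hab : a < 1 - b) (hb : 0 < b) (γ : ℝ) : 0 < ratioD a b γ :=
  div_pos (ratio_numerator_pos ha hab hb γ) (pow_pos (excess_pos ha hab hb γ) 3)

/-- The coefficient of variation determines the truncation point. -/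
lemma injective_ratio (ha : 0 ≤ a) (hab : a < 1 - b) (hb : 0 < b) :
    Function.Injective (ratio a b) :=
  (strictMono_of_hasDerivAt_pos (hasDerivAt_ratio ha hab hb) (ratioD_pos ha hab hb)).injective

lemma hasStrictDerivAt_ratio (ha : 0 ≤ a) (hab : a < 1 - b) (hb : 0 < b) (γ : ℝ) :
    HasStrictDerivAt (ratio a b) (ratioD a b γ) γ := by
  refine hasStrictDerivAt_of_hasDerivAt_of_continuousAt
    (Eventually.of_forall (hasDerivAt_ratio ha hab hb)) ?_
  have h1 := continuous_cyDgam ha hab hb 1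
  have h2 := continuous_cyDgam ha hab hb 2
  have hc : ∀ k, Continuous fun γ => cy a b γ k := fun k =>
    continuous_iff_continuousAt.2 fun γ => (hasDerivAt_cy_gam ha hab hb γ k).continuousAt
  have hE : Continuous (excess a b) := (hc 1).sub continuous_id
  have hS : Continuous (spread a b) := (hc 2).sub ((hc 1).pow 2)
  have hSD : Continuous (spreadD a b) := h2.sub ((continuous_const.mul (hc 1)).mul h1)
  have : Continuous (ratioD a b) :=
    (((continuous_const.mul (continuous_const.sub h1)).mul hS).add (hSD.mul hE)).div
      (hE.pow 3) fun γ => pow_ne_zero 3 (excess_pos ha hab hb γ).ne'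
  exact this.continuousAt

/-- The inverse of `ratio`; arbitrary outside the range of `ratio`. -/
noncomputable def ratioInv (a b : ℝ) : ℝ → ℝ := Function.invFun (ratio a b)

lemma ratioInv_ratio (ha : 0 ≤ a) (hab : a < 1 - b) (hb : 0 < b) (γ : ℝ) :
    ratioInv a b (ratio a b γ) = γ := Function.leftInverse_invFun (injective_ratio ha hab hb) γ

lemma hasDerivAt_ratioInv (ha : 0 ≤ a) (hab : a < 1 - b) (hb : 0 < b) (γ : ℝ) :
    HasDerivAt (ratioInv a b) (ratioD a b γ)⁻¹ (ratio a b γ) :=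
  ((hasStrictDerivAt_ratio ha hab hb γ).to_local_left_inverse (ratioD_pos ha hab hb γ).ne'
    (Eventually.of_forall (ratioInv_ratio ha hab hb))).hasDerivAt

lemma eventually_ratio_ratioInv (ha : 0 ≤ a) (hab : a < 1 - b) (hb : 0 < b) (γ : ℝ) :
    ∀ᶠ q in 𝓝 (ratio a b γ), ratio a b (ratioInv a b q) = q := by
  have h := (hasStrictDerivAt_ratio ha hab hb γ).map_nhds_eq (ratioD_pos ha hab hb γ).ne'
  rw [← h, eventually_map]
  exact Eventually.of_forall fun x => by rw [ratioInv_ratio ha hab hb]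

end Ratio

/-! ### The solution map of the estimating equations -/

section Solution

variable {a b : ℝ}

/-- The estimating equations in terms of the mean excess and the spread. -/
lemma solves_iff (ha : 0 ≤ a) (hab : a < 1 - b) (hb : 0 < b) (t w₁ w₂ θ σ : ℝ) :
    Solves t a b w₁ w₂ θ σ ↔ 0 < σ ∧ w₁ - t = σ * excess a b (gam t θ σ) ∧
      w₂ - w₁ ^ 2 = σ ^ 2 * spread a b (gam t θ σ) := by
  rw [Solves]
  refine and_congr_right fun hσ => ?_
  have hS := spread_pos ha hab hb (gam t θ σ)
  have hg : σ * gam t θ σ = t - θ := by rw [gam]; field_simp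
  refine and_congr ?_ ?_
  · rw [excess, mul_sub, hg]
    constructor <;> intro h <;> linarith
  · rw [← spread]
    generalize spread a b (gam t θ σ) = S at hS ⊢
    constructor
    · intro h
      have h0 : 0 ≤ (w₂ - w₁ ^ 2) / S := by
        by_contra hcon
        rw [Real.sqrt_eq_zero_of_nonpos (not_le.1 hcon).le] at h
        linarith
      have h2 : σ ^ 2 = (w₂ - w₁ ^ 2) / S := by
        rw [h, Real.sq_sqrt h0]
      rw [h2]
      field_simp
    · intro h
      rw [h, mul_div_assoc, div_self hS.ne', mul_one, Real.sqrt_sq hσ.le]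

/-- The value of `γ` determined by `(w₁, w₂)`. -/
noncomputable def gammaSol (t a b w₁ w₂ : ℝ) : ℝ := ratioInv a b ((w₂ - w₁ ^ 2) / (w₁ - t) ^ 2)

/-- The value of `σ` determined by `(w₁, w₂)`. -/
noncomputable def sigmaSol (t a b w₁ w₂ : ℝ) : ℝ := (w₁ - t) / excess a b (gammaSol t a b w₁ w₂)

/-- The solution `(θ, σ)` of the estimating equations at `(w₁, w₂)`, if there is one. -/
noncomputable def solution (t a b : ℝ) (w : EuclideanSpace ℝ (Fin 2)) :
    EuclideanSpace ℝ (Fin 2) :=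
  !₂[t - sigmaSol t a b (w 0) (w 1) * gammaSol t a b (w 0) (w 1), sigmaSol t a b (w 0) (w 1)]

lemma ratio_of_solves (ha : 0 ≤ a) (hab : a < 1 - b) (hb : 0 < b) {t w₁ w₂ θ σ : ℝ}
    (h : Solves t a b w₁ w₂ θ σ) :
    (w₂ - w₁ ^ 2) / (w₁ - t) ^ 2 = ratio a b (gam t θ σ) := by
  obtain ⟨hσ, h1, h2⟩ := (solves_iff ha hab hb t w₁ w₂ θ σ).1 h
  have := (excess_pos ha hab hb (gam t θ σ)).ne'
  rw [h1, h2, ratio]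
  field_simp

lemma gammaSol_of_solves (ha : 0 ≤ a) (hab : a < 1 - b) (hb : 0 < b) {t w₁ w₂ θ σ : ℝ}
    (h : Solves t a b w₁ w₂ θ σ) : gammaSol t a b w₁ w₂ = gam t θ σ := by
  rw [gammaSol, ratio_of_solves ha hab hb h, ratioInv_ratio ha hab hb]

lemma sigmaSol_of_solves (ha : 0 ≤ a) (hab : a < 1 - b) (hb : 0 < b) {t w₁ w₂ θ σ : ℝ}
    (h : Solves t a b w₁ w₂ θ σ) : sigmaSol t a b w₁ w₂ = σ := by
  rw [sigmaSol, gammaSol_of_solves ha hab hb h]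
  obtain ⟨hσ, h1, h2⟩ := (solves_iff ha hab hb t w₁ w₂ θ σ).1 h
  rw [h1, mul_div_assoc, div_self (excess_pos ha hab hb _).ne', mul_one]

/-- The estimating equations have at most one solution. -/
lemma solution_of_solves (ha : 0 ≤ a) (hab : a < 1 - b) (hb : 0 < b) {t θ σ : ℝ}
    {w : EuclideanSpace ℝ (Fin 2)} (h : Solves t a b (w 0) (w 1) θ σ) :
    solution t a b w = !₂[θ, σ] := by
  rw [solution, sigmaSol_of_solves ha hab hb h, gammaSol_of_solves ha hab hb h]
  have hσ : σ ≠ 0 := h.1.ne'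
  have : t - σ * gam t θ σ = θ := by rw [gam]; field_simp; ring
  rw [this]

lemma solves_solution (ha : 0 ≤ a) (hab : a < 1 - b) (hb : 0 < b) {t : ℝ}
    {w : EuclideanSpace ℝ (Fin 2)} (h1 : t < w 0)
    (h2 : ratio a b (ratioInv a b ((w 1 - w 0 ^ 2) / (w 0 - t) ^ 2)) =
      (w 1 - w 0 ^ 2) / (w 0 - t) ^ 2) :
    Solves t a b (w 0) (w 1) (solution t a b w 0) (solution t a b w 1) := by
  have hM := excess_pos ha hab hb (gammaSol t a b (w 0) (w 1))
  have hw : 0 < w 0 - t := sub_pos.2 h1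
  have hσ : 0 < sigmaSol t a b (w 0) (w 1) := div_pos hw hM
  have hg : gam t (solution t a b w 0) (solution t a b w 1) = gammaSol t a b (w 0) (w 1) := by
    simp only [solution, gam]
    simp
    field_simp
  rw [solves_iff ha hab hb, hg]
  simp only [solution, PiLp.toLp_apply, Matrix.cons_val_one,
    Matrix.cons_val_fin_one]
  rw [← gammaSol, ratio] at h2
  refine ⟨hσ, ?_, ?_⟩
  · rw [sigmaSol]; field_simp
  · rw [sigmaSol, div_pow, div_mul_eq_mul_div, mul_div_assoc, h2]
    field_simp

/-- Near a point at which the equations have a solution they have one too, since `ratio` has a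
nonzero derivative and is therefore locally surjective. -/
lemma eventually_solves_solution (ha : 0 ≤ a) (hab : a < 1 - b) (hb : 0 < b) {t θ σ : ℝ}
    {W : EuclideanSpace ℝ (Fin 2)} (h : Solves t a b (W 0) (W 1) θ σ) :
    ∀ᶠ w in 𝓝 W, Solves t a b (w 0) (w 1) (solution t a b w 0) (solution t a b w 1) := by
  obtain ⟨hσ, h1, h2⟩ := (solves_iff ha hab hb t _ _ θ σ).1 h
  have hW : 0 < W 0 - t := by
    rw [h1]; exact mul_pos hσ (excess_pos ha hab hb _)
  have c0 : ContinuousAt (fun w : EuclideanSpace ℝ (Fin 2) => w 0) W := by fun_prop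
  have hc : ContinuousAt (fun w : EuclideanSpace ℝ (Fin 2) =>
      (w 1 - w 0 ^ 2) / (w 0 - t) ^ 2) W :=
    ContinuousAt.div (by fun_prop) (by fun_prop) (pow_ne_zero 2 hW.ne')
  have hr := eventually_ratio_ratioInv ha hab hb (gam t θ σ)
  rw [← ratio_of_solves ha hab hb h] at hr
  filter_upwards [hc.eventually hr, c0.eventually (lt_mem_nhds (by linarith : t < W 0))] with w h3 h4
  exact solves_solution ha hab hb h4 h3

end Solution

/-! ### The Jacobian matrix of the solution map -/

section Jacobian

variable {a b : ℝ}

lemma cyDtheta_eq (ha : 0 ≤ a) (hab : a < 1 - b) (hb : 0 < b) (t θ σ : ℝ) (k : ℕ) :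
    cyDtheta t a b θ σ k = -(cyDgam a b (gam t θ σ) k / σ) := by
  rw [cyDgam_eq_brace ha hab hb, cyDtheta]
  ring

lemma cyDsigma_eq (ha : 0 ≤ a) (hab : a < 1 - b) (hb : 0 < b) (t θ σ : ℝ) (k : ℕ) :
    cyDsigma t a b θ σ k = -(gam t θ σ * cyDgam a b (gam t θ σ) k / σ) := by
  rw [cyDgam_eq_brace ha hab hb, cyDsigma]
  nth_rewrite 3 [gam]
  ring

/-- The entries of `D_y` in terms of `γ`-derivatives; their common denominator is `σ` times the
numerator `G` of the derivative of `ratio`. -/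
lemma DMat_entries (ha : 0 ≤ a) (hab : a < 1 - b) (hb : 0 < b) {c t T θ σ : ℝ} (hσ : 0 < σ)
    {W p r C M G : ℝ} (hW : popMoment c t T a b θ σ 1 = W)
    (hp : cyDgam a b (gam t θ σ) 1 = p) (hr : spreadD a b (gam t θ σ) = r)
    (hC : spread a b (gam t θ σ) = C) (hM : excess a b (gam t θ σ) = M)
    (hG : 2 * (1 - p) * C + r * M = G) (hV : wVar c t T a b θ σ = σ ^ 2 * C) :
    d21 c t T a b θ σ = (r * σ - 2 * (1 - p) * W) / (σ * G) ∧
    d22 c t T a b θ σ = (1 - p) / (σ * G) ∧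
    d11 c t T a b θ σ = (1 - (M + gam t θ σ * (1 - p)) *
      ((r * σ - 2 * (1 - p) * W) / (σ * G))) / (1 - p) ∧
    d12 c t T a b θ σ = -((M + gam t θ σ * (1 - p)) / (σ * G)) := by
  have hC0 : 0 < C := hC ▸ spread_pos ha hab hb _
  have hp1 : 0 < 1 - p := by
    have := cyDgam_one_lt_one ha hab hb (gam t θ σ)
    linarith
  have hG0 : 0 < G := by
    rw [← hG, ← hp, ← hr, ← hC, ← hM]
    exact ratio_numerator_pos ha hab hb _
  have hc1 : cy a b (gam t θ σ) 1 = M + gam t θ σ := by rw [← hM, excess]; ring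
  have hf11 : f11 t a b θ σ = 1 - p := by
    rw [f11, cyDtheta_eq ha hab hb, hp]
    field_simp
    ring
  have hf12 : f12 t a b θ σ = M + gam t θ σ * (1 - p) := by
    rw [f12, cyDsigma_eq ha hab hb, hp, hc1]
    field_simp
    ring
  have hf21 : f21 t a b θ σ = -(r / σ) := by
    rw [f21, cyDtheta_eq ha hab hb, cyDtheta_eq ha hab hb, ← hr, spreadD]
    field_simp
    ring
  have hf22 : f22 t a b θ σ = -(gam t θ σ * r / σ) := by
    rw [f22, cyDsigma_eq ha hab hb, cyDsigma_eq ha hab hb, ← hr, spreadD]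
    field_simp
    ring
  have hcV : cVar t a b θ σ = C := hC
  have hK : Kconst c t T a b θ σ = 1 / (2 * σ) := by
    have : C / (σ ^ 2 * C) = (1 / σ) ^ 2 := by field_simp
    rw [Kconst, hcV, hV, this, Real.sqrt_sq (by positivity)]
    field_simp
  have hden : denom c t T a b θ σ = C * G / 2 := by
    rw [denom, hf11, hf12, hf21, hf22, hcV, hV, hK, ← hG]
    field_simp
    ring
  have h21 : d21 c t T a b θ σ = (r * σ - 2 * (1 - p) * W) / (σ * G) := by
    rw [d21, hden, hf11, hf21, hcV, hV, hK, hW]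
    field_simp
    ring
  have h22 : d22 c t T a b θ σ = (1 - p) / (σ * G) := by
    rw [d22, hden, hf11, hcV, hK]
    field_simp
  refine ⟨h21, h22, ?_, ?_⟩
  · rw [d11, h21, hf11, hf12]
  · rw [d12, h22, hf11, hf12]
    field_simp

/-- The matrix `D_y` is the derivative of the solution map. -/
lemma hasFDerivAt_solution (ha : 0 ≤ a) (hab : a < 1 - b) (hb : 0 < b) {c t T θ σ : ℝ}
    (hσ : 0 < σ)
    (hV : wVar c t T a b θ σ = σ ^ 2 * spread a b (gam t θ σ))
    (hsol : Solves t a b (popMoment c t T a b θ σ 1) (popMoment c t T a b θ σ 2) θ σ) :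
    HasFDerivAt (solution t a b)
      (Matrix.toEuclideanCLM (n := Fin 2) (𝕜 := ℝ) (DMat c t T a b θ σ))
      !₂[popMoment c t T a b θ σ 1, popMoment c t T a b θ σ 2] := by
  obtain ⟨h21, h22, h11, h12⟩ := DMat_entries ha hab hb hσ rfl rfl rfl rfl rfl rfl hV
  set W₁ := popMoment c t T a b θ σ 1
  set W₂ := popMoment c t T a b θ σ 2
  set W : EuclideanSpace ℝ (Fin 2) := !₂[W₁, W₂] with hW
  set γ := gam t θ σ with hγ
  obtain ⟨-, hs1, hs2⟩ := (solves_iff ha hab hb t _ _ θ σ).1 hsol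
  rw [← hγ] at hs1 hs2
  set e0 : EuclideanSpace ℝ (Fin 2) →L[ℝ] ℝ := EuclideanSpace.proj 0
  set e1 : EuclideanSpace ℝ (Fin 2) →L[ℝ] ℝ := EuclideanSpace.proj 1
  have he0 : HasFDerivAt (fun w : EuclideanSpace ℝ (Fin 2) => w 0) e0 W := e0.hasFDerivAt
  have he1 : HasFDerivAt (fun w : EuclideanSpace ℝ (Fin 2) => w 1) e1 W := e1.hasFDerivAt
  have hM := excess_pos ha hab hb γ
  have hG := ratio_numerator_pos ha hab hb γ
  have hp1 : 0 < 1 - cyDgam a b γ 1 := sub_pos.2 (cyDgam_one_lt_one ha hab hb γ)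
  have hD := ratioD_pos ha hab hb γ
  have hq0 : (W₂ - W₁ ^ 2) / (W₁ - t) ^ 2 = ratio a b γ := ratio_of_solves ha hab hb hsol
  have hWt : W₁ - t ≠ 0 := by rw [hs1]; positivity
  have hinv : HasFDerivAt (fun w : EuclideanSpace ℝ (Fin 2) => ((w 0 - t) ^ 2)⁻¹)
      (-(2 / (W₁ - t) ^ 3) • e0) W := by
    have h1 : HasDerivAt (fun x : ℝ => ((x - t) ^ 2)⁻¹) (-(2 / (W₁ - t) ^ 3)) (W 0) := by
      have := (((hasDerivAt_id (W 0)).sub_const t).fun_pow 2).fun_inv (pow_ne_zero 2 hWt)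
      convert! this using 1
      simp only [hW, id, PiLp.toLp_apply, Matrix.cons_val_zero]
      field_simp
      simp
    exact HasDerivAt.comp_hasFDerivAt (h₂ := fun x : ℝ => ((x - t) ^ 2)⁻¹) W h1 he0
  have hsq : HasFDerivAt (fun w : EuclideanSpace ℝ (Fin 2) => w 0 ^ 2) ((2 * W₁) • e0) W := by
    have h1 : HasDerivAt (fun x : ℝ => x ^ 2) (2 * W₁) (W 0) := by
      simpa [hW] using hasDerivAt_pow 2 (W 0)
    exact HasDerivAt.comp_hasFDerivAt (h₂ := fun x : ℝ => x ^ 2) W h1 he0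
  have hq : HasFDerivAt (fun w : EuclideanSpace ℝ (Fin 2) => (w 1 - w 0 ^ 2) / (w 0 - t) ^ 2)
      ((1 / (W₁ - t) ^ 2) • e1 - (2 * W₁ / (W₁ - t) ^ 2 + 2 * (W₂ - W₁ ^ 2) / (W₁ - t) ^ 3) • e0)
      W := by
    refine ((he1.sub hsq).mul hinv).congr_fderiv ?_
    ext v
    simp [hW]
    field_simp
    ring
  have hgW : gammaSol t a b (W 0) (W 1) = γ := gammaSol_of_solves ha hab hb hsol
  have hsW : sigmaSol t a b (W 0) (W 1) = σ := sigmaSol_of_solves ha hab hb hsol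
  set L := (1 / (W₁ - t) ^ 2) • e1
    - (2 * W₁ / (W₁ - t) ^ 2 + 2 * (W₂ - W₁ ^ 2) / (W₁ - t) ^ 3) • e0 with hL
  have hgam : HasFDerivAt (fun w : EuclideanSpace ℝ (Fin 2) => gammaSol t a b (w 0) (w 1))
      ((ratioD a b γ)⁻¹ • L) W := by
    have h1 := hasDerivAt_ratioInv ha hab hb γ
    rw [← hq0] at h1
    exact HasDerivAt.comp_hasFDerivAt (h₂ := ratioInv a b) W h1 hq
  have hexc : HasFDerivAt (fun w : EuclideanSpace ℝ (Fin 2) =>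
      (excess a b (gammaSol t a b (w 0) (w 1)))⁻¹)
      (((1 - cyDgam a b γ 1) / excess a b γ ^ 2) • (ratioD a b γ)⁻¹ • L) W := by
    have h1 : HasDerivAt (fun x => (excess a b x)⁻¹) ((1 - cyDgam a b γ 1) / excess a b γ ^ 2)
        (gammaSol t a b (W 0) (W 1)) := by
      rw [hgW]
      convert! (hasDerivAt_excess ha hab hb γ).fun_inv hM.ne' using 1
      ring
    exact HasDerivAt.comp_hasFDerivAt (h₂ := fun x => (excess a b x)⁻¹) W h1 hgam
  have hsig : HasFDerivAt (fun w : EuclideanSpace ℝ (Fin 2) => sigmaSol t a b (w 0) (w 1))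
      ((excess a b γ)⁻¹ • e0 + (σ * (1 - cyDgam a b γ 1) / excess a b γ) •
        (ratioD a b γ)⁻¹ • L) W := by
    refine ((he0.sub_const t).mul hexc).congr_fderiv ?_
    ext v
    simp only [hgW, add_apply, smul_apply, smul_eq_mul]
    rw [show W 0 = W₁ from rfl, hs1]
    field_simp
    ring
  have hthe : HasFDerivAt (fun w : EuclideanSpace ℝ (Fin 2) =>
      t - sigmaSol t a b (w 0) (w 1) * gammaSol t a b (w 0) (w 1)) _ W :=
    (hsig.mul hgam).const_sub t
  have hLv : ∀ v, (ratioD a b γ)⁻¹ * L v = excess a b γ /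
      (σ ^ 2 * (2 * (1 - cyDgam a b γ 1) * spread a b γ + spreadD a b γ * excess a b γ)) *
      (v 1 - 2 * (W₁ + σ * spread a b γ / excess a b γ) * v 0) := by
    intro v
    have hv0 : e0 v = v 0 := rfl
    have hv1 : e1 v = v 1 := rfl
    rw [hL, ratioD, hs1, hs2]
    simp only [sub_apply, smul_apply, smul_eq_mul,
      hv0, hv1]
    field_simp
  -- `spread` is expressed by the numerator of `ratioD`, so that both sides become rational
  -- functions of independent quantities
  have hC : spread a b γ = (2 * (1 - cyDgam a b γ 1) * spread a b γ
      + spreadD a b γ * excess a b γ - spreadD a b γ * excess a b γ) /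
        (2 * (1 - cyDgam a b γ 1)) := by
    field_simp
    ring
  rw [← hasFDerivWithinAt_univ, hasFDerivWithinAt_euclidean]
  intro i
  rw [hasFDerivWithinAt_univ]
  fin_cases i
  · refine hthe.congr_fderiv ?_
    ext v
    have hv0 : e0 v = v 0 := rfl
    have hR : ((EuclideanSpace.proj (0 : Fin 2)).comp
        (Matrix.toEuclideanCLM (n := Fin 2) (𝕜 := ℝ) (DMat c t T a b θ σ))) v =
        d11 c t T a b θ σ * v 0 + d12 c t T a b θ σ * v 1 := by
      simp [DMat, Matrix.mulVec, dotProduct, Fin.sum_univ_two]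
    refine Eq.trans ?_ hR.symm
    simp only [hgW, hsW, add_apply, smul_apply, smul_eq_mul, neg_apply, hLv, hv0]
    rw [h11, h12]
    generalize 2 * (1 - cyDgam a b γ 1) * spread a b γ + spreadD a b γ * excess a b γ = G at hG hC ⊢
    rw [hC]
    generalize excess a b γ = M at hM ⊢
    generalize spreadD a b γ = r
    generalize 1 - cyDgam a b γ 1 = P at hp1 ⊢
    field_simp
    ring
  · refine hsig.congr_fderiv ?_
    ext v
    have hv0 : e0 v = v 0 := rfl
    have hR : ((EuclideanSpace.proj (1 : Fin 2)).comp
        (Matrix.toEuclideanCLM (n := Fin 2) (𝕜 := ℝ) (DMat c t T a b θ σ))) v =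
        d21 c t T a b θ σ * v 0 + d22 c t T a b θ σ * v 1 := by
      simp [DMat, Matrix.mulVec, dotProduct, Fin.sum_univ_two]
    refine Eq.trans ?_ hR.symm
    simp only [add_apply, smul_apply,
      smul_eq_mul, hLv, hv0]
    rw [h21, h22]
    generalize 2 * (1 - cyDgam a b γ 1) * spread a b γ + spreadD a b γ * excess a b γ = G at hG hC ⊢
    rw [hC]
    generalize excess a b γ = M at hM ⊢
    generalize spreadD a b γ = r
    generalize 1 - cyDgam a b γ 1 = P at hp1 ⊢
    field_simp
    ring

end Jacobian

/-! ### The law of the payment-per-payment variable -/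

section PaymentLaw

variable {c t T θ σ : ℝ}

instance isProbabilityMeasure_lossLaw (θ σ : ℝ) : IsProbabilityMeasure (lossLaw θ σ) := by
  unfold lossLaw; infer_instance

lemma cdf_lossLaw (θ : ℝ) (hσ : 0 < σ) (x : ℝ) :
    cdf (lossLaw θ σ) x = Phi ((x - θ) / σ) := by
  have h : lossLaw θ σ = ((gaussianReal 0 1).map (σ * ·)).map (θ + ·) := by
    rw [gaussianReal_map_const_mul, gaussianReal_map_const_add, lossLaw]
    congr 1
    · ring
    · ext
      simp [Real.coe_toNNReal _ (sq_nonneg σ)]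
  have hpre : (fun z : ℝ => θ + σ * z) ⁻¹' Set.Iic x = Set.Iic ((x - θ) / σ) := by
    ext z
    simp only [Set.mem_preimage, Set.mem_Iic, le_div_iff₀ hσ]
    constructor <;> intro h <;> linarith
  rw [cdf_eq_real, Phi, cdf_eq_real, measureReal_def, measureReal_def, h,
    Measure.map_map (by fun_prop) (by fun_prop), Measure.map_apply (by fun_prop) measurableSet_Iic]
  exact congrArg _ (congrArg _ hpre)

lemma lossLaw_real_Ioi (hσ : 0 < σ) :
    (lossLaw θ σ).real (Set.Ioi t) = 1 - Phi (gam t θ σ) := by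
  rw [← Set.compl_Iic, probReal_compl_eq_one_sub measurableSet_Iic, ← cdf_eq_real,
    cdf_lossLaw θ hσ, gam]

lemma lossLaw_Ioi_ne_zero (hσ : 0 < σ) : lossLaw θ σ (Set.Ioi t) ≠ 0 := by
  intro h
  have h1 := lossLaw_real_Ioi (θ := θ) (t := t) hσ
  rw [measureReal_def, h, ENNReal.toReal_zero] at h1
  exact (one_sub_Phi_pos (gam t θ σ)).ne h1

lemma isProbabilityMeasure_paymentLaw (hσ : 0 < σ) :
    IsProbabilityMeasure (paymentLaw c t T θ σ) := by
  have := cond_isProbabilityMeasure (lossLaw_Ioi_ne_zero (θ := θ) (t := t) hσ)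
  exact Measure.isProbabilityMeasure_map (by fun_prop)

lemma cdf_paymentLaw (hσ : 0 < σ) (y : ℝ) :
    cdf (paymentLaw c t T θ σ) y =
      (1 - Phi (gam t θ σ))⁻¹ *
        (lossLaw θ σ).real (Set.Ioi t ∩ {x | c * (min x T - t) ≤ y}) := by
  have := isProbabilityMeasure_paymentLaw (c := c) (t := t) (T := T) (θ := θ) hσ
  rw [cdf_eq_real, measureReal_def, paymentLaw,
    Measure.map_apply (by fun_prop) measurableSet_Iic, cond_apply measurableSet_Ioi,
    ENNReal.toReal_mul, ENNReal.toReal_inv, ← lossLaw_real_Ioi hσ]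
  rfl

lemma cdf_paymentLaw_of_neg (hc : 0 < c) (htT : t < T) (hσ : 0 < σ) {y : ℝ} (hy : y < 0) :
    cdf (paymentLaw c t T θ σ) y = 0 := by
  have : Set.Ioi t ∩ {x | c * (min x T - t) ≤ y} = ∅ := by
    ext x
    simp only [Set.mem_inter_iff, Set.mem_Ioi, Set.mem_ofPred_eq, Set.mem_empty_iff_false,
      iff_false, not_and, not_le]
    intro hx
    have := mul_pos hc (sub_pos.2 (lt_min hx htT))
    linarith
  rw [cdf_paymentLaw hσ, this]
  simp

lemma cdf_paymentLaw_of_mem (hc : 0 < c) (hσ : 0 < σ) {y : ℝ} (hy : 0 ≤ y)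
    (hyT : y < c * (T - t)) :
    cdf (paymentLaw c t T θ σ) y =
      (Phi ((y / c + t - θ) / σ) - Phi (gam t θ σ)) / (1 - Phi (gam t θ σ)) := by
  have hdiv : 0 ≤ y / c := by positivity
  have : Set.Ioi t ∩ {x | c * (min x T - t) ≤ y} = Set.Iic (y / c + t) \ Set.Iic t := by
    ext x
    simp only [Set.mem_inter_iff, Set.mem_Ioi, Set.mem_ofPred_eq, Set.mem_sdiff, Set.mem_Iic,
      not_le]
    rw [and_comm]
    refine and_congr_left fun _ => ?_
    have h1 : c * (min x T - t) ≤ y ↔ min x T ≤ y / c + t := by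
      rw [← le_div_iff₀' hc, sub_le_iff_le_add]
    have h2 : ¬ T ≤ y / c + t := by
      rw [not_le, ← lt_sub_iff_add_lt, div_lt_iff₀' hc]
      exact hyT
    rw [h1, min_le_iff, or_iff_left h2]
  rw [cdf_paymentLaw hσ, this, measureReal_sdiff (Set.Iic_subset_Iic.2 (by linarith))
    measurableSet_Iic, ← cdf_eq_real, ← cdf_eq_real, cdf_lossLaw θ hσ, cdf_lossLaw θ hσ, gam]
  ring

lemma cdf_paymentLaw_of_le (hc : 0 < c) (hσ : 0 < σ) {y : ℝ} (hyT : c * (T - t) ≤ y) :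
    cdf (paymentLaw c t T θ σ) y = 1 := by
  have : Set.Ioi t ∩ {x | c * (min x T - t) ≤ y} = Set.Ioi t := by
    refine Set.inter_eq_left.2 fun x _ => ?_
    have : c * (min x T - t) ≤ c * (T - t) := by gcongr; exact min_le_right _ _
    exact this.trans hyT
  rw [cdf_paymentLaw hσ, this, lossLaw_real_Ioi hσ, inv_mul_cancel₀ (one_sub_Phi_pos _).ne']

/-- The quantile `c (θ + σ Δ_v - t)` of the uncensored part of the payment law. -/
noncomputable def payQ (c t θ σ v : ℝ) : ℝ := c * (θ + σ * Delta (gam t θ σ) v - t)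

lemma hY_payQ (hc : 0 < c) (v : ℝ) :
    hY c t (payQ c t θ σ v) = θ + σ * Delta (gam t θ σ) v := by
  rw [hY, payQ, mul_div_cancel_left₀ _ hc.ne']
  ring

lemma payQ_zero (hσ : 0 < σ) : payQ c t θ σ 0 = 0 := by
  rw [payQ, Delta_zero, gam, mul_div_cancel₀ _ hσ.ne']
  ring

lemma payQ_lt_payQ (hc : 0 < c) (hσ : 0 < σ) {s r : ℝ} (h0 : 0 ≤ s) (hsr : s < r) (h1 : r < 1) :
    payQ c t θ σ s < payQ c t θ σ r := by
  have := Delta_lt_Delta (γ := gam t θ σ) h0 hsr h1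
  unfold payQ
  gcongr

lemma payQ_le_payQ (hc : 0 < c) (hσ : 0 < σ) {s r : ℝ} (h0 : 0 ≤ s) (hsr : s ≤ r) (h1 : r < 1) :
    payQ c t θ σ s ≤ payQ c t θ σ r := by
  have := Delta_mono (γ := gam t θ σ) h0 hsr h1
  unfold payQ
  gcongr

lemma payQ_nonneg (hc : 0 < c) (hσ : 0 < σ) {v : ℝ} (h0 : 0 ≤ v) (h1 : v < 1) :
    0 ≤ payQ c t θ σ v := by
  rw [← payQ_zero (c := c) (t := t) (θ := θ) hσ]
  exact payQ_le_payQ hc hσ le_rfl h0 h1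

lemma sStar_eq (hσ : 0 < σ) : sStar t T θ σ =
    (Phi ((T - θ) / σ) - Phi (gam t θ σ)) / (1 - Phi (gam t θ σ)) := by
  rw [sStar, cdf_lossLaw θ hσ, cdf_lossLaw θ hσ, gam]

lemma sStar_lt_one (hσ : 0 < σ) : sStar t T θ σ < 1 := by
  rw [sStar_eq hσ, div_lt_one (one_sub_Phi_pos _)]
  linarith [Phi_lt_one ((T - θ) / σ)]

lemma payQ_lt (hc : 0 < c) (hσ : 0 < σ) {v : ℝ} (h0 : 0 ≤ v) (hv : v < sStar t T θ σ) :
    payQ c t θ σ v < c * (T - t) := by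
  have h1 := hv.trans (sStar_lt_one hσ)
  rw [sStar_eq hσ, lt_div_iff₀ (one_sub_Phi_pos _)] at hv
  have h2 : Delta (gam t θ σ) v < (T - θ) / σ := by
    rw [← strictMono_Phi.lt_iff_lt, Phi_Delta (level_mem h0 h1 _)]
    linarith
  rw [lt_div_iff₀ hσ] at h2
  unfold payQ
  gcongr
  linarith

lemma cdf_payQ (hc : 0 < c) (hσ : 0 < σ) {v : ℝ} (h0 : 0 ≤ v) (hv : v < sStar t T θ σ) :
    cdf (paymentLaw c t T θ σ) (payQ c t θ σ v) = v := by
  have h1 := hv.trans (sStar_lt_one hσ)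
  have hP := one_sub_Phi_pos (gam t θ σ)
  rw [cdf_paymentLaw_of_mem hc hσ (payQ_nonneg hc hσ h0 h1) (payQ_lt hc hσ h0 hv),
    show payQ c t θ σ v / c + t = hY c t (payQ c t θ σ v) from rfl, hY_payQ hc,
    add_sub_cancel_left, mul_div_cancel_left₀ _ hσ.ne', Phi_Delta (level_mem h0 h1 _)]
  field_simp
  ring

lemma cdf_paymentLaw_lt (hc : 0 < c) (htT : t < T) (hσ : 0 < σ) {v : ℝ} (h0 : 0 < v)
    (hv : v < sStar t T θ σ) {y : ℝ} (hy : y < payQ c t θ σ v) :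
    cdf (paymentLaw c t T θ σ) y < v := by
  rcases lt_or_ge y 0 with h | h
  · rwa [cdf_paymentLaw_of_neg hc htT hσ h]
  · have hq := payQ_lt hc hσ h0.le hv
    have hP := one_sub_Phi_pos (gam t θ σ)
    conv_rhs => rw [← cdf_payQ hc hσ h0.le hv]
    rw [cdf_paymentLaw_of_mem hc hσ h (hy.trans hq),
      cdf_paymentLaw_of_mem hc hσ (h.trans hy.le) hq]
    have : Phi ((y / c + t - θ) / σ) < Phi ((payQ c t θ σ v / c + t - θ) / σ) :=
      strictMono_Phi (by gcongr)
    gcongr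

lemma le_cdf_paymentLaw_iff (hc : 0 < c) (htT : t < T) (hσ : 0 < σ) {v : ℝ} (h0 : 0 < v)
    (hv : v < sStar t T θ σ) (y : ℝ) :
    v ≤ cdf (paymentLaw c t T θ σ) y ↔ payQ c t θ σ v ≤ y := by
  constructor
  · intro h
    by_contra hcon
    exact absurd (cdf_paymentLaw_lt hc htT hσ h0 hv (not_le.1 hcon)) (not_lt.2 h)
  · intro h
    conv_lhs => rw [← cdf_payQ hc hσ h0.le hv]
    exact (cdf (paymentLaw c t T θ σ)).mono h

lemma lt_cdf_paymentLaw (hc : 0 < c) (hσ : 0 < σ) {v : ℝ} (h0 : 0 ≤ v)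
    (hv : v < sStar t T θ σ) {y : ℝ} (hy : payQ c t θ σ v < y) :
    v < cdf (paymentLaw c t T θ σ) y := by
  have h1 := hv.trans (sStar_lt_one hσ)
  have hq0 := payQ_nonneg (t := t) (θ := θ) hc hσ h0 h1
  have hP := one_sub_Phi_pos (gam t θ σ)
  rcases lt_or_ge y (c * (T - t)) with h | h
  · conv_lhs => rw [← cdf_payQ hc hσ h0 hv]
    rw [cdf_paymentLaw_of_mem hc hσ (hq0.trans hy.le) h,
      cdf_paymentLaw_of_mem hc hσ hq0 (hy.trans h)]
    have : Phi ((payQ c t θ σ v / c + t - θ) / σ) < Phi ((y / c + t - θ) / σ) :=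
      strictMono_Phi (by gcongr)
    gcongr
  · rwa [cdf_paymentLaw_of_le hc hσ h]

/-- At level `0` both sides are `0`: the left one as the infimum of all of `ℝ`. -/
lemma quantile_paymentLaw (hc : 0 < c) (htT : t < T) (hσ : 0 < σ) {v : ℝ} (h0 : 0 ≤ v)
    (hv : v < sStar t T θ σ) : quantile (paymentLaw c t T θ σ) v = payQ c t θ σ v := by
  rcases h0.eq_or_lt with rfl | h0
  · have : {x | 0 ≤ cdf (paymentLaw c t T θ σ) x} = Set.univ :=
      Set.eq_univ_of_forall fun x => cdf_nonneg _ x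
    rw [payQ_zero hσ, quantile, this, Real.sInf_univ]
  · have : {x | v ≤ cdf (paymentLaw c t T θ σ) x} = Set.Ici (payQ c t θ σ v) := by
      ext x
      exact le_cdf_paymentLaw_iff hc htT hσ h0 hv x
    rw [quantile, this, csInf_Ici]

lemma hasDerivAt_cdf_payQ (hc : 0 < c) (hσ : 0 < σ) {v : ℝ} (h0 : 0 < v)
    (hv : v < sStar t T θ σ) :
    HasDerivAt (fun y => cdf (paymentLaw c t T θ σ) y)
      (phi (Delta (gam t θ σ) v) / (c * σ * (1 - Phi (gam t θ σ)))) (payQ c t θ σ v) := by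
  have h1 := hv.trans (sStar_lt_one hσ)
  have hq0 : 0 < payQ c t θ σ v := by
    rw [← payQ_zero (c := c) (t := t) (θ := θ) hσ]
    exact payQ_lt_payQ hc hσ le_rfl h0 h1
  have hlin : HasDerivAt (fun y : ℝ => (y / c + t - θ) / σ) (1 / c / σ) (payQ c t θ σ v) :=
    ((((hasDerivAt_id _).div_const c).add_const t).sub_const θ).div_const σ
  have harg : (payQ c t θ σ v / c + t - θ) / σ = Delta (gam t θ σ) v := by
    rw [show payQ c t θ σ v / c + t = hY c t (payQ c t θ σ v) from rfl, hY_payQ hc,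
      add_sub_cancel_left, mul_div_cancel_left₀ _ hσ.ne']
  have hPhi := hasDerivAt_Phi ((payQ c t θ σ v / c + t - θ) / σ)
  have h2 := ((hPhi.comp (payQ c t θ σ v) hlin).sub_const
    (Phi (gam t θ σ))).div_const (1 - Phi (gam t θ σ))
  rw [harg] at h2
  have hP := one_sub_Phi_pos (gam t θ σ)
  refine (h2.congr_deriv (by field_simp)).congr_of_eventuallyEq ?_
  filter_upwards [Ioo_mem_nhds hq0 (payQ_lt hc hσ h0.le hv)] with y hy
  exact cdf_paymentLaw_of_mem hc hσ hy.1.le hy.2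

end PaymentLaw

/-! ### Moments of the winsorized payment -/

section Moments

variable {c t T a b θ σ : ℝ}

/-- Clamping the payment to the interval between two of its quantiles has the law of the quantile
function at a clamped uniform variable. -/
lemma map_wins_paymentLaw (hc : 0 < c) (htT : t < T) (hσ : 0 < σ)
    (ha : 0 ≤ a) (hab : a < 1 - b) (hb : 1 - b < sStar t T θ σ) :
    (paymentLaw c t T θ σ).map (wins (payQ c t θ σ a) (payQ c t θ σ (1 - b))) =
      (volume.restrict (Set.Ioc (0 : ℝ) 1)).map
        (fun s => payQ c t θ σ (wins a (1 - b) s)) := by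
  have hb0 : 0 < b := by linarith [sStar_lt_one (t := t) (T := T) (θ := θ) hσ]
  have := isProbabilityMeasure_paymentLaw (c := c) (t := t) (T := T) (θ := θ) hσ
  have hcont : Continuous fun s => payQ c t θ σ (wins a (1 - b) s) := by
    have := continuous_Delta_wins_right ha hab hb0 (gam t θ σ)
    unfold payQ
    fun_prop
  have hU : IsProbabilityMeasure (volume.restrict (Set.Ioc (0 : ℝ) 1)) := ⟨by simp⟩
  have hw := (continuous_wins (payQ c t θ σ a) (payQ c t θ σ (1 - b))).measurable
  have := Measure.isProbabilityMeasure_map (μ := paymentLaw c t T θ σ) hw.aemeasurable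
  have := Measure.isProbabilityMeasure_map (μ := volume.restrict (Set.Ioc (0 : ℝ) 1))
    hcont.measurable.aemeasurable
  refine Measure.eq_of_cdf _ _ (StieltjesFunction.ext fun x => ?_)
  rw [cdf_eq_real, cdf_eq_real, map_measureReal_apply hw measurableSet_Iic,
    map_measureReal_apply hcont.measurable measurableSet_Iic,
    measureReal_restrict_apply (hcont.measurable measurableSet_Iic)]
  have h1b : 0 < 1 - b := ha.trans_lt hab
  have hq := payQ_lt_payQ (t := t) (θ := θ) hc hσ ha hab (by linarith : 1 - b < 1)
  have hmon : ∀ s, payQ c t θ σ a ≤ payQ c t θ σ (wins a (1 - b) s) ∧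
      payQ c t θ σ (wins a (1 - b) s) ≤ payQ c t θ σ (1 - b) := fun s =>
    ⟨payQ_le_payQ hc hσ ha (wins_mem hab.le s).1 (wins_mem_unit ha hab hb0 s).2,
      payQ_le_payQ hc hσ (wins_mem_unit ha hab hb0 s).1 (wins_mem hab.le s).2 (by linarith)⟩
  rcases lt_or_ge x (payQ c t θ σ a) with h1 | h1
  · have e1 : wins (payQ c t θ σ a) (payQ c t θ σ (1 - b)) ⁻¹' Set.Iic x = ∅ := by
      ext y
      have := (wins_mem hq.le y).1
      simp only [Set.mem_preimage, Set.mem_Iic, Set.mem_empty_iff_false, iff_false, not_le]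
      linarith
    have e2 : (fun s => payQ c t θ σ (wins a (1 - b) s)) ⁻¹' Set.Iic x = ∅ := by
      ext s
      have := (hmon s).1
      simp only [Set.mem_preimage, Set.mem_Iic, Set.mem_empty_iff_false, iff_false, not_le]
      linarith
    rw [e1, e2]
    simp
  rcases lt_or_ge x (payQ c t θ σ (1 - b)) with h2 | h2
  · have e1 : wins (payQ c t θ σ a) (payQ c t θ σ (1 - b)) ⁻¹' Set.Iic x = Set.Iic x := by
      ext y
      simp [wins, h1, not_le.2 h2]
    have hlt := cdf_paymentLaw_lt hc htT hσ h1b hb h2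
    have hle : a ≤ cdf (paymentLaw c t T θ σ) x := by
      rcases ha.eq_or_lt with h | h
      · rw [← h]; exact cdf_nonneg _ _
      · exact (le_cdf_paymentLaw_iff hc htT hσ h (hab.trans hb) x).2 h1
    have e2 : (fun s => payQ c t θ σ (wins a (1 - b) s)) ⁻¹' Set.Iic x ∩ Set.Ioc 0 1 =
        Set.Ioc 0 (cdf (paymentLaw c t T θ σ) x) := by
      ext s
      simp only [Set.mem_inter_iff, Set.mem_preimage, Set.mem_Iic, Set.mem_Ioc]
      have key : 0 < s → (payQ c t θ σ (wins a (1 - b) s) ≤ x ↔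
          s ≤ cdf (paymentLaw c t T θ σ) x) := by
        intro hs
        have hw0 : 0 < wins a (1 - b) s := lt_max_of_lt_right (lt_min h1b hs)
        rw [← le_cdf_paymentLaw_iff hc htT hσ hw0 ((wins_mem hab.le s).2.trans_lt hb)]
        simp [wins, hle, not_le.2 hlt]
      constructor
      · rintro ⟨hx, hs, -⟩
        exact ⟨hs, (key hs).1 hx⟩
      · rintro ⟨hs, hx⟩
        exact ⟨(key hs).2 hx, hs, hx.trans (cdf_le_one _ _)⟩
    rw [e1, e2, ← cdf_eq_real, Real.volume_real_Ioc_of_le (cdf_nonneg _ _), sub_zero]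
  · have e1 : wins (payQ c t θ σ a) (payQ c t θ σ (1 - b)) ⁻¹' Set.Iic x = Set.univ :=
      Set.eq_univ_of_forall fun y => (wins_mem hq.le y).2.trans h2
    have e2 : (fun s => payQ c t θ σ (wins a (1 - b) s)) ⁻¹' Set.Iic x = Set.univ :=
      Set.eq_univ_of_forall fun s => (hmon s).2.trans h2
    rw [e1, e2]
    simp

/-- The `k`-th power of the standardized loss `(h_Y(y) - θ) / σ`. -/
noncomputable def stdPow (c t θ σ : ℝ) (k : ℕ) (y : ℝ) : ℝ := ((y / c + t - θ) / σ) ^ k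

lemma continuous_stdPow (c t θ σ : ℝ) (k : ℕ) : Continuous (stdPow c t θ σ k) := by
  unfold stdPow; fun_prop

lemma contDiff_stdPow (c t θ σ : ℝ) (k : ℕ) : ContDiff ℝ 1 (stdPow c t θ σ k) := by
  unfold stdPow; fun_prop

lemma stdPow_payQ (hc : 0 < c) (hσ : 0 < σ) (k : ℕ) (v : ℝ) :
    stdPow c t θ σ k (payQ c t θ σ v) = Delta (gam t θ σ) v ^ k := by
  rw [stdPow, show payQ c t θ σ v / c + t = hY c t (payQ c t θ σ v) from rfl, hY_payQ hc,
      add_sub_cancel_left, mul_div_cancel_left₀ _ hσ.ne']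

lemma stdPow_mul (c t θ σ : ℝ) (i j : ℕ) (y : ℝ) :
    stdPow c t θ σ i y * stdPow c t θ σ j y = stdPow c t θ σ (i + j) y := (pow_add _ i j).symm

lemma hasDerivAt_stdPow (hc : 0 < c) (hσ : 0 < σ) (k : ℕ) (v : ℝ) :
    HasDerivAt (stdPow c t θ σ k) (k * Delta (gam t θ σ) v ^ (k - 1) / (c * σ))
      (payQ c t θ σ v) := by
  have hlin : HasDerivAt (fun y : ℝ => (y / c + t - θ) / σ) (1 / c / σ) (payQ c t θ σ v) :=
    ((((hasDerivAt_id _).div_const c).add_const t).sub_const θ).div_const σ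
  have harg : (payQ c t θ σ v / c + t - θ) / σ = Delta (gam t θ σ) v := by
    rw [show payQ c t θ σ v / c + t = hY c t (payQ c t θ σ v) from rfl, hY_payQ hc,
      add_sub_cancel_left, mul_div_cancel_left₀ _ hσ.ne']
  refine (hlin.fun_pow k).congr_deriv ?_
  rw [harg]
  field_simp

lemma integral_stdPow_wins (hc : 0 < c) (htT : t < T) (hσ : 0 < σ)
    (ha : 0 ≤ a) (hab : a < 1 - b) (hb : 1 - b < sStar t T θ σ) (k : ℕ) :
    ∫ y, stdPow c t θ σ k (wins (payQ c t θ σ a) (payQ c t θ σ (1 - b)) y)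
      ∂(paymentLaw c t T θ σ) = cy a b (gam t θ σ) k := by
  have hb0 : 0 < b := by linarith [sStar_lt_one (t := t) (T := T) (θ := θ) hσ]
  have hcont : Continuous fun s => payQ c t θ σ (wins a (1 - b) s) := by
    have := continuous_Delta_wins_right ha hab hb0 (gam t θ σ)
    unfold payQ
    fun_prop
  rw [← integral_map (φ := wins (payQ c t θ σ a) (payQ c t θ σ (1 - b)))
      (f := stdPow c t θ σ k) (continuous_wins _ _).aemeasurable
      (continuous_stdPow c t θ σ k).aestronglyMeasurable,
    map_wins_paymentLaw hc htT hσ ha hab hb,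
    integral_map hcont.aemeasurable (continuous_stdPow c t θ σ k).aestronglyMeasurable,
    cy_eq_integral ha hab hb0, intervalIntegral.integral_of_le zero_le_one]
  simp only [stdPow_payQ hc hσ]

lemma popMoment_eq (hc : 0 < c) (htT : t < T) (hσ : 0 < σ)
    (ha : 0 ≤ a) (hab : a < 1 - b) (hb : 1 - b < sStar t T θ σ) (k : ℕ) :
    popMoment c t T a b θ σ k =
      a * (θ + σ * Delta (gam t θ σ) a) ^ k
        + (∫ v in a..(1 - b), (θ + σ * Delta (gam t θ σ) v) ^ k)
        + b * (θ + σ * Delta (gam t θ σ) (1 - b)) ^ k := by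
  have h : ∀ v, 0 ≤ v → v < sStar t T θ σ →
      hY c t (quantile (paymentLaw c t T θ σ) v) = θ + σ * Delta (gam t θ σ) v := by
    intro v h0 h1
    rw [quantile_paymentLaw hc htT hσ h0 h1, hY_payQ hc]
  rw [popMoment, h a ha (hab.trans hb), h (1 - b) (ha.trans hab.le) hb]
  congr 2
  refine intervalIntegral.integral_congr fun v hv => ?_
  rw [Set.uIcc_of_le hab.le] at hv
  simp only [h v (ha.trans hv.1) (hv.2.trans_lt hb)]

lemma popMoment_one (hc : 0 < c) (htT : t < T) (hσ : 0 < σ)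
    (ha : 0 ≤ a) (hab : a < 1 - b) (hb : 1 - b < sStar t T θ σ) :
    popMoment c t T a b θ σ 1 = θ + σ * cy a b (gam t θ σ) 1 := by
  have hb0 : 0 < b := by linarith [sStar_lt_one (t := t) (T := T) (θ := θ) hσ]
  have hi := intervalIntegrable_Delta_pow (gam t θ σ) 1 ha hab.le (by linarith)
  simp only [pow_one] at hi
  rw [popMoment_eq hc htT hσ ha hab hb, cy]
  simp only [pow_one]
  rw [intervalIntegral.integral_add intervalIntegrable_const (hi.const_mul σ),
    intervalIntegral.integral_const_mul, intervalIntegral.integral_const, smul_eq_mul]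
  ring

lemma popMoment_two (hc : 0 < c) (htT : t < T) (hσ : 0 < σ)
    (ha : 0 ≤ a) (hab : a < 1 - b) (hb : 1 - b < sStar t T θ σ) :
    popMoment c t T a b θ σ 2 =
      θ ^ 2 + 2 * θ * σ * cy a b (gam t θ σ) 1 + σ ^ 2 * cy a b (gam t θ σ) 2 := by
  have hb0 : 0 < b := by linarith [sStar_lt_one (t := t) (T := T) (θ := θ) hσ]
  have hi := intervalIntegrable_Delta_pow (gam t θ σ) 1 ha hab.le (by linarith)
  have hi2 := intervalIntegrable_Delta_pow (gam t θ σ) 2 ha hab.le (by linarith)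
  have hexp : ∀ v, (θ + σ * Delta (gam t θ σ) v) ^ 2 =
      θ ^ 2 + (2 * θ * σ) * Delta (gam t θ σ) v ^ 1 + σ ^ 2 * Delta (gam t θ σ) v ^ 2 := by
    intro v; ring
  rw [popMoment_eq hc htT hσ ha hab hb, cy, cy]
  simp only [hexp]
  rw [intervalIntegral.integral_add (intervalIntegrable_const.add (hi.const_mul _))
      (hi2.const_mul _), intervalIntegral.integral_add intervalIntegrable_const (hi.const_mul _),
    intervalIntegral.integral_const_mul, intervalIntegral.integral_const_mul,
    intervalIntegral.integral_const, smul_eq_mul]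
  ring

lemma wVar_eq (hc : 0 < c) (htT : t < T) (hσ : 0 < σ)
    (ha : 0 ≤ a) (hab : a < 1 - b) (hb : 1 - b < sStar t T θ σ) :
    wVar c t T a b θ σ = σ ^ 2 * spread a b (gam t θ σ) := by
  rw [wVar, popMoment_one hc htT hσ ha hab hb, popMoment_two hc htT hσ ha hab hb, spread]
  ring

/-- The true parameters solve the estimating equations at the population moments. -/
lemma solves_popMoment (hc : 0 < c) (htT : t < T) (hσ : 0 < σ)
    (ha : 0 ≤ a) (hab : a < 1 - b) (hb : 1 - b < sStar t T θ σ) :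
    Solves t a b (popMoment c t T a b θ σ 1) (popMoment c t T a b θ σ 2) θ σ := by
  have hb0 : 0 < b := by linarith [sStar_lt_one (t := t) (T := T) (θ := θ) hσ]
  refine (solves_iff ha hab hb0 _ _ _ _ _).2 ⟨hσ, ?_, wVar_eq hc htT hσ ha hab hb⟩
  have hg : σ * gam t θ σ = t - θ := mul_div_cancel₀ _ hσ.ne'
  rw [popMoment_one hc htT hσ ha hab hb, excess, mul_sub, hg]
  ring

end Moments

/-! ### The covariance matrix of the influence functions -/

section Covariance

variable {c t T a b θ σ : ℝ}

/-- The influence function of the winsorized mean of `((h_Y(y) - θ) / σ) ^ k`. -/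
noncomputable def infl (c t a b θ σ : ℝ) (k : ℕ) : ℝ → ℝ :=
  influence (stdPow c t θ σ k) (payQ c t θ σ a) (payQ c t θ σ (1 - b))
    (cyDa a (gam t θ σ) k) (-cyDb b (gam t θ σ) k)

lemma measurable_infl (c t a b θ σ : ℝ) (k : ℕ) : Measurable (infl c t a b θ σ k) :=
  measurable_influence (continuous_stdPow c t θ σ k) _ _ _ _

lemma exists_bound_infl (hc : 0 < c) (hσ : 0 < σ) (ha : 0 ≤ a) (hab : a < 1 - b) (hb : 0 < b)
    (k : ℕ) : ∃ C, ∀ y, |infl c t a b θ σ k y| ≤ C :=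
  exists_bound_influence (continuous_stdPow c t θ σ k)
    (payQ_lt_payQ hc hσ ha hab (by linarith)).le _ _

/-- The integral of a linear combination of winsorized powers and of the two indicators from
which the influence functions are built. -/
lemma integral_combination (hc : 0 < c) (htT : t < T) (hσ : 0 < σ)
    (ha : 0 ≤ a) (hab : a < 1 - b) (hb : 1 - b < sStar t T θ σ) (i j k : ℕ) (p q r s u : ℝ) :
    ∫ y, (stdPow c t θ σ i (wins (payQ c t θ σ a) (payQ c t θ σ (1 - b)) y)
        + p * stdPow c t θ σ j (wins (payQ c t θ σ a) (payQ c t θ σ (1 - b)) y)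
        + q * stdPow c t θ σ k (wins (payQ c t θ σ a) (payQ c t θ σ (1 - b)) y)
        + r * below (payQ c t θ σ a) y + s * below (payQ c t θ σ (1 - b)) y + u)
      ∂(paymentLaw c t T θ σ) =
      cy a b (gam t θ σ) i + p * cy a b (gam t θ σ) j + q * cy a b (gam t θ σ) k
        + r * a + s * (1 - b) + u := by
  have hb0 : 0 < b := by linarith [sStar_lt_one (t := t) (T := T) (θ := θ) hσ]
  have := isProbabilityMeasure_paymentLaw (c := c) (t := t) (T := T) (θ := θ) hσ
  have hq := (payQ_lt_payQ (t := t) (θ := θ) hc hσ ha hab (by linarith)).le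
  have hi : ∀ k, Integrable (fun y => stdPow c t θ σ k
      (wins (payQ c t θ σ a) (payQ c t θ σ (1 - b)) y)) (paymentLaw c t T θ σ) := fun k => by
    obtain ⟨C, hC⟩ := exists_bound_wins hq (continuous_stdPow c t θ σ k)
    exact integrable_of_bounded
      ((continuous_stdPow c t θ σ k).comp (continuous_wins _ _)).measurable hC
  have hB : ∀ x, Integrable (below x) (paymentLaw c t T θ σ) := fun x => integrable_below x
  have i1 := (hi i).add ((hi j).const_mul p)
  have i2 := i1.add ((hi k).const_mul q)
  have i3 := i2.add ((hB (payQ c t θ σ a)).const_mul r)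
  have i4 := i3.add ((hB (payQ c t θ σ (1 - b))).const_mul s)
  have e5 := integral_add i4 (integrable_const u)
  have e4 := integral_add i3 ((hB (payQ c t θ σ (1 - b))).const_mul s)
  have e3 := integral_add i2 ((hB (payQ c t θ σ a)).const_mul r)
  have e2 := integral_add i1 ((hi k).const_mul q)
  have e1 := integral_add (hi i) ((hi j).const_mul p)
  simp only [Pi.add_apply] at e1 e2 e3 e4 e5
  rw [e5, e4, e3, e2, e1]
  simp only [integral_const_mul, integral_stdPow_wins hc htT hσ ha hab hb, integral_below,
    cdf_payQ hc hσ ha (hab.trans hb), cdf_payQ hc hσ (ha.trans hab.le) hb]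
  simp

lemma integral_infl (hc : 0 < c) (htT : t < T) (hσ : 0 < σ)
    (ha : 0 ≤ a) (hab : a < 1 - b) (hb : 1 - b < sStar t T θ σ) (k : ℕ) :
    ∫ y, infl c t a b θ σ k y ∂(paymentLaw c t T θ σ) =
      cy a b (gam t θ σ) k - cyDa a (gam t θ σ) k * a + cyDb b (gam t θ σ) k * (1 - b) := by
  have h := integral_combination (c := c) hc htT hσ ha hab hb k k k 0 0
    (-cyDa a (gam t θ σ) k) (cyDb b (gam t θ σ) k) 0
  calc _ = _ := integral_congr_ae (Eventually.of_forall fun y => by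
        simp only [infl, influence]; ring)
    _ = _ := h
    _ = _ := by ring

/-- The product of two influence functions is again a linear combination of winsorized powers and
of the two indicators, because the clamped variable is constant outside the clamping interval. -/
lemma integral_infl_mul_infl (hc : 0 < c) (htT : t < T) (hσ : 0 < σ)
    (ha : 0 ≤ a) (hab : a < 1 - b) (hb : 1 - b < sStar t T θ σ) (i j : ℕ) :
    ∫ y, infl c t a b θ σ i y * infl c t a b θ σ j y ∂(paymentLaw c t T θ σ) =
      cy a b (gam t θ σ) (i + j)
        + cyDb b (gam t θ σ) j * (cy a b (gam t θ σ) i - b * Delta (gam t θ σ) (1 - b) ^ i)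
        + cyDb b (gam t θ σ) i * (cy a b (gam t θ σ) j - b * Delta (gam t θ σ) (1 - b) ^ j)
        - cyDa a (gam t θ σ) j * Delta (gam t θ σ) a ^ i * a
        - cyDa a (gam t θ σ) i * Delta (gam t θ σ) a ^ j * a
        + (cyDa a (gam t θ σ) i * cyDa a (gam t θ σ) j
          - cyDa a (gam t θ σ) i * cyDb b (gam t θ σ) j
          - cyDa a (gam t θ σ) j * cyDb b (gam t θ σ) i) * a
        + cyDb b (gam t θ σ) i * cyDb b (gam t θ σ) j * (1 - b) := by
  have hb0 : 0 < b := by linarith [sStar_lt_one (t := t) (T := T) (θ := θ) hσ]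
  have hq := payQ_lt_payQ (t := t) (θ := θ) hc hσ ha hab (by linarith)
  set γ := gam t θ σ with hγ
  have h := integral_combination (c := c) hc htT hσ ha hab hb (i + j) i j
    (cyDb b γ j) (cyDb b γ i)
    (-(cyDa a γ j * Delta γ a ^ i) - cyDa a γ i * Delta γ a ^ j + cyDa a γ i * cyDa a γ j
      - cyDa a γ i * cyDb b γ j - cyDa a γ j * cyDb b γ i)
    (cyDb b γ i * cyDb b γ j + cyDb b γ j * Delta γ (1 - b) ^ i + cyDb b γ i * Delta γ (1 - b) ^ j)
    (-(cyDb b γ j * Delta γ (1 - b) ^ i) - cyDb b γ i * Delta γ (1 - b) ^ j)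
  calc _ = _ := integral_congr_ae (Eventually.of_forall fun y => by
        simp only [infl, influence, ← hγ]
        rw [← stdPow_mul]
        rcases le_or_gt y (payQ c t θ σ a) with h1 | h1
        · have hw : wins (payQ c t θ σ a) (payQ c t θ σ (1 - b)) y = payQ c t θ σ a := by
            rw [wins, min_eq_right (h1.trans hq.le), max_eq_left h1]
          rw [hw, stdPow_payQ hc hσ, stdPow_payQ hc hσ, below, below, if_pos h1,
            if_pos (h1.trans hq.le)]
          ring
        rcases le_or_gt y (payQ c t θ σ (1 - b)) with h2 | h2
        · rw [below, below, if_neg (not_le.2 h1), if_pos h2]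
          ring
        · have hw : wins (payQ c t θ σ a) (payQ c t θ σ (1 - b)) y = payQ c t θ σ (1 - b) := by
            rw [wins, min_eq_left h2.le, max_eq_right hq.le]
          rw [hw, stdPow_payQ hc hσ, stdPow_payQ hc hσ, below, below, if_neg (not_le.2 h1),
            if_neg (not_le.2 h2)]
          ring)
    _ = _ := h
    _ = _ := by ring

/-- The covariance matrix of the influence functions of the first two winsorized standardized
moments. -/
noncomputable def inflCov (a b γ : ℝ) : Matrix (Fin 2) (Fin 2) ℝ :=
  !![cStar1 a b γ, 2 * cStar2 a b γ; 2 * cStar2 a b γ, 4 * cStar3 a b γ]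

/-- The linear combination of the centred influence functions with coefficients `u`. -/
noncomputable def inflComb (c t T a b θ σ : ℝ) (u : Fin 2 → ℝ) (y : ℝ) : ℝ :=
  u 0 * (infl c t a b θ σ 1 y - ∫ z, infl c t a b θ σ 1 z ∂(paymentLaw c t T θ σ))
    + u 1 * (infl c t a b θ σ 2 y - ∫ z, infl c t a b θ σ 2 z ∂(paymentLaw c t T θ σ))

lemma measurable_inflComb (c t T a b θ σ : ℝ) (u : Fin 2 → ℝ) :
    Measurable (inflComb c t T a b θ σ u) :=
  (((measurable_infl c t a b θ σ 1).sub_const _).const_mul _).add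
    (((measurable_infl c t a b θ σ 2).sub_const _).const_mul _)

lemma exists_bound_inflComb (hc : 0 < c) (hσ : 0 < σ) (ha : 0 ≤ a) (hab : a < 1 - b) (hb : 0 < b)
    (u : Fin 2 → ℝ) : ∃ C, ∀ y, |inflComb c t T a b θ σ u y| ≤ C := by
  obtain ⟨C, hC⟩ := exists_bound_infl (t := t) (θ := θ) hc hσ ha hab hb 1
  obtain ⟨D, hD⟩ := exists_bound_infl (t := t) (θ := θ) hc hσ ha hab hb 2
  refine ⟨|u 0| * (C + |∫ z, infl c t a b θ σ 1 z ∂(paymentLaw c t T θ σ)|)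
    + |u 1| * (D + |∫ z, infl c t a b θ σ 2 z ∂(paymentLaw c t T θ σ)|), fun y => ?_⟩
  unfold inflComb
  refine (abs_add_le _ _).trans ?_
  rw [abs_mul, abs_mul]
  gcongr
  · exact (abs_sub _ _).trans (by gcongr; exact hC y)
  · exact (abs_sub _ _).trans (by gcongr; exact hD y)

lemma integrable_infl (hc : 0 < c) (hσ : 0 < σ) (ha : 0 ≤ a) (hab : a < 1 - b) (hb : 0 < b)
    (k : ℕ) : Integrable (infl c t a b θ σ k) (paymentLaw c t T θ σ) := by
  have := isProbabilityMeasure_paymentLaw (c := c) (t := t) (T := T) (θ := θ) hσ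
  obtain ⟨C, hC⟩ := exists_bound_infl (t := t) (θ := θ) hc hσ ha hab hb k
  exact integrable_of_bounded (measurable_infl c t a b θ σ k) hC

lemma integral_inflComb (hc : 0 < c) (hσ : 0 < σ) (ha : 0 ≤ a) (hab : a < 1 - b) (hb : 0 < b)
    (u : Fin 2 → ℝ) : ∫ y, inflComb c t T a b θ σ u y ∂(paymentLaw c t T θ σ) = 0 := by
  have := isProbabilityMeasure_paymentLaw (c := c) (t := t) (T := T) (θ := θ) hσ
  have h := integrable_infl (t := t) (T := T) (θ := θ) hc hσ ha hab hb
  set μ₁ := ∫ z, infl c t a b θ σ 1 z ∂(paymentLaw c t T θ σ) with hμ₁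
  set μ₂ := ∫ z, infl c t a b θ σ 2 z ∂(paymentLaw c t T θ σ) with hμ₂
  have e := integral_add (((h 1).sub (integrable_const μ₁)).const_mul (u 0))
    (((h 2).sub (integrable_const μ₂)).const_mul (u 1))
  have e1 := integral_sub (h 1) (integrable_const μ₁)
  have e2 := integral_sub (h 2) (integrable_const μ₂)
  simp only [Pi.sub_apply] at e e1 e2
  unfold inflComb
  rw [e, integral_const_mul, integral_const_mul, e1, e2]
  simp [hμ₁, hμ₂]

lemma integral_inflComb_sq (hc : 0 < c) (htT : t < T) (hσ : 0 < σ)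
    (ha : 0 ≤ a) (hab : a < 1 - b) (hb : 1 - b < sStar t T θ σ) (u : Fin 2 → ℝ) :
    ∫ y, inflComb c t T a b θ σ u y ^ 2 ∂(paymentLaw c t T θ σ) =
      u ⬝ᵥ inflCov a b (gam t θ σ) *ᵥ u := by
  have hb0 : 0 < b := by linarith [sStar_lt_one (t := t) (T := T) (θ := θ) hσ]
  have := isProbabilityMeasure_paymentLaw (c := c) (t := t) (T := T) (θ := θ) hσ
  have h := integrable_infl (t := t) (T := T) (θ := θ) hc hσ ha hab hb0
  have hm : ∀ i j, Integrable (fun y => infl c t a b θ σ i y * infl c t a b θ σ j y)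
      (paymentLaw c t T θ σ) := fun i j => by
    obtain ⟨C, hC⟩ := exists_bound_infl (t := t) (θ := θ) hc hσ ha hab hb0 i
    exact (h j).bdd_mul (c := C) (measurable_infl c t a b θ σ i).aestronglyMeasurable
      (Eventually.of_forall hC)
  have hmul := integral_infl_mul_infl hc htT hσ ha hab hb
  set μ₁ := ∫ z, infl c t a b θ σ 1 z ∂(paymentLaw c t T θ σ) with hμ₁
  set μ₂ := ∫ z, infl c t a b θ σ 2 z ∂(paymentLaw c t T θ σ) with hμ₂
  have hexp : ∀ y, inflComb c t T a b θ σ u y ^ 2 =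
      u 0 ^ 2 * (infl c t a b θ σ 1 y * infl c t a b θ σ 1 y)
      + 2 * u 0 * u 1 * (infl c t a b θ σ 1 y * infl c t a b θ σ 2 y)
      + u 1 ^ 2 * (infl c t a b θ σ 2 y * infl c t a b θ σ 2 y)
      - 2 * (u 0 * μ₁ + u 1 * μ₂) * u 0 * infl c t a b θ σ 1 y
      - 2 * (u 0 * μ₁ + u 1 * μ₂) * u 1 * infl c t a b θ σ 2 y
      + (u 0 * μ₁ + u 1 * μ₂) ^ 2 := by
    intro y
    rw [inflComb, ← hμ₁, ← hμ₂]
    ring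
  have i1 := ((hm 1 1).const_mul (u 0 ^ 2)).add ((hm 1 2).const_mul (2 * u 0 * u 1))
  have i2 := i1.add ((hm 2 2).const_mul (u 1 ^ 2))
  have i3 := i2.sub ((h 1).const_mul (2 * (u 0 * μ₁ + u 1 * μ₂) * u 0))
  have i4 := i3.sub ((h 2).const_mul (2 * (u 0 * μ₁ + u 1 * μ₂) * u 1))
  have e1 := integral_add ((hm 1 1).const_mul (u 0 ^ 2)) ((hm 1 2).const_mul (2 * u 0 * u 1))
  have e2 := integral_add i1 ((hm 2 2).const_mul (u 1 ^ 2))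
  have e3 := integral_sub i2 ((h 1).const_mul (2 * (u 0 * μ₁ + u 1 * μ₂) * u 0))
  have e4 := integral_sub i3 ((h 2).const_mul (2 * (u 0 * μ₁ + u 1 * μ₂) * u 1))
  have e5 := integral_add i4 (integrable_const ((u 0 * μ₁ + u 1 * μ₂) ^ 2))
  simp only [Pi.add_apply, Pi.sub_apply] at e1 e2 e3 e4 e5
  simp only [hexp]
  rw [e5, e4, e3, e2, e1]
  simp only [integral_const_mul, integral_const, hmul, ← hμ₁, ← hμ₂]
  have m1 : μ₁ = _ := integral_infl hc htT hσ ha hab hb 1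
  have m2 : μ₂ = _ := integral_infl hc htT hσ ha hab hb 2
  rw [m1, m2]
  have pa := (phi_pos (Delta (gam t θ σ) a)).ne'
  have pb := (phi_pos (Delta (gam t θ σ) (1 - b))).ne'
  simp only [inflCov, Matrix.mulVec, dotProduct, Fin.sum_univ_two, Matrix.of_apply,
    Matrix.cons_val_zero, Matrix.cons_val_one, cStar1, cStar2, cStar3, cyDa, cyDb, probReal_univ,
    smul_eq_mul]
  norm_num
  field_simp
  ring

end Covariance

/-! ### The delta method -/

section DeltaMethod

variable {Ω : Type*} [MeasurableSpace Ω] {μ : Measure Ω}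
  {E F : Type*} [NormedAddCommGroup E] [NormedSpace ℝ E] [NormedAddCommGroup F] [NormedSpace ℝ F]

/-- The delta method. -/
lemma tendsto_delta_method {g : E → F} {g' : E →L[ℝ] F} {w : E} (hg : HasFDerivAt g g' w)
    {X Z : ℕ × Ω → E} (hZ : Tight μ Z)
    (hX : Tendsto (fun x => √(x.1 : ℝ) • (X x - w) - Z x) (inProb μ) (𝓝 0)) :
    Tendsto (fun x => √(x.1 : ℝ) • (g (X x) - g w) - g' (Z x)) (inProb μ) (𝓝 0) := by
  have hT : Tight μ fun x => √(x.1 : ℝ) • (X x - w) := hZ.of_tendsto_sub hX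
  have h1 : Tendsto (fun x => √(x.1 : ℝ) • (g (X x) - g w - g' (X x - w))) (inProb μ) (𝓝 0) :=
    hT.tendsto_of_isLittleO ((Asymptotics.isBigO_refl (fun x : ℕ × Ω => √(x.1 : ℝ))
      (inProb μ)).smul_isLittleO
      (hg.isLittleO.comp_tendsto (tendsto_of_tight_sqrt hT)))
  have h2 := (g'.continuous.tendsto 0).comp hX
  rw [map_zero] at h2
  have h3 := h1.add h2
  rw [add_zero] at h3
  refine h3.congr fun x => ?_
  simp only [Function.comp_apply, map_sub, map_smul, smul_sub]
  abel

end DeltaMethod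

/-! ### Linearization of the sample winsorized moments -/

section SampleMoments

variable {Ω : Type*} {θ σ : ℝ}

lemma sampleMoment_eq_emp (c t : ℝ) (Y : ℕ → Ω → ℝ) {x : ℕ × Ω} {m m' : ℕ} (h : m + m' < x.1)
    (k : ℕ) :
    sampleMoment c t (fun i : Fin x.1 => Y i x.2) m m' k =
      emp Y (fun y => hY c t (wins (ostat Y (m + 1) x) (ostat Y (x.1 - m') x) y) ^ k) x := by
  rw [sampleMoment, ← sum_clamp_orderStat (fun i : Fin x.1 => Y i x.2) (fun z => hY c t z ^ k) h,
    emp, one_div_mul_eq_div,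
    ← Fin.sum_univ_eq_sum_range (fun i => hY c t (wins (ostat Y (m + 1) x)
      (ostat Y (x.1 - m') x) (Y i x.2)) ^ k)]
  rfl

/-- The winsorized sample moments of the standardized losses `(h_Y(Y_i) - θ) / σ`. -/
noncomputable def stdMoment (c t θ σ : ℝ) (Y : ℕ → Ω → ℝ) (m m' : ℕ → Ω → ℕ) (k : ℕ)
    (x : ℕ × Ω) : ℝ :=
  emp Y (fun y => stdPow c t θ σ k
    (wins (ostat Y (m x.1 x.2 + 1) x) (ostat Y (x.1 - m' x.1 x.2) x) y)) x

lemma hY_eq (c t θ : ℝ) (hσ : 0 < σ) (y : ℝ) : hY c t y = θ + σ * stdPow c t θ σ 1 y := by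
  rw [hY, stdPow, pow_one, mul_div_cancel₀ _ hσ.ne']
  ring

lemma sampleMoment_one (c t θ : ℝ) (hσ : 0 < σ) (Y : ℕ → Ω → ℝ) {m m' : ℕ → Ω → ℕ} {x : ℕ × Ω}
    (h : m x.1 x.2 + m' x.1 x.2 < x.1) :
    sampleMoment c t (fun i : Fin x.1 => Y i x.2) (m x.1 x.2) (m' x.1 x.2) 1 =
      θ + σ * stdMoment c t θ σ Y m m' 1 x := by
  rw [sampleMoment_eq_emp c t Y h, stdMoment, ← emp_const (Y := Y) θ (by omega : 0 < x.1),
    ← emp_const_mul, ← emp_add, emp_const _ (by omega)]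
  simp only [pow_one, hY_eq c t θ hσ]

lemma sampleMoment_two (c t θ : ℝ) (hσ : 0 < σ) (Y : ℕ → Ω → ℝ) {m m' : ℕ → Ω → ℕ} {x : ℕ × Ω}
    (h : m x.1 x.2 + m' x.1 x.2 < x.1) :
    sampleMoment c t (fun i : Fin x.1 => Y i x.2) (m x.1 x.2) (m' x.1 x.2) 2 =
      θ ^ 2 + 2 * θ * σ * stdMoment c t θ σ Y m m' 1 x
        + σ ^ 2 * stdMoment c t θ σ Y m m' 2 x := by
  have hexp : ∀ y, hY c t y ^ 2 =
      θ ^ 2 + 2 * θ * σ * stdPow c t θ σ 1 y + σ ^ 2 * stdPow c t θ σ 2 y := by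
    intro y
    rw [hY_eq c t θ hσ, stdPow, stdPow]
    ring
  rw [sampleMoment_eq_emp c t Y h]
  simp only [hexp]
  rw [emp_add, emp_add, emp_const_mul, emp_const_mul, emp_const _ (by omega)]
  rfl

lemma inv_sqrt_mul_sum_eq_empProc (P : Measure ℝ) (Y : ℕ → Ω → ℝ) (f : ℝ → ℝ) (x : ℕ × Ω) :
    (√(x.1 : ℝ))⁻¹ * ∑ i ∈ Finset.range x.1, (f (Y i x.2) - ∫ z, f z ∂P) = empProc P Y f x := by
  rw [empProc, emp, Finset.sum_sub_distrib, Finset.sum_const, Finset.card_range, nsmul_eq_mul]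
  rcases Nat.eq_zero_or_pos x.1 with h | h
  · simp [h]
  · have h0 : (0 : ℝ) < x.1 := by exact_mod_cast h
    have h1 : (x.1 : ℝ) = √(x.1 : ℝ) * √(x.1 : ℝ) := (Real.mul_self_sqrt h0.le).symm
    have h2 : √(x.1 : ℝ) ≠ 0 := (Real.sqrt_pos.2 h0).ne'
    field_simp
    rw [Real.sq_sqrt h0.le]

/-- The vector of the first two centred influence functions. -/
noncomputable def inflVec (c t T a b θ σ : ℝ) (y : ℝ) : EuclideanSpace ℝ (Fin 2) :=
  !₂[infl c t a b θ σ 1 y - ∫ z, infl c t a b θ σ 1 z ∂(paymentLaw c t T θ σ),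
    infl c t a b θ σ 2 y - ∫ z, infl c t a b θ σ 2 z ∂(paymentLaw c t T θ σ)]

/-- The normalized sum of the centred influence vectors. -/
noncomputable def inflSum (c t T a b θ σ : ℝ) (Y : ℕ → Ω → ℝ) (x : ℕ × Ω) :
    EuclideanSpace ℝ (Fin 2) :=
  (√(x.1 : ℝ))⁻¹ • ∑ i ∈ Finset.range x.1, inflVec c t T a b θ σ (Y i x.2)

lemma measurable_inflVec (c t T a b θ σ : ℝ) : Measurable (inflVec c t T a b θ σ) := by
  refine (WithLp.measurable_toLp 2 _).comp (measurable_pi_iff.2 fun i => ?_)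
  fin_cases i
  · exact (measurable_infl c t a b θ σ 1).sub_const _
  · exact (measurable_infl c t a b θ σ 2).sub_const _

lemma inflSum_eq (c t T a b θ σ : ℝ) (Y : ℕ → Ω → ℝ) (x : ℕ × Ω) :
    inflSum c t T a b θ σ Y x = !₂[empProc (paymentLaw c t T θ σ) Y (infl c t a b θ σ 1) x,
      empProc (paymentLaw c t T θ σ) Y (infl c t a b θ σ 2) x] := by
  rw [← inv_sqrt_mul_sum_eq_empProc, ← inv_sqrt_mul_sum_eq_empProc]
  ext i
  fin_cases i <;> simp [inflSum, inflVec]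

end SampleMoments

section Linearization

variable {Ω : Type*} [MeasurableSpace Ω] {μ : Measure Ω} [IsProbabilityMeasure μ]
  {Y : ℕ → Ω → ℝ} {c t T a b θ σ : ℝ}

lemma tendsto_stdMoment (hc : 0 < c) (htT : t < T) (hσ : 0 < σ)
    (ha : 0 ≤ a) (hab : a < 1 - b) (hb : 1 - b < sStar t T θ σ)
    (hindep : iIndepFun Y μ) (hlaw : ∀ i, HasLaw (Y i) (paymentLaw c t T θ σ) μ)
    {m m' : ℕ → Ω → ℕ}
    (hm : Tendsto (fun x : ℕ × Ω => √(x.1 : ℝ) * ((m x.1 x.2 : ℝ) / x.1 - a)) (inProb μ) (𝓝 0))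
    (hm' : Tendsto (fun x : ℕ × Ω => √(x.1 : ℝ) * ((m' x.1 x.2 : ℝ) / x.1 - b))
      (inProb μ) (𝓝 0)) (k : ℕ) :
    Tendsto (fun x => √(x.1 : ℝ) * (stdMoment c t θ σ Y m m' k x - cy a b (gam t θ σ) k)
      - empProc (paymentLaw c t T θ σ) Y (infl c t a b θ σ k) x) (inProb μ) (𝓝 0) := by
  have hb0 : 0 < b := by linarith [sStar_lt_one (t := t) (T := T) (θ := θ) hσ]
  have h1b : 0 < 1 - b := ha.trans_lt hab
  have hP := one_sub_Phi_pos (gam t θ σ)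
  have hpa := phi_pos (Delta (gam t θ σ) a)
  have hpb := phi_pos (Delta (gam t θ σ) (1 - b))
  have h := tendsto_winsorized hindep hlaw (contDiff_stdPow c t θ σ k) hab
    (payQ_lt_payQ hc hσ ha hab (by linarith)).le (cdf_payQ hc hσ ha (hab.trans hb))
    (cdf_payQ hc hσ h1b.le hb) hm hm' (fun u hu => lt_cdf_paymentLaw hc hσ ha (hab.trans hb) hu)
    (fun u hu => by
      rcases ha.eq_or_lt with h0 | h0
      · right
        rw [← h0, payQ_zero hσ] at hu
        exact cdf_paymentLaw_of_neg hc htT hσ hu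
      · exact Or.inl (cdf_paymentLaw_lt hc htT hσ h0 (hab.trans hb) hu))
    (fun h0 => ⟨hasDerivAt_cdf_payQ hc hσ h0 (hab.trans hb), by positivity⟩)
    (hasDerivAt_cdf_payQ hc hσ h1b hb) (by positivity)
    (hasDerivAt_stdPow hc hσ k a) (hasDerivAt_stdPow hc hσ k (1 - b))
  rw [integral_stdPow_wins hc htT hσ ha hab hb] at h
  have e1 : a * (k * Delta (gam t θ σ) a ^ (k - 1) / (c * σ) /
      (phi (Delta (gam t θ σ) a) / (c * σ * (1 - Phi (gam t θ σ))))) = cyDa a (gam t θ σ) k := by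
    rw [cyDa]
    field_simp
  have e2 : b * (k * Delta (gam t θ σ) (1 - b) ^ (k - 1) / (c * σ) /
      (phi (Delta (gam t θ σ) (1 - b)) / (c * σ * (1 - Phi (gam t θ σ))))) =
      -cyDb b (gam t θ σ) k := by
    rw [cyDb, neg_neg]
    field_simp
  rw [e1, e2] at h
  exact h

lemma tight_inflSum (hc : 0 < c) (hσ : 0 < σ)
    (ha : 0 ≤ a) (hab : a < 1 - b) (hb : 0 < b)
    (hindep : iIndepFun Y μ) (hlaw : ∀ i, HasLaw (Y i) (paymentLaw c t T θ σ) μ) :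
    Tight μ (inflSum c t T a b θ σ Y) := by
  have h : ∀ k, Tight μ fun x => ‖empProc (paymentLaw c t T θ σ) Y (infl c t a b θ σ k) x‖ := by
    intro k
    obtain ⟨C, hC⟩ := exists_bound_infl (t := t) (θ := θ) hc hσ ha hab hb k
    exact (tight_empProc hindep hlaw (measurable_infl c t a b θ σ k) hC).of_eventually_le 1 0
      (Eventually.of_forall fun x => by simp)
  refine ((h 1).add (h 2)).of_eventually_le 1 0 (Eventually.of_forall fun x => ?_)
  rw [inflSum_eq, one_mul, add_zero, Real.norm_eq_abs (_ + _),
    abs_of_nonneg (add_nonneg (norm_nonneg _) (norm_nonneg _)), EuclideanSpace.norm_eq,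
    Fin.sum_univ_two]
  refine Real.sqrt_le_iff.2 ⟨by positivity, ?_⟩
  simp only [Matrix.cons_val_zero, Matrix.cons_val_one]
  nlinarith [norm_nonneg (empProc (paymentLaw c t T θ σ) Y (infl c t a b θ σ 1) x),
    norm_nonneg (empProc (paymentLaw c t T θ σ) Y (infl c t a b θ σ 2) x)]

/-- The linear part of the affine map that takes the first two winsorized moments of
`(h_Y(y) - θ) / σ` to those of `h_Y(y)`. -/
noncomputable def destdMat (θ σ : ℝ) : Matrix (Fin 2) (Fin 2) ℝ :=
  !![σ, 0; 2 * θ * σ, σ ^ 2]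

lemma SigmaMat_eq (t a b θ σ : ℝ) :
    SigmaMat t a b θ σ = destdMat θ σ * inflCov a b (gam t θ σ) * (destdMat θ σ)ᵀ := by
  ext i j
  fin_cases i <;> fin_cases j <;>
    simp [SigmaMat, destdMat, inflCov, Matrix.mul_apply, Fin.sum_univ_two] <;> ring

/-- The sample winsorized moments are asymptotically linear. -/
lemma tendsto_sampleMoment (hc : 0 < c) (htT : t < T) (hσ : 0 < σ)
    (ha : 0 ≤ a) (hab : a < 1 - b) (hb : 1 - b < sStar t T θ σ)
    (hindep : iIndepFun Y μ) (hlaw : ∀ i, HasLaw (Y i) (paymentLaw c t T θ σ) μ)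
    {m m' : ℕ → Ω → ℕ}
    (hm : Tendsto (fun x : ℕ × Ω => √(x.1 : ℝ) * ((m x.1 x.2 : ℝ) / x.1 - a)) (inProb μ) (𝓝 0))
    (hm' : Tendsto (fun x : ℕ × Ω => √(x.1 : ℝ) * ((m' x.1 x.2 : ℝ) / x.1 - b))
      (inProb μ) (𝓝 0)) :
    Tendsto (fun x : ℕ × Ω => √(x.1 : ℝ) •
      (!₂[sampleMoment c t (fun i : Fin x.1 => Y i x.2) (m x.1 x.2) (m' x.1 x.2) 1,
          sampleMoment c t (fun i : Fin x.1 => Y i x.2) (m x.1 x.2) (m' x.1 x.2) 2]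
        - !₂[popMoment c t T a b θ σ 1, popMoment c t T a b θ σ 2])
      - Matrix.toEuclideanCLM (n := Fin 2) (𝕜 := ℝ) (destdMat θ σ)
          (inflSum c t T a b θ σ Y x)) (inProb μ) (𝓝 0) := by
  have h1 := tendsto_stdMoment hc htT hσ ha hab hb hindep hlaw hm hm' 1
  have h2 := tendsto_stdMoment hc htT hσ ha hab hb hindep hlaw hm hm' 2
  have hv : Tendsto (fun x => (!₂[√(x.1 : ℝ) * (stdMoment c t θ σ Y m m' 1 x
        - cy a b (gam t θ σ) 1) - empProc (paymentLaw c t T θ σ) Y (infl c t a b θ σ 1) x,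
      √(x.1 : ℝ) * (stdMoment c t θ σ Y m m' 2 x
        - cy a b (gam t θ σ) 2) - empProc (paymentLaw c t T θ σ) Y (infl c t a b θ σ 2) x]
          : EuclideanSpace ℝ (Fin 2))) (inProb μ) (𝓝 0) := by
    have h0 : (0 : EuclideanSpace ℝ (Fin 2)) = !₂[0, 0] := by
      ext i; fin_cases i <;> rfl
    rw [h0]
    refine ((PiLp.continuous_toLp 2 _).tendsto _).comp (tendsto_pi_nhds.2 fun i => ?_)
    fin_cases i
    · exact h1
    · exact h2
  have h := ((Matrix.toEuclideanCLM (n := Fin 2) (𝕜 := ℝ)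
    (destdMat θ σ)).continuous.tendsto 0).comp hv
  rw [map_zero] at h
  refine h.congr' ?_
  filter_upwards [eventually_add_lt hab hm hm'] with x hx
  rw [sampleMoment_one c t θ hσ Y hx, sampleMoment_two c t θ hσ Y hx,
    popMoment_one hc htT hσ ha hab hb, popMoment_two hc htT hσ ha hab hb, inflSum_eq]
  ext i
  fin_cases i
  · simp [destdMat]
    ring
  · simp [destdMat]
    ring

end Linearization

/-! ### The limit law -/

section Limit

variable {Ω : Type*} [MeasurableSpace Ω] {μ : Measure Ω} [IsProbabilityMeasure μ]
  {Y : ℕ → Ω → ℝ} {c t T a b θ σ : ℝ}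

lemma posSemidef_inflCov (hc : 0 < c) (htT : t < T) (hσ : 0 < σ)
    (ha : 0 ≤ a) (hab : a < 1 - b) (hb : 1 - b < sStar t T θ σ) :
    (inflCov a b (gam t θ σ)).PosSemidef := by
  refine Matrix.PosSemidef.of_dotProduct_mulVec_nonneg ?_ fun u => ?_
  · ext i j
    fin_cases i <;> fin_cases j <;> simp [inflCov]
  · rw [star_trivial, ← integral_inflComb_sq hc htT hσ ha hab hb u]
    exact integral_nonneg fun y => sq_nonneg _

open scoped RealInnerProductSpace in
lemma inner_toEuclideanCLM_inflVec (M : Matrix (Fin 2) (Fin 2) ℝ)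
    (u : EuclideanSpace ℝ (Fin 2)) (y : ℝ) :
    ⟪Matrix.toEuclideanCLM (n := Fin 2) (𝕜 := ℝ) M (inflVec c t T a b θ σ y), u⟫ =
      inflComb c t T a b θ σ (Mᵀ *ᵥ u) y := by
  rw [real_inner_comm, Matrix.inner_toEuclideanCLM, Matrix.dotProduct_mulVec,
    ← Matrix.mulVec_transpose]
  simp [inflComb, inflVec, dotProduct, Fin.sum_univ_two]

/-- The central limit theorem for linear images of the normalized sum of influence vectors. -/
lemma tendstoInDistribution_inflSum (hc : 0 < c) (htT : t < T) (hσ : 0 < σ)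
    (ha : 0 ≤ a) (hab : a < 1 - b) (hb : 1 - b < sStar t T θ σ)
    (hindep : iIndepFun Y μ) (hlaw : ∀ i, HasLaw (Y i) (paymentLaw c t T θ σ) μ)
    (M : Matrix (Fin 2) (Fin 2) ℝ) :
    TendstoInDistribution (fun (n : ℕ) ω => Matrix.toEuclideanCLM (n := Fin 2) (𝕜 := ℝ) M
        (inflSum c t T a b θ σ Y (n, ω))) atTop
      (id : EuclideanSpace ℝ (Fin 2) → EuclideanSpace ℝ (Fin 2)) (fun _ => μ)
      (multivariateGaussian 0 (M * inflCov a b (gam t θ σ) * Mᵀ)) := by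
  have hb0 : 0 < b := by linarith [sStar_lt_one (t := t) (T := T) (θ := θ) hσ]
  set φ : ℝ → EuclideanSpace ℝ (Fin 2) := fun y =>
    Matrix.toEuclideanCLM (n := Fin 2) (𝕜 := ℝ) M (inflVec c t T a b θ σ y) with hφ
  have hφm : Measurable φ :=
    (Matrix.toEuclideanCLM (n := Fin 2) (𝕜 := ℝ) M).measurable.comp (measurable_inflVec ..)
  have h := tendstoInDistribution_sum_multivariateGaussian (X := fun i ω => φ (Y i ω))
    (S := M * inflCov a b (gam t θ σ) * Mᵀ) (hindep.comp (fun _ => φ) fun _ => hφm)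
    (fun i => (IdentDistrib.mk (hlaw i).aemeasurable (hlaw 0).aemeasurable
      ((hlaw i).map_eq.trans (hlaw 0).map_eq.symm)).comp hφm)
    (by
      have := (posSemidef_inflCov hc htT hσ ha hab hb).mul_mul_conjTranspose_same M
      rwa [Matrix.conjTranspose_eq_transpose_of_trivial] at this)
    (fun u => by
      simp only [hφ, inner_toEuclideanCLM_inflVec]
      obtain ⟨C, hC⟩ := exists_bound_inflComb (t := t) (T := T) (θ := θ) hc hσ ha hab hb0 (Mᵀ *ᵥ u)
      exact MemLp.of_bound ((measurable_inflComb c t T a b θ σ _).comp_aemeasurable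
        (hlaw 0).aemeasurable).aestronglyMeasurable C (Eventually.of_forall fun ω => hC _))
    (fun u => by
      simp only [hφ, inner_toEuclideanCLM_inflVec]
      rw [← integral_inflComb (T := T) (t := t) (θ := θ) hc hσ ha hab hb0 (Mᵀ *ᵥ u)]
      exact (hlaw 0).integral_comp (measurable_inflComb ..).aestronglyMeasurable)
    (fun u => by
      simp only [hφ, inner_toEuclideanCLM_inflVec]
      have e := (hlaw 0).integral_comp (f := fun y => inflComb c t T a b θ σ (Mᵀ *ᵥ u) y ^ 2)
        ((measurable_inflComb ..).pow_const 2).aestronglyMeasurable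
      refine Eq.trans e ?_
      rw [integral_inflComb_sq hc htT hσ ha hab hb, ← Matrix.mulVec_mulVec,
        ← Matrix.mulVec_mulVec, Matrix.dotProduct_mulVec _ M, ← Matrix.mulVec_transpose])
  refine h.congr (fun n => Eventually.of_forall fun ω => ?_) (Eventually.of_forall fun _ => rfl)
  simp only [hφ, inflSum, map_smul, map_sum]

end Limit

end MWM

theorem mainTheorem1
    {Ω : Type*} [MeasurableSpace Ω] (μ : Measure Ω) [IsProbabilityMeasure μ]
    (c t T a b θ σ : ℝ) (hc : 0 < c) (htT : t < T) (hσ : 0 < σ)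
    (ha : 0 ≤ a) (hab : a < 1 - b) (hb : 1 - b < MWM.sStar t T θ σ)
    -- the i.i.d. sample
    (Y : ℕ → Ω → ℝ) (hindep : iIndepFun Y μ)
    (hlaw : ∀ i, HasLaw (Y i) (MWM.paymentLaw c t T θ σ) μ)
    -- the (possibly data-dependent) numbers of observations winsorized from below and from above
    (m mstar : ℕ → Ω → ℕ)
    (hm : TendstoInMeasure μ
      (fun (n : ℕ) ω => √(n : ℝ) * ((m n ω : ℝ) / (n : ℝ) - a)) atTop (fun _ => 0))
    (hmstar : TendstoInMeasure μ
      (fun (n : ℕ) ω => √(n : ℝ) * ((mstar n ω : ℝ) / (n : ℝ) - b)) atTop (fun _ => 0))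
    -- the sample winsorized moments
    (What : ℕ → ℕ → Ω → ℝ)
    (hWhat : ∀ k n ω, What k n ω =
      MWM.sampleMoment c t (fun i : Fin n => Y i ω) (m n ω) (mstar n ω) k)
    -- the estimator: a solution of the implicit equations whenever there is one
    (est : ℕ → Ω → EuclideanSpace ℝ (Fin 2)) (hest_meas : ∀ n, AEMeasurable (est n) μ)
    (hest : ∀ n, ∀ᵐ ω ∂μ,
      (∃ θ' σ' : ℝ, MWM.Solves t a b (What 1 n ω) (What 2 n ω) θ' σ') →
        MWM.Solves t a b (What 1 n ω) (What 2 n ω) (est n ω 0) (est n ω 1)) :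
    -- the listed expressions are the partial derivatives of the constants `c_{y,k}`
    (∀ k : ℕ,
      HasDerivAt (fun x => MWM.cy x b (MWM.gam t θ σ) k) (MWM.cyDa a (MWM.gam t θ σ) k) a ∧
      HasDerivAt (fun x => MWM.cy a x (MWM.gam t θ σ) k) (MWM.cyDb b (MWM.gam t θ σ) k) b ∧
      HasDerivAt (fun x => MWM.cy a b (MWM.gam t x σ) k) (MWM.cyDtheta t a b θ σ k) θ ∧
      HasDerivAt (fun x => MWM.cy a b (MWM.gam t θ x) k) (MWM.cyDsigma t a b θ σ k) σ) ∧
    -- `D_y` is the Jacobian at `(W_{y,1}, W_{y,2})` of the solution map of the implicit equations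
    (∃ g : EuclideanSpace ℝ (Fin 2) → EuclideanSpace ℝ (Fin 2),
      g !₂[MWM.popMoment c t T a b θ σ 1, MWM.popMoment c t T a b θ σ 2] = !₂[θ, σ] ∧
      (∀ᶠ w in 𝓝 !₂[MWM.popMoment c t T a b θ σ 1, MWM.popMoment c t T a b θ σ 2],
        MWM.Solves t a b (w 0) (w 1) (g w 0) (g w 1)) ∧
      HasFDerivAt g (Matrix.toEuclideanCLM (n := Fin 2) (𝕜 := ℝ) (MWM.DMat c t T a b θ σ))
        !₂[MWM.popMoment c t T a b θ σ 1, MWM.popMoment c t T a b θ σ 2]) ∧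
    -- with probability tending to one, the implicit equations have a solution
    Tendsto (fun n => μ {ω | ¬ ∃ θ' σ' : ℝ,
      MWM.Solves t a b (What 1 n ω) (What 2 n ω) θ' σ'}) atTop (𝓝 0) ∧
    -- asymptotic normality
    (MWM.SMat c t T a b θ σ).PosSemidef ∧
    TendstoInDistribution
      (fun (n : ℕ) ω => √(n : ℝ) • (est n ω - !₂[θ, σ])) atTop
      (id : EuclideanSpace ℝ (Fin 2) → EuclideanSpace ℝ (Fin 2)) (fun _ => μ)
      (multivariateGaussian 0 (MWM.SMat c t T a b θ σ)) := by
  have hb0 : 0 < b := by linarith [MWM.sStar_lt_one (t := t) (T := T) (θ := θ) hσ]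
  have hsol := MWM.solves_popMoment hc htT hσ ha hab hb
  have hV := MWM.wVar_eq hc htT hσ ha hab hb
  have hD := MWM.hasFDerivAt_solution ha hab hb0 hσ hV hsol
  set W : EuclideanSpace ℝ (Fin 2) :=
    !₂[MWM.popMoment c t T a b θ σ 1, MWM.popMoment c t T a b θ σ 2] with hW
  have hgW : MWM.solution t a b W = !₂[θ, σ] := MWM.solution_of_solves ha hab hb0 hsol
  have hev := MWM.eventually_solves_solution (W := W) ha hab hb0 hsol
  have hm' := (MWM.tendsto_inProb_iff_tendstoInMeasure
    (X := fun (n : ℕ) ω => √(n : ℝ) * ((m n ω : ℝ) / (n : ℝ) - a))).2 hm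
  have hmstar' := (MWM.tendsto_inProb_iff_tendstoInMeasure
    (X := fun (n : ℕ) ω => √(n : ℝ) * ((mstar n ω : ℝ) / (n : ℝ) - b))).2 hmstar
  have hlin := MWM.tendsto_sampleMoment hc htT hσ ha hab hb hindep hlaw hm' hmstar'
  simp only [← hWhat] at hlin
  set Wn : ℕ × Ω → EuclideanSpace ℝ (Fin 2) := fun x => !₂[What 1 x.1 x.2, What 2 x.1 x.2] with hWn
  have hZ : MWM.Tight μ fun x => Matrix.toEuclideanCLM (n := Fin 2) (𝕜 := ℝ)
      (MWM.destdMat θ σ) (MWM.inflSum c t T a b θ σ Y x) :=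
    (MWM.tight_inflSum hc hσ ha hab hb0 hindep hlaw).of_eventually_le _ 0
      (Eventually.of_forall fun x => by
        rw [add_zero]
        exact ContinuousLinearMap.le_opNorm _ _)
  have hcons : Tendsto Wn (MWM.inProb μ) (𝓝 W) :=
    MWM.tendsto_of_tight_sqrt (hZ.of_tendsto_sub hlin)
  have hsolv : ∀ᶠ x in MWM.inProb μ, MWM.Solves t a b (What 1 x.1 x.2) (What 2 x.1 x.2)
      (MWM.solution t a b (Wn x) 0) (MWM.solution t a b (Wn x) 1) := hcons.eventually hev
  have hdelta := MWM.tendsto_delta_method hD hZ hlin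
  -- by uniqueness, any solution is the value of the solution map
  have hest' : ∀ᶠ x in MWM.inProb μ, MWM.solution t a b (Wn x) = est x.1 x.2 := by
    filter_upwards [hsolv, MWM.eventually_inProb_of_ae (μ := μ)
      (p := fun x => (∃ θ' σ' : ℝ, MWM.Solves t a b (What 1 x.1 x.2) (What 2 x.1 x.2) θ' σ') →
        MWM.Solves t a b (What 1 x.1 x.2) (What 2 x.1 x.2) (est x.1 x.2 0) (est x.1 x.2 1))
      hest] with x hx hx'
    rw [MWM.solution_of_solves ha hab hb0 (w := Wn x) (hx' ⟨_, _, hx⟩)]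
    ext i
    fin_cases i <;> rfl
  have hS : MWM.SMat c t T a b θ σ = (MWM.DMat c t T a b θ σ * MWM.destdMat θ σ) *
      MWM.inflCov a b (MWM.gam t θ σ) * (MWM.DMat c t T a b θ σ * MWM.destdMat θ σ)ᵀ := by
    rw [MWM.SMat, MWM.SigmaMat_eq, Matrix.transpose_mul]
    simp only [Matrix.mul_assoc]
  refine ⟨fun k => ⟨MWM.hasDerivAt_cy_a ha hab hb0 _ k, MWM.hasDerivAt_cy_b ha hab hb0 _ k,
      MWM.hasDerivAt_cy_theta ha hab hb0 t θ σ k, MWM.hasDerivAt_cy_sigma ha hab hb0 t θ hσ.ne' k⟩,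
    ⟨MWM.solution t a b, hgW, hev, hD⟩, ?_, ?_, ?_⟩
  · exact (MWM.eventually_inProb (p := fun x => ∃ θ' σ' : ℝ,
      MWM.Solves t a b (What 1 x.1 x.2) (What 2 x.1 x.2) θ' σ')).1
        (hsolv.mono fun x hx => ⟨_, _, hx⟩)
  · have h := (MWM.posSemidef_inflCov hc htT hσ ha hab hb).mul_mul_conjTranspose_same
      (MWM.DMat c t T a b θ σ * MWM.destdMat θ σ)
    rwa [Matrix.conjTranspose_eq_transpose_of_trivial, ← hS] at h
  · have hclt := MWM.tendstoInDistribution_inflSum hc htT hσ ha hab hb hindep hlaw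
      (MWM.DMat c t T a b θ σ * MWM.destdMat θ σ)
    rw [← hS] at hclt
    refine tendstoInDistribution_of_tendstoInMeasure_sub _ _ hclt ?_
      fun n => ((hest_meas n).sub_const !₂[θ, σ]).const_smul (√(n : ℝ))
    refine (MWM.tendsto_inProb_iff_tendstoInMeasure (X := (fun (n : ℕ) ω =>
      √(n : ℝ) • (est n ω - !₂[θ, σ])) - fun (n : ℕ) ω => Matrix.toEuclideanCLM (n := Fin 2)
        (𝕜 := ℝ) (MWM.DMat c t T a b θ σ * MWM.destdMat θ σ)
          (MWM.inflSum c t T a b θ σ Y (n, ω)))).1 (hdelta.congr' ?_)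
    filter_upwards [hest'] with x hx
    rw [hx, hgW, map_mul]
    rfl
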